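/- All manifolds, bundles and tensors are real and smooth; metrics are symmetric, fibrewise non-degenerate bilinear forms of arbitrary signature unless positive definiteness is stated. **Definitions.** A *Frobenius algebra structure* $(\circ,e,g)$ along the fibers of a vector bundle consists of a fiberwise bilinear, commutative, associative multiplication $\circ$ with unit section $e$ and a metric $g$ on the bundle with $g(a\circ b,c)=g(a,b\circ c)$. An *almost Frobenius structure* on a manifold $N$ is such a structure on $TN$. It is *Frobenius* if (i) $L_{X\circ Y}(\circ)=X\circ L_Y(\circ)+Y\circ L_X(\circ)$ for all local vector fields $X,Y$, where $L_X(\circ)(Z,T)=[X,Z\circ T]-[X,Z]\circ T-Z\circ[X,T]$; and (ii) the Levi-Civita connection $\nabla$ of $g$ satisfies $\nabla e=0$ and is flat. **Setting.** Let $M$ be a manifold of dimension $n\ge 1$ with a semisimple Frobenius structure $(\circ_M,e_M,g_M)$ with non-vanishing rotation coefficients. That is, around each point there are coordinates $(u^1,\dots,u^n)$ that are *canonical*, $\frac{\partial}{\partial u^i}\circ_M\frac{\partial}{\partial u^j}=\delta_{ij}\frac{\partial}{\partial u^i}$, and a function $\eta$ with $g_M=\sum_{k=1}^n\eta_k\,du^k\otimes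 du^k$ such that for $i\ne j$ the functions $\gamma_{ij}=\eta_{ij}/\sqrt{\eta_i\eta_j}$ vanish nowhere (subscripts of $\eta$ denote partial derivatives with respect to the $u^k$; if $\eta_i\eta_j<0$ the square root is complex). Let $\pi:V\to M$ be a vector bundle of finite rank with a Frobenius algebra structure $(\circ_V,e_V,g_V)$ along its fibers, let $D$ be a connection on $V$, and let $\alpha:V\to TM$ be a bundle morphism with $$\alpha(e_V)=e_M,\qquad \alpha(v_1\circ_V v_2)=\alpha(v_1)\circ_M\alpha(v_2).$$ The connection $D$ splits $T_vV=T_pM\oplus V_p$ ($v\in V_p$) into horizontal and vertical vectors. Define on the manifold $V$ a multiplication $\circ$ and a symmetric bilinear form $g$ by $$\tilde X\circ\tilde Y=\widetilde{X\circ_MY},\quad v_1\circ v_2=v_1\circ_Vv_2,\quad v\circ\tilde X=\tilde X\circ v=\widetilde{\alpha(v)\circ_MX},$$ $$g(\tilde X,\tilde Y)=g_M(X,Y),\quad g(v_1,v_2)=g_V(v_1,v_2),\quad g(v,\tilde X)=g(\tilde X,v)=g_M(\alpha(v),X),$$ for $X,Y\in T_pM$ with horizontal lifts $\tilde X,\tilde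 Y$ and $v_1,v_2,v\in V_p$ regarded as vertical vectors; and view $e_V$ as a vertical vector field on $V$. **Theorem.** $(\circ,e_V,g)$ is a Frobenius structure on the manifold $V$ with $g$ positive definite if and only if the following hold: 1. $D$ is flat and the Frobenius algebra $(\circ_V,e_V,g_V)$ is $D$-parallel; 2. $\alpha=\lambda\otimes e_M$ for a $D$-parallel section $\lambda$ of $V^*$ with $\lambda(e_V)=1$ and $\lambda(s_1\circ_Vs_2)=\lambda(s_1)\lambda(s_2)$ for all $s_1,s_2$; 3. in all canonical coordinates $(u^1,\dots,u^n)$ on an open subset of $M$ in which $g_M=\sum_k\eta_k\,du^k\otimes du^k$ for a function $\eta$, one has $\eta_k>0$ for $1\le k\le n$, and $g_V-\left(\sum_{k=1}^n\eta_k\right)\lambda\otimes\lambda$ is positive definite. -/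

import Mathlib

open Set Bundle FiberBundle VectorField
open scoped Manifold ContDiff Topology

noncomputable section

namespace FrobBundle

section Bundles

/-! ### Algebra structures, metrics and connections on a smooth vector bundle

`B` is a real manifold, `W → B` a real vector bundle with model fibre `F`. Local sections over an
open set `U` are represented by sections on all of `B` whose values outside `U` are irrelevant. -/

variable {E : Type*} [NormedAddCommGroup E] [NormedSpace ℝ E]
  {H : Type*} [TopologicalSpace H] (I : ModelWithCorners ℝ E H)
  {B : Type*} [TopologicalSpace B] [ChartedSpace H B] [IsManifold I ∞ B]
  (F : Type*) [NormedAddCommGroup F] [NormedSpace ℝ F]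
  {W : B → Type*} [TopologicalSpace (TotalSpace F W)]
  [∀ x, AddCommGroup (W x)] [∀ x, Module ℝ (W x)] [∀ x, TopologicalSpace (W x)]
  [FiberBundle F W]

/-- The section `s` of `W` is smooth on the set `U`. -/
def SmoothOn (s : ∀ x, W x) (U : Set B) : Prop :=
  ContMDiffOn I (I.prod 𝓘(ℝ, F)) ∞ (fun x => TotalSpace.mk' F x (s x)) U

/-- `(mul, e, g)` is a structure of Frobenius algebra along the fibres of `W`: a smooth fibrewise
commutative associative multiplication `mul` with smooth unit section `e`, together with a smooth
(possibly indefinite) metric `g` on `W` which is invariant with respect to `mul`. -/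
structure IsFrobeniusAlgebraBundle (mul : ∀ x, W x →ₗ[ℝ] W x →ₗ[ℝ] W x) (e : ∀ x, W x)
    (g : ∀ x, LinearMap.BilinForm ℝ (W x)) : Prop where
  smooth_mul : ∀ U : Set B, IsOpen U → ∀ s t : ∀ x, W x, SmoothOn I F s U → SmoothOn I F t U →
    SmoothOn I F (fun x => mul x (s x) (t x)) U
  smooth_unit : SmoothOn I F e univ
  smooth_metric : ∀ U : Set B, IsOpen U → ∀ s t : ∀ x, W x, SmoothOn I F s U → SmoothOn I F t U →
    ContMDiffOn I 𝓘(ℝ, ℝ) ∞ (fun x => g x (s x) (t x)) U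
  mul_comm : ∀ x (a b : W x), mul x a b = mul x b a
  mul_assoc : ∀ x (a b c : W x), mul x (mul x a b) c = mul x a (mul x b c)
  unit_mul : ∀ x (a : W x), mul x (e x) a = a
  metric_symm : ∀ x, (g x).IsSymm
  metric_nondegenerate : ∀ x, (g x).Nondegenerate
  metric_invariant : ∀ x (a b c : W x), g x (mul x a b) c = g x a (mul x b c)

/-- The bilinear form `b` is positive definite. -/
def IsPosDef {T : Type*} [AddCommGroup T] [Module ℝ T] (b : LinearMap.BilinForm ℝ T) : Prop :=
  b.IsSymm ∧ ∀ v : T, v ≠ 0 → 0 < b v v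

variable [∀ x, IsTopologicalAddGroup (W x)] [∀ x, ContinuousSMul ℝ (W x)]

variable {I F} in
/-- The curvature `R(X, Y) s = D_X D_Y s - D_Y D_X s - D_[X, Y] s` of a connection. -/
def curvature (D : CovariantDerivative I F W) (X Y : ∀ x : B, TangentSpace I x) (s : ∀ x, W x)
    (x : B) : W x :=
  D (fun y => D s y (Y y)) x (X x) - D (fun y => D s y (X y)) x (Y x)
    - D s x (mlieBracket I X Y x)

variable {I F} in
/-- The connection `D` is flat. -/
def IsFlat (D : CovariantDerivative I F W) : Prop :=
  ∀ U : Set B, IsOpen U → ∀ (X Y : ∀ x : B, TangentSpace I x) (s : ∀ x, W x),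
    SmoothOn I E X U → SmoothOn I E Y U → SmoothOn I F s U → ∀ x ∈ U, curvature D X Y s x = 0

variable {I F} in
/-- The bilinear form `g` on the bundle `W` is `D`-parallel. -/
def IsParallelMetric (D : CovariantDerivative I F W) (g : ∀ x, LinearMap.BilinForm ℝ (W x)) :
    Prop :=
  ∀ U : Set B, IsOpen U → ∀ s t : ∀ x, W x, SmoothOn I F s U → SmoothOn I F t U →
    ∀ x ∈ U, ∀ X : TangentSpace I x,
      mvfderiv I (fun y => g y (s y) (t y)) x X = g x (D s x X) (t x) + g x (s x) (D t x X)

variable {I F} in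
/-- The fibrewise multiplication `mul` on `W` is `D`-parallel. -/
def IsParallelMul (D : CovariantDerivative I F W) (mul : ∀ x, W x →ₗ[ℝ] W x →ₗ[ℝ] W x) : Prop :=
  ∀ U : Set B, IsOpen U → ∀ s t : ∀ x, W x, SmoothOn I F s U → SmoothOn I F t U →
    ∀ x ∈ U, ∀ X : TangentSpace I x,
      D (fun y => mul y (s y) (t y)) x X = mul x (D s x X) (t x) + mul x (s x) (D t x X)

variable {I F} in
/-- The Frobenius algebra structure `(mul, e, g)` along the fibres of `W` is `D`-parallel. -/
def IsParallelFrobeniusAlgebra (D : CovariantDerivative I F W)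
    (mul : ∀ x, W x →ₗ[ℝ] W x →ₗ[ℝ] W x) (e : ∀ x, W x) (g : ∀ x, LinearMap.BilinForm ℝ (W x)) :
    Prop :=
  IsParallelMul D mul ∧ (∀ x, D e x = 0) ∧ IsParallelMetric D g

/-- The fibrewise linear functional `l` is a smooth section of the dual bundle of `W`. -/
def IsSmoothFunctional (l : ∀ x, W x →ₗ[ℝ] ℝ) : Prop :=
  ∀ U : Set B, IsOpen U → ∀ s : ∀ x, W x, SmoothOn I F s U →
    ContMDiffOn I 𝓘(ℝ, ℝ) ∞ (fun x => l x (s x)) U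

variable {I F} in
/-- The section `l` of the dual bundle of `W` is `D`-parallel. -/
def IsParallelFunctional (D : CovariantDerivative I F W) (l : ∀ x, W x →ₗ[ℝ] ℝ) : Prop :=
  ∀ U : Set B, IsOpen U → ∀ s : ∀ x, W x, SmoothOn I F s U →
    ∀ x ∈ U, ∀ X : TangentSpace I x, mvfderiv I (fun y => l y (s y)) x X = l x (D s x X)

/-- `a` is a smooth bundle morphism from `W` to the tangent bundle of the base. -/
def IsSmoothMorphism (a : ∀ x, W x →ₗ[ℝ] TangentSpace I x) : Prop :=
  ∀ U : Set B, IsOpen U → ∀ s : ∀ x, W x, SmoothOn I F s U → SmoothOn I E (fun x => a x (s x)) U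

end Bundles

section Frobenius

/-! ### Frobenius manifolds -/

variable {E : Type*} [NormedAddCommGroup E] [NormedSpace ℝ E] [FiniteDimensional ℝ E]
  {H : Type*} [TopologicalSpace H] (I : ModelWithCorners ℝ E H)
  {M : Type*} [TopologicalSpace M] [ChartedSpace H M] [IsManifold I ∞ M]

/-- An almost Frobenius structure on the manifold `M`. -/
abbrev IsAlmostFrobenius
    (mul : ∀ x : M, TangentSpace I x →ₗ[ℝ] TangentSpace I x →ₗ[ℝ] TangentSpace I x)
    (e : ∀ x : M, TangentSpace I x) (g : ∀ x : M, LinearMap.BilinForm ℝ (TangentSpace I x)) :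
    Prop :=
  IsFrobeniusAlgebraBundle I E (W := (TangentSpace I : M → Type _)) mul e g

/-- The Lie derivative of a multiplication on the tangent bundle:
`L_X(∘)(Z, T) = [X, Z ∘ T] - [X, Z] ∘ T - Z ∘ [X, T]`. -/
def lieDerivMul (mul : ∀ x : M, TangentSpace I x →ₗ[ℝ] TangentSpace I x →ₗ[ℝ] TangentSpace I x)
    (X Z T : ∀ x : M, TangentSpace I x) (x : M) : TangentSpace I x :=
  mlieBracket I X (fun y => mul y (Z y) (T y)) x - mul x (mlieBracket I X Z x) (T x)
    - mul x (Z x) (mlieBracket I X T x)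

/-- The condition `L_{X ∘ Y}(∘) = X ∘ L_Y(∘) + Y ∘ L_X(∘)` defining `F`-manifolds. -/
def IsFMultiplication
    (mul : ∀ x : M, TangentSpace I x →ₗ[ℝ] TangentSpace I x →ₗ[ℝ] TangentSpace I x) : Prop :=
  ∀ U : Set M, IsOpen U → ∀ X Y Z T : ∀ x : M, TangentSpace I x,
    SmoothOn I E X U → SmoothOn I E Y U → SmoothOn I E Z U → SmoothOn I E T U → ∀ x ∈ U,
      lieDerivMul I mul (fun y => mul y (X y) (Y y)) Z T x =
        mul x (X x) (lieDerivMul I mul Y Z T x) + mul x (Y x) (lieDerivMul I mul X Z T x)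

variable {I} in
/-- `nabla` is the Levi-Civita connection of the (possibly indefinite) metric `g`: it is
torsion-free and `g` is parallel. -/
def IsLeviCivita (nabla : CovariantDerivative I E (TangentSpace I : M → Type _))
    (g : ∀ x : M, LinearMap.BilinForm ℝ (TangentSpace I x)) : Prop :=
  nabla.torsion = 0 ∧ IsParallelMetric nabla g

/-- `(mul, e, g)` is a Frobenius structure on the manifold `M`: an almost Frobenius structure whose
multiplication makes `M` an `F`-manifold, and whose metric is admissible (the unit field is parallel
for the Levi-Civita connection) and flat. -/
structure IsFrobenius
    (mul : ∀ x : M, TangentSpace I x →ₗ[ℝ] TangentSpace I x →ₗ[ℝ] TangentSpace I x)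
    (e : ∀ x : M, TangentSpace I x) (g : ∀ x : M, LinearMap.BilinForm ℝ (TangentSpace I x)) :
    Prop where
  almostFrobenius : IsAlmostFrobenius I mul e g
  fMultiplication : IsFMultiplication I mul
  admissible_flat : ∃ nabla : CovariantDerivative I E (TangentSpace I : M → Type _),
    IsLeviCivita nabla g ∧ (∀ x, nabla e x = 0) ∧ IsFlat nabla

end Frobenius

section Canonical

/-! ### Canonical coordinates, metric potential, rotation coefficients -/

variable {n : ℕ} {M : Type*} [TopologicalSpace M] [ChartedSpace (EuclideanSpace ℝ (Fin n)) M]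

/-- The coordinate vector field `∂/∂u^k` of the chart `u = (u^1, …, u^n)`; used on `u.source`. -/
def coordField (u : OpenPartialHomeomorph M (EuclideanSpace ℝ (Fin n))) (k : Fin n) (p : M) :
    TangentSpace (𝓡 n) p :=
  let dusymm : EuclideanSpace ℝ (Fin n) →L[ℝ] TangentSpace (𝓡 n) p :=
    mfderiv (𝓡 n) (𝓡 n) u.symm (u p)
  dusymm (EuclideanSpace.single k 1)

/-- The partial derivative `∂f/∂u^k` in the chart `u`. -/
def coordDeriv (u : OpenPartialHomeomorph M (EuclideanSpace ℝ (Fin n))) (k : Fin n) (f : M → ℝ)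
    (p : M) : ℝ :=
  mvfderiv (𝓡 n) f p (coordField u k p)

/-- `u` is a system of canonical coordinates on `u.source`, for the multiplication `mul`:
`∂/∂u^i ∘ ∂/∂u^j = δ_ij ∂/∂u^i`. -/
def IsCanonical
    (mul : ∀ x : M, TangentSpace (𝓡 n) x →ₗ[ℝ] TangentSpace (𝓡 n) x →ₗ[ℝ] TangentSpace (𝓡 n) x)
    (u : OpenPartialHomeomorph M (EuclideanSpace ℝ (Fin n))) : Prop :=
  u ∈ IsManifold.maximalAtlas (𝓡 n) ∞ M ∧ ∀ p ∈ u.source, ∀ i j : Fin n,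
    mul p (coordField u i p) (coordField u j p) = if i = j then coordField u i p else 0

/-- `η` is a metric potential in the chart `u`: on `u.source`, the metric is
`g = ∑ k, η_k du^k ⊗ du^k`, where `η_k = ∂η/∂u^k`. -/
def IsMetricPotential (g : ∀ x : M, LinearMap.BilinForm ℝ (TangentSpace (𝓡 n) x))
    (u : OpenPartialHomeomorph M (EuclideanSpace ℝ (Fin n))) (η : M → ℝ) : Prop :=
  ContMDiffOn (𝓡 n) 𝓘(ℝ, ℝ) ∞ η u.source ∧ ∀ p ∈ u.source, ∀ i j : Fin n,
    g p (coordField u i p) (coordField u j p) = if i = j then coordDeriv u i η p else 0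

/-- The rotation coefficient `γ_ij = η_ij / √(η_i η_j)`. As the metric may be indefinite, the square
root is a complex one (when `η_i η_j > 0`, it is the usual positive square root). -/
def rotationCoeff (u : OpenPartialHomeomorph M (EuclideanSpace ℝ (Fin n))) (η : M → ℝ)
    (i j : Fin n) (p : M) : ℂ :=
  (coordDeriv u j (coordDeriv u i η) p : ℂ) /
    ((coordDeriv u i η p * coordDeriv u j η p : ℝ) : ℂ) ^ (1 / 2 : ℂ)

/-- `(mul, e, g)` is a semisimple Frobenius structure on `M` with non-vanishing rotation
coefficients: around each point there are canonical coordinates `u` in which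
`g = ∑ k, η_k du^k ⊗ du^k` for a function `η`, with `γ_ij ≠ 0` everywhere for all `i ≠ j`. -/
def IsSemisimpleFrobeniusWithRotation [IsManifold (𝓡 n) ∞ M]
    (mul : ∀ x : M, TangentSpace (𝓡 n) x →ₗ[ℝ] TangentSpace (𝓡 n) x →ₗ[ℝ] TangentSpace (𝓡 n) x)
    (e : ∀ x : M, TangentSpace (𝓡 n) x)
    (g : ∀ x : M, LinearMap.BilinForm ℝ (TangentSpace (𝓡 n) x)) : Prop :=
  IsFrobenius (𝓡 n) mul e g ∧
    ∀ p : M, ∃ (u : OpenPartialHomeomorph M (EuclideanSpace ℝ (Fin n))) (η : M → ℝ),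
      p ∈ u.source ∧ IsCanonical mul u ∧ IsMetricPotential g u η ∧
        ∀ q ∈ u.source, ∀ i j : Fin n, i ≠ j → rotationCoeff u η i j q ≠ 0

end Canonical

section TotalSpaceStructure

/-! ### The induced structure on the total space of a vector bundle with connection -/

variable {E : Type*} [NormedAddCommGroup E] [NormedSpace ℝ E]
  {H : Type*} [TopologicalSpace H] {I : ModelWithCorners ℝ E H}
  {M : Type*} [TopologicalSpace M] [ChartedSpace H M]
  {F : Type*} [NormedAddCommGroup F] [NormedSpace ℝ F]
  {V : M → Type*} [TopologicalSpace (TotalSpace F V)]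
  [∀ x, AddCommGroup (V x)] [∀ x, Module ℝ (V x)] [∀ x, TopologicalSpace (V x)]
  [FiberBundle F V] [VectorBundle ℝ F V]

variable (I) in
/-- The differential at `v` of the bundle projection `V → M`. -/
def projDeriv (v : TotalSpace F V) :
    TangentSpace (I.prod 𝓘(ℝ, F)) v →L[ℝ] TangentSpace I v.proj :=
  mfderiv (I.prod 𝓘(ℝ, F)) I (TotalSpace.proj : TotalSpace F V → M) v

variable (I) in
/-- The identification of the fibre `V_p` with the vertical tangent space at `v ∈ V_p`: it maps `w`
to the velocity at `0` of `t ↦ v + t w`. It is written as the differential at `0` of the map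
`f ↦ v + φ f`, for the linear isomorphism `φ : F → V_p` given by the trivialization, precomposed
with the inverse of `φ`. -/
def vertLift (v : TotalSpace F V) : V v.proj →L[ℝ] TangentSpace (I.prod 𝓘(ℝ, F)) v :=
  let dι : F →L[ℝ] TangentSpace (I.prod 𝓘(ℝ, F)) v :=
    mfderiv 𝓘(ℝ, F) (I.prod 𝓘(ℝ, F)) (fun f : F => TotalSpace.mk' F v.proj
      (v.2 + (trivializationAt F V v.proj).symmL ℝ v.proj f)) 0
  dι ∘L (trivializationAt F V v.proj).continuousLinearMapAt ℝ v.proj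

variable [∀ x, IsTopologicalAddGroup (V x)] [∀ x, ContinuousSMul ℝ (V x)]

/-- The `D`-horizontal lift at `v ∈ V_p` of `X ∈ T_p M`: it is `ds(X) - D_X s` (the second term being
viewed as a vertical vector) for a section `s` with `s(p) = v`. The section used is the one that is
constant in the trivialization; the result does not depend on this choice. -/
def horLift (D : CovariantDerivative I F V) (v : TotalSpace F V) :
    TangentSpace I v.proj →L[ℝ] TangentSpace (I.prod 𝓘(ℝ, F)) v :=
  let ds : TangentSpace I v.proj →L[ℝ] TangentSpace (I.prod 𝓘(ℝ, F)) v :=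
    mfderiv I (I.prod 𝓘(ℝ, F)) (fun x => TotalSpace.mk' F x (extend F v.2 x)) v.proj
  ds - vertLift I v ∘L D (extend F v.2) v.proj

/-- The `D`-vertical component, as an element of the fibre `V_p`, of a tangent vector at
`v ∈ V_p`. -/
def vertPart (D : CovariantDerivative I F V) (v : TotalSpace F V) :
    TangentSpace (I.prod 𝓘(ℝ, F)) v →L[ℝ] V v.proj :=
  (trivializationAt F V v.proj).symmL ℝ v.proj ∘L
    mvfderiv (I.prod 𝓘(ℝ, F)) (fun w : TotalSpace F V => (trivializationAt F V v.proj w).2) v +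
  D (extend F v.2) v.proj ∘L projDeriv I v

/-- The multiplication on the tangent bundle of the manifold `V`: with `T_v V = T_p M ⊕ V_p` (the
horizontal and vertical subspaces),
`X ∘ Y = X ∘_M Y`, `v₁ ∘ v₂ = v₁ ∘_V v₂`, `v ∘ X = X ∘ v = α(v) ∘_M X`. -/
def totalMul (D : CovariantDerivative I F V)
    (mulM : ∀ x : M, TangentSpace I x →ₗ[ℝ] TangentSpace I x →ₗ[ℝ] TangentSpace I x)
    (mulV : ∀ x, V x →ₗ[ℝ] V x →ₗ[ℝ] V x) (α : ∀ x, V x →ₗ[ℝ] TangentSpace I x)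
    (v : TotalSpace F V) :
    TangentSpace (I.prod 𝓘(ℝ, F)) v →ₗ[ℝ] TangentSpace (I.prod 𝓘(ℝ, F)) v →ₗ[ℝ]
      TangentSpace (I.prod 𝓘(ℝ, F)) v :=
  LinearMap.mk₂ ℝ (fun A B =>
      horLift D v (mulM v.proj (projDeriv I v A) (projDeriv I v B) +
        mulM v.proj (α v.proj (vertPart D v A)) (projDeriv I v B) +
        mulM v.proj (α v.proj (vertPart D v B)) (projDeriv I v A)) +
      vertLift I v (mulV v.proj (vertPart D v A) (vertPart D v B)))
    (fun A A' B => by simp only [map_add, LinearMap.add_apply]; abel)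
    (fun c A B => by simp only [map_smul, map_add, LinearMap.smul_apply, smul_add])
    (fun A B B' => by simp only [map_add, LinearMap.add_apply]; abel)
    (fun c A B => by simp only [map_smul, map_add, LinearMap.smul_apply, smul_add])

variable (I) in
/-- The section `eV`, viewed as a vertical vector field on the manifold `V`. -/
def totalUnit (eV : ∀ x, V x) (v : TotalSpace F V) : TangentSpace (I.prod 𝓘(ℝ, F)) v :=
  vertLift I v (eV v.proj)

/-- The metric on the manifold `V`: `g(X, Y) = g_M(X, Y)`, `g(v₁, v₂) = g_V(v₁, v₂)` and
`g(v, X) = g(X, v) = g_M(α(v), X)`, for `X`, `Y` horizontal and `v`, `v₁`, `v₂` vertical. -/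
def totalMetric (D : CovariantDerivative I F V)
    (gM : ∀ x : M, LinearMap.BilinForm ℝ (TangentSpace I x))
    (gV : ∀ x, LinearMap.BilinForm ℝ (V x)) (α : ∀ x, V x →ₗ[ℝ] TangentSpace I x)
    (v : TotalSpace F V) : LinearMap.BilinForm ℝ (TangentSpace (I.prod 𝓘(ℝ, F)) v) :=
  LinearMap.mk₂ ℝ (fun A B =>
      gM v.proj (projDeriv I v A) (projDeriv I v B) +
      gM v.proj (α v.proj (vertPart D v A)) (projDeriv I v B) +
      gM v.proj (α v.proj (vertPart D v B)) (projDeriv I v A) +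
      gV v.proj (vertPart D v A) (vertPart D v B))
    (fun A A' B => by simp only [map_add, LinearMap.add_apply]; abel)
    (fun c A B => by simp only [map_smul, LinearMap.smul_apply, smul_add])
    (fun A B B' => by simp only [map_add, LinearMap.add_apply]; abel)
    (fun c A B => by simp only [map_smul, LinearMap.smul_apply, smul_add])

end TotalSpaceStructure

end FrobBundle

end

set_option linter.unusedSectionVars false

noncomputable section

namespace FrobBundle

section Germs

variable {E : Type*} [NormedAddCommGroup E] [NormedSpace ℝ E]
  {H : Type*} [TopologicalSpace H] {I : ModelWithCorners ℝ E H}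
  {B : Type*} [TopologicalSpace B] [ChartedSpace H B]
  {F : Type*} [NormedAddCommGroup F] [NormedSpace ℝ F]
  {G : Type*} [NormedAddCommGroup G] [NormedSpace ℝ G]
  {W : B → Type*} [TopologicalSpace (TotalSpace F W)]
  [∀ x, AddCommGroup (W x)] [∀ x, Module ℝ (W x)] [∀ x, TopologicalSpace (W x)]
  [FiberBundle F W]

variable (I) in
/-- The function `f` is smooth in a neighbourhood of `x`. -/
def SmoothNear (f : B → G) (x : B) : Prop := ∀ᶠ y in 𝓝 x, ContMDiffAt I 𝓘(ℝ, G) ∞ f y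

variable (I F) in
/-- The section `s` is smooth in a neighbourhood of `x`. -/
def SmoothSec (s : ∀ x, W x) (x : B) : Prop :=
  ∀ᶠ y in 𝓝 x, ContMDiffAt I (I.prod 𝓘(ℝ, F)) ∞ (fun y => TotalSpace.mk' F y (s y)) y

variable {f h : B → G} {a b : B → ℝ} {s t : ∀ x, W x} {x : B}

lemma SmoothNear.contMDiffAt (hf : SmoothNear I f x) : ContMDiffAt I 𝓘(ℝ, G) ∞ f x :=
  hf.self_of_nhds

lemma SmoothNear.mdifferentiableAt (hf : SmoothNear I f x) : MDifferentiableAt I 𝓘(ℝ, G) f x :=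
  hf.contMDiffAt.mdifferentiableAt (by simp)

lemma SmoothNear.eventually (hf : SmoothNear I f x) : ∀ᶠ y in 𝓝 x, SmoothNear I f y :=
  Filter.Eventually.eventually_nhds hf

lemma SmoothNear.congr (hf : SmoothNear I f x) (hfh : ∀ᶠ y in 𝓝 x, h y = f y) :
    SmoothNear I h x := by
  filter_upwards [hf, hfh.eventually_nhds] with y hy hy'
  exact hy.congr_of_eventuallyEq hy'

lemma smoothNear_const (c : G) : SmoothNear I (fun _ : B => c) x :=
  Filter.Eventually.of_forall fun _ => contMDiffAt_const

lemma SmoothNear.add (hf : SmoothNear I f x) (hh : SmoothNear I h x) :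
    SmoothNear I (fun y => f y + h y) x := by
  filter_upwards [hf, hh] with y hy hy' using hy.add hy'

lemma SmoothNear.sub (hf : SmoothNear I f x) (hh : SmoothNear I h x) :
    SmoothNear I (fun y => f y - h y) x := by
  filter_upwards [hf, hh] with y hy hy' using hy.sub hy'

lemma SmoothNear.neg (hf : SmoothNear I f x) : SmoothNear I (fun y => - f y) x := by
  filter_upwards [hf] with y hy using hy.neg

lemma SmoothNear.mul (hf : SmoothNear I a x) (hh : SmoothNear I b x) :
    SmoothNear I (fun y => a y * b y) x := by
  filter_upwards [hf, hh] with y hy hy' using hy.mul hy'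

lemma SmoothNear.inv (hf : SmoothNear I a x) (h0 : a x ≠ 0) :
    SmoothNear I (fun y => (a y)⁻¹) x := by
  have := hf.contMDiffAt.continuousAt.eventually_ne h0
  filter_upwards [hf, this] with y hy hy' using hy.inv₀ hy'

lemma SmoothNear.sum {ι : Type*} {u : Finset ι} {f : ι → B → G}
    (hf : ∀ i ∈ u, SmoothNear I (f i) x) : SmoothNear I (fun y => ∑ i ∈ u, f i y) x := by
  classical
  induction u using Finset.induction_on with
  | empty => simpa using smoothNear_const (0 : G)
  | insert i u hi ih =>
    simp only [Finset.sum_insert hi]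
    exact (hf i (by simp)).add (ih fun j hj => hf j (by simp [hj]))

lemma SmoothNear.prod {ι : Type*} {u : Finset ι} {f : ι → B → ℝ}
    (hf : ∀ i ∈ u, SmoothNear I (f i) x) : SmoothNear I (fun y => ∏ i ∈ u, f i y) x := by
  classical
  induction u using Finset.induction_on with
  | empty => simpa using smoothNear_const (1 : ℝ)
  | insert i u hi ih =>
    simp only [Finset.prod_insert hi]
    exact (hf i (by simp)).mul (ih fun j hj => hf j (by simp [hj]))

lemma SmoothNear.clm_comp {G' : Type*} [NormedAddCommGroup G'] [NormedSpace ℝ G'] (L : G →L[ℝ] G')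
    (hf : SmoothNear I f x) : SmoothNear I (fun y => L (f y)) x := by
  filter_upwards [hf] with y hy using L.contMDiff.contMDiffAt.comp y hy

lemma SmoothNear.det {ι : Type*} [Fintype ι] [DecidableEq ι] {A : B → Matrix ι ι ℝ}
    (hA : ∀ i j, SmoothNear I (fun y => A y i j) x) : SmoothNear I (fun y => (A y).det) x := by
  simp only [Matrix.det_apply]
  refine .sum fun σ _ => ?_
  simp only [Units.smul_def, zsmul_eq_mul]
  exact (smoothNear_const _).mul (.prod fun i _ => hA _ _)

lemma SmoothNear.matrix_inv {ι : Type*} [Fintype ι] [DecidableEq ι] {A : B → Matrix ι ι ℝ}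
    (hA : ∀ i j, SmoothNear I (fun y => A y i j) x) (h0 : (A x).det ≠ 0) (i j : ι) :
    SmoothNear I (fun y => (A y)⁻¹ i j) x := by
  simp only [Matrix.inv_def, Ring.inverse_eq_inv', Matrix.smul_apply, smul_eq_mul]
  refine ((SmoothNear.det hA).inv h0).mul ?_
  simp only [Matrix.adjugate_apply]
  refine .det fun k l => ?_
  simp only [Matrix.updateRow_apply]
  split_ifs
  · exact smoothNear_const _
  · exact hA _ _

lemma SmoothSec.contMDiffAt (hs : SmoothSec I F s x) :
    ContMDiffAt I (I.prod 𝓘(ℝ, F)) ∞ (fun y => TotalSpace.mk' F y (s y)) x :=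
  hs.self_of_nhds

lemma SmoothSec.mdifferentiableAt (hs : SmoothSec I F s x) :
    MDifferentiableAt I (I.prod 𝓘(ℝ, F)) (fun y => TotalSpace.mk' F y (s y)) x :=
  hs.contMDiffAt.mdifferentiableAt (by simp)

lemma SmoothSec.eventually (hs : SmoothSec I F s x) : ∀ᶠ y in 𝓝 x, SmoothSec I F s y :=
  Filter.Eventually.eventually_nhds hs

lemma SmoothSec.congr (hs : SmoothSec I F s x) (hst : ∀ᶠ y in 𝓝 x, t y = s y) :
    SmoothSec I F t x := by
  filter_upwards [hs, hst.eventually_nhds] with y hy hy'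
  exact hy.congr_of_eventuallyEq (hy'.mono fun z hz => by simp [hz])

lemma SmoothSec.exists_smoothOn (hs : SmoothSec I F s x) :
    ∃ U : Set B, IsOpen U ∧ x ∈ U ∧ SmoothOn I F s U := by
  obtain ⟨U, hU, hUo, hxU⟩ := eventually_nhds_iff.1 hs
  exact ⟨U, hUo, hxU, fun y hy => (hU y hy).contMDiffWithinAt⟩

lemma SmoothOn.smoothSec {U : Set B} (hU : IsOpen U) (hs : SmoothOn I F s U) (hx : x ∈ U) :
    SmoothSec I F s x := by
  filter_upwards [hU.mem_nhds hx] with y hy using (hs y hy).contMDiffAt (hU.mem_nhds hy)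

lemma SmoothSec.exists_smoothOn₂ (hs : SmoothSec I F s x) (ht : SmoothSec I F t x) :
    ∃ U : Set B, IsOpen U ∧ x ∈ U ∧ SmoothOn I F s U ∧ SmoothOn I F t U := by
  obtain ⟨U, hU, hUo, hxU⟩ := eventually_nhds_iff.1 (Filter.Eventually.and hs ht)
  exact ⟨U, hUo, hxU, fun y hy => (hU y hy).1.contMDiffWithinAt,
    fun y hy => (hU y hy).2.contMDiffWithinAt⟩

lemma smoothNear_of_contMDiffOn {U : Set B} (hU : IsOpen U) (hf : ContMDiffOn I 𝓘(ℝ, G) ∞ f U)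
    (hx : x ∈ U) : SmoothNear I f x := by
  filter_upwards [hU.mem_nhds hx] with y hy using (hf y hy).contMDiffAt (hU.mem_nhds hy)

section Vector
variable [VectorBundle ℝ F W]

lemma SmoothSec.add (hs : SmoothSec I F s x) (ht : SmoothSec I F t x) :
    SmoothSec I F (fun y => s y + t y) x := by
  filter_upwards [hs, ht] with y hy hy' using hy.add_section hy'

lemma SmoothNear.smul (ha : SmoothNear I a x) (hs : SmoothSec I F s x) :
    SmoothSec I F (fun y => a y • s y) x := by
  filter_upwards [ha, hs] with y hy hy' using hy.smul_section hy'

lemma smoothSec_zero : SmoothSec I F (fun y => (0 : W y)) x :=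
  Filter.Eventually.of_forall fun _ => contMDiffAt_zeroSection ..

lemma SmoothSec.sum {ι : Type*} {u : Finset ι} {s : ι → ∀ x, W x}
    (hs : ∀ i ∈ u, SmoothSec I F (s i) x) : SmoothSec I F (fun y => ∑ i ∈ u, s i y) x := by
  classical
  induction u using Finset.induction_on with
  | empty => simpa using smoothSec_zero
  | insert i u hi ih =>
    simp only [Finset.sum_insert hi]
    exact (hs i (by simp)).add (ih fun j hj => hs j (by simp [hj]))

variable (I F) in
lemma smoothSec_extend [ContMDiffVectorBundle ∞ F W I] (v : W x) :
    SmoothSec I F (extend F v) x := by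
  obtain ⟨U, hU, h⟩ := exists_contMDiffOn_extend (k := ∞) I F v
  filter_upwards [eventually_mem_nhds_iff.2 hU] with y hy
  exact (h y (mem_of_mem_nhds hy)).contMDiffAt hy

/-- In a trivialization a section is smooth when its expression is. -/
lemma smoothSec_iff_trivialization [ContMDiffVectorBundle ∞ F W I]
    (e : Trivialization F (TotalSpace.proj : TotalSpace F W → B)) [MemTrivializationAtlas e]
    (hx : x ∈ e.baseSet) :
    SmoothSec I F s x ↔ SmoothNear I (fun y => (e ⟨y, s y⟩).2) x := by
  unfold SmoothSec SmoothNear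
  refine Filter.eventually_congr ?_
  filter_upwards [e.open_baseSet.mem_nhds hx] with y hy
  exact e.contMDiffAt_section_iff hy

end Vector

end Germs

section Tangent

variable {E : Type*} [NormedAddCommGroup E] [NormedSpace ℝ E]
  {H : Type*} [TopologicalSpace H] {I : ModelWithCorners ℝ E H}
  {B : Type*} [TopologicalSpace B] [ChartedSpace H B] [IsManifold I ∞ B]
  {G : Type*} [NormedAddCommGroup G] [NormedSpace ℝ G]
  {f h : B → ℝ} {X Y Z : ∀ x : B, TangentSpace I x} {x : B}

lemma SmoothNear.dirDeriv {f : B → G} (hf : SmoothNear I f x) (hX : SmoothSec I E X x) :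
    SmoothNear I (fun y => mvfderiv I f y (X y)) x := by
  obtain ⟨U, hU, hUo, hxU⟩ := eventually_nhds_iff.1 (Filter.Eventually.and hf hX)
  have h1 : ContMDiffOn I 𝓘(ℝ, G) ∞ f U := fun y hy => (hU y hy).1.contMDiffWithinAt
  have h2 := h1.contMDiffOn_tangentMapWithin (m := ∞) (by simp) hUo.uniqueMDiffOn
  have h3 : ContMDiffOn I (I.prod 𝓘(ℝ, E)) ∞ (fun y => TotalSpace.mk' E y (X y)) U :=
    fun y hy => (hU y hy).2.contMDiffWithinAt
  have h4 := (contMDiff_snd_tangentBundle_modelSpace G 𝓘(ℝ, G) (n := ∞)).comp_contMDiffOn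
    (h2.comp h3 (fun y hy => hy))
  refine smoothNear_of_contMDiffOn hUo (h4.congr fun y hy => ?_) hxU
  simp only [Function.comp, tangentMapWithin, mfderivWithin_of_isOpen hUo hy]
  rfl

end Tangent

section Bracket

variable {E : Type*} [NormedAddCommGroup E] [NormedSpace ℝ E] [CompleteSpace E]
  {H : Type*} [TopologicalSpace H] {I : ModelWithCorners ℝ E H}
  {B : Type*} [TopologicalSpace B] [ChartedSpace H B] [IsManifold I ∞ B]
  {f h : B → ℝ} {X Y Z : ∀ x : B, TangentSpace I x} {x : B}

lemma two_le_infty : (2 : WithTop ℕ∞) ≤ ∞ := WithTop.coe_le_coe.2 le_top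

lemma three_le_infty : (3 : WithTop ℕ∞) ≤ ∞ := WithTop.coe_le_coe.2 le_top

lemma isManifold_minSmoothness_two : IsManifold I (minSmoothness ℝ 2) B := by
  rw [minSmoothness_of_isRCLikeNormedField]
  exact .of_le two_le_infty

lemma isManifold_minSmoothness_three : IsManifold I (minSmoothness ℝ 3) B := by
  rw [minSmoothness_of_isRCLikeNormedField]
  exact .of_le three_le_infty

attribute [local instance] isManifold_minSmoothness_two isManifold_minSmoothness_three

lemma SmoothSec.mlieBracket (hX : SmoothSec I E X x) (hY : SmoothSec I E Y x) :
    SmoothSec I E (mlieBracket I X Y) x := by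
  have : IsManifold I ((⊤ : ℕ∞) + 1) B := by
    have h : ((⊤ : ℕ∞) : WithTop ℕ∞) + 1 = ∞ := by rfl
    rw [h]; infer_instance
  filter_upwards [hX, hY] with y hy hy'
  exact ContMDiffAt.mlieBracket_vectorField (m := ⊤) (n := ⊤) hy hy' (by simp)

lemma mlieBracket_fun_smul_right (hf : SmoothNear I f x) (hY : SmoothSec I E Y x) :
    mlieBracket I X (fun y => f y • Y y) x
      = mvfderiv I f x (X x) • Y x + f x • mlieBracket I X Y x :=
  mlieBracket_smul_right (V := X) hf.mdifferentiableAt hY.mdifferentiableAt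

lemma mlieBracket_fun_smul_left (hf : SmoothNear I f x) (hY : SmoothSec I E Y x) :
    mlieBracket I (fun y => f y • Y y) X x
      = - mvfderiv I f x (X x) • Y x + f x • mlieBracket I Y X x :=
  mlieBracket_smul_left (W := X) hf.mdifferentiableAt hY.mdifferentiableAt

lemma mlieBracket_fun_add_right (hY : SmoothSec I E Y x) (hZ : SmoothSec I E Z x) :
    mlieBracket I X (fun y => Y y + Z y) x = mlieBracket I X Y x + mlieBracket I X Z x :=
  mlieBracket_add_right (V := X) hY.mdifferentiableAt hZ.mdifferentiableAt

lemma mlieBracket_fun_add_left (hY : SmoothSec I E Y x) (hZ : SmoothSec I E Z x) :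
    mlieBracket I (fun y => Y y + Z y) X x = mlieBracket I Y X x + mlieBracket I Z X x :=
  mlieBracket_add_left (W := X) hY.mdifferentiableAt hZ.mdifferentiableAt

lemma mlieBracket_congr_right {Y' : ∀ x : B, TangentSpace I x} (h : ∀ᶠ y in 𝓝 x, Y y = Y' y) :
    mlieBracket I X Y x = mlieBracket I X Y' x :=
  Filter.EventuallyEq.mlieBracket_vectorField_eq (Filter.EventuallyEq.rfl) h

lemma mlieBracket_congr_left {Y' : ∀ x : B, TangentSpace I x} (h : ∀ᶠ y in 𝓝 x, Y y = Y' y) :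
    mlieBracket I Y X x = mlieBracket I Y' X x :=
  Filter.EventuallyEq.mlieBracket_vectorField_eq h (Filter.EventuallyEq.rfl)

lemma jacobi_mlieBracket (hX : SmoothSec I E X x) (hY : SmoothSec I E Y x)
    (hZ : SmoothSec I E Z x) :
    mlieBracket I X (mlieBracket I Y Z) x =
      mlieBracket I (mlieBracket I X Y) Z x + mlieBracket I Y (mlieBracket I X Z) x := by
  have h2 : minSmoothness ℝ 2 ≤ (∞ : WithTop ℕ∞) := by
    rw [minSmoothness_of_isRCLikeNormedField]; exact two_le_infty
  exact leibniz_identity_mlieBracket_apply (hX.contMDiffAt.of_le h2) (hY.contMDiffAt.of_le h2)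
    (hZ.contMDiffAt.of_le h2)

/-- The Lie bracket of vector fields is the commutator of the associated derivations. -/
lemma mvfderiv_mlieBracket (hf : SmoothNear I f x) (hX : SmoothSec I E X x)
    (hY : SmoothSec I E Y x) :
    mvfderiv I f x (mlieBracket I X Y x) =
      mvfderiv I (fun y => mvfderiv I f y (Y y)) x (X x) -
        mvfderiv I (fun y => mvfderiv I f y (X y)) x (Y x) := by
  rcases subsingleton_or_nontrivial E with hE | hE
  · have h0 (v : TangentSpace I x) : v = 0 := Subsingleton.elim (α := E) v 0
    rw [h0 (mlieBracket I X Y x), h0 (X x), h0 (Y x)]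
    simp
  obtain ⟨w, hw⟩ := exists_ne (0 : E)
  let w' : TangentSpace I x := w
  set Z : ∀ y, TangentSpace I y := extend E w' with hZdef
  have hZ : SmoothSec I E Z x := smoothSec_extend I E w'
  have hZx : Z x = w' := extend_apply_self ..
  have step (X Y : ∀ x : B, TangentSpace I x) (hX : SmoothSec I E X x) (hY : SmoothSec I E Y x) :
      mlieBracket I X (mlieBracket I Y (fun y => f y • Z y)) x =
        mvfderiv I (fun y => mvfderiv I f y (Y y)) x (X x) • Z x
        + mvfderiv I f x (Y x) • mlieBracket I X Z x
        + (mvfderiv I f x (X x) • mlieBracket I Y Z x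
        + f x • mlieBracket I X (mlieBracket I Y Z) x) := by
    have h1 : ∀ᶠ y in 𝓝 x, mlieBracket I Y (fun y => f y • Z y) y =
        mvfderiv I f y (Y y) • Z y + f y • mlieBracket I Y Z y := by
      filter_upwards [hf.eventually, hZ.eventually] with y hy hy'
      exact mlieBracket_fun_smul_right hy hy'
    rw [mlieBracket_congr_right h1,
      mlieBracket_fun_add_right ((hf.dirDeriv hY).smul hZ) (hf.smul (hY.mlieBracket hZ)),
      mlieBracket_fun_smul_right (hf.dirDeriv hY) hZ,
      mlieBracket_fun_smul_right hf (hY.mlieBracket hZ)]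
  have J := jacobi_mlieBracket hX hY (hf.smul hZ)
  have J' := jacobi_mlieBracket hX hY hZ
  rw [step X Y hX hY, step Y X hY hX, J', mlieBracket_fun_smul_right hf hZ] at J
  have key : (mvfderiv I f x (mlieBracket I X Y x) -
      (mvfderiv I (fun y => mvfderiv I f y (Y y)) x (X x) -
        mvfderiv I (fun y => mvfderiv I f y (X y)) x (Y x))) • w' = 0 := by
    rw [← hZx]
    rw [← sub_eq_zero] at J
    rw [← neg_eq_zero, ← J]
    module
  rcases smul_eq_zero.1 key with h | h
  · linarith
  · exact absurd h hw

end Bracket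

attribute [local instance] isManifold_minSmoothness_two isManifold_minSmoothness_three

section Separation

variable {E : Type*} [NormedAddCommGroup E] [NormedSpace ℝ E]
  {H : Type*} [TopologicalSpace H] {I : ModelWithCorners ℝ E H}
  {B : Type*} [TopologicalSpace B] [ChartedSpace H B] [IsManifold I ∞ B]

lemma smoothNear_extChartAt (x₀ : B) {x : B} (hx : x ∈ (chartAt H x₀).source) :
    SmoothNear I (extChartAt I x₀) x := by
  filter_upwards [(chartAt H x₀).open_source.mem_nhds hx] with y hy
  exact contMDiffAt_extChartAt' hy

lemma mvfderiv_extChartAt_injective (x : B) :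
    Function.Injective (mvfderiv I (extChartAt I x) x) := by
  intro v w h
  have := (isInvertible_mfderiv_extChartAt (I := I) (mem_extChartAt_source x)).injective
  exact this h

lemma mvfderiv_clm_comp {G : Type*} [NormedAddCommGroup G] [NormedSpace ℝ G]
    {G' : Type*} [NormedAddCommGroup G'] [NormedSpace ℝ G'] {f : B → G} {x : B}
    (L : G →L[ℝ] G') (hf : SmoothNear I f x) (v : TangentSpace I x) :
    mvfderiv I (fun y => L (f y)) x v = L (mvfderiv I f x v) := by
  have := mfderiv_comp x (g := L) (L.contMDiff.mdifferentiableAt (n := 1) one_ne_zero)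
    hf.mdifferentiableAt
  rw [mfderiv_eq_fderiv, L.fderiv] at this
  exact congr($this v)

/-- Tangent vectors are separated by the derivatives of smooth functions. -/
lemma tangent_ext {x : B} {v w : TangentSpace I x}
    (h : ∀ f : B → ℝ, SmoothNear I f x → mvfderiv I f x v = mvfderiv I f x w) : v = w := by
  apply mvfderiv_extChartAt_injective x
  have hc := smoothNear_extChartAt (I := I) x (mem_chart_source H x)
  apply (SeparatingDual.eq_iff_forall_dual_eq (R := ℝ)).2
  intro L
  have hL := h _ (hc.clm_comp L)
  rwa [mvfderiv_clm_comp L hc, mvfderiv_clm_comp L hc] at hL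

/-- A vector field is smooth when it maps smooth functions to smooth functions. -/
lemma smoothSec_of_mvfderiv [FiniteDimensional ℝ E] {x : B} {X : ∀ x : B, TangentSpace I x}
    (h : ∀ L : E →L[ℝ] ℝ, SmoothNear I (fun y => mvfderiv I (fun z => L (extChartAt I x z)) y (X y)) x) :
    SmoothSec I E X x := by
  rw [smoothSec_iff_trivialization (trivializationAt E (TangentSpace I) x)
    (mem_baseSet_trivializationAt' x)]
  let b := Module.finBasis ℝ E
  have key : SmoothNear I (fun y => ∑ i, mvfderiv I
      (fun z => (b.coord i).toContinuousLinearMap (extChartAt I x z)) y (X y) • b i) x := by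
    refine .sum fun i _ => ?_
    exact (h (b.coord i).toContinuousLinearMap).clm_comp ((ContinuousLinearMap.id ℝ ℝ).smulRight (b i))
  refine key.congr ?_
  filter_upwards [(chartAt H x).open_source.mem_nhds (mem_chart_source H x)] with y hy
  have hc := smoothNear_extChartAt (I := I) x hy
  have h1 (i) := mvfderiv_clm_comp (b.coord i).toContinuousLinearMap hc (X y)
  simp only [h1]
  simp only [LinearMap.coe_toContinuousLinearMap', Module.Basis.coord_apply]
  rw [b.sum_repr]
  have h2 := congr($(TangentBundle.continuousLinearMapAt_trivializationAt (I := I) hy) (X y))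
  rw [Trivialization.continuousLinearMapAt_apply, Trivialization.linearMapAt_apply, if_pos] at h2
  · exact h2
  · simpa using hy

end Separation

section Algebra

variable {E : Type*} [NormedAddCommGroup E] [NormedSpace ℝ E]
  {H : Type*} [TopologicalSpace H] {I : ModelWithCorners ℝ E H}
  {B : Type*} [TopologicalSpace B] [ChartedSpace H B] [IsManifold I ∞ B]
  {F : Type*} [NormedAddCommGroup F] [NormedSpace ℝ F]
  {W : B → Type*} [TopologicalSpace (TotalSpace F W)]
  [∀ x, AddCommGroup (W x)] [∀ x, Module ℝ (W x)] [∀ x, TopologicalSpace (W x)]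
  [FiberBundle F W]
  {mul : ∀ x, W x →ₗ[ℝ] W x →ₗ[ℝ] W x} {e : ∀ x, W x} {g : ∀ x, LinearMap.BilinForm ℝ (W x)}
  {s t σ : ∀ x, W x} {x : B}

lemma IsFrobeniusAlgebraBundle.smoothSec_mul (h : IsFrobeniusAlgebraBundle I F mul e g)
    (hs : SmoothSec I F s x) (ht : SmoothSec I F t x) :
    SmoothSec I F (fun y => mul y (s y) (t y)) x := by
  obtain ⟨U, hU, hx, hs', ht'⟩ := hs.exists_smoothOn₂ ht
  exact (h.smooth_mul U hU s t hs' ht').smoothSec hU hx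

lemma IsFrobeniusAlgebraBundle.smoothSec_unit (h : IsFrobeniusAlgebraBundle I F mul e g) (x : B) :
    SmoothSec I F e x :=
  h.smooth_unit.smoothSec isOpen_univ (mem_univ x)

lemma IsFrobeniusAlgebraBundle.smoothNear_metric (h : IsFrobeniusAlgebraBundle I F mul e g)
    (hs : SmoothSec I F s x) (ht : SmoothSec I F t x) :
    SmoothNear I (fun y => g y (s y) (t y)) x := by
  obtain ⟨U, hU, hx, hs', ht'⟩ := hs.exists_smoothOn₂ ht
  exact smoothNear_of_contMDiffOn hU (h.smooth_metric U hU s t hs' ht') hx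

lemma IsFrobeniusAlgebraBundle.symm (h : IsFrobeniusAlgebraBundle I F mul e g) (a b : W x) :
    g x a b = g x b a := (h.metric_symm x).eq a b

lemma IsFrobeniusAlgebraBundle.mul_unit (h : IsFrobeniusAlgebraBundle I F mul e g) (a : W x) :
    mul x a (e x) = a := by rw [h.mul_comm, h.unit_mul]

lemma IsFrobeniusAlgebraBundle.eq_of_metric_eq (h : IsFrobeniusAlgebraBundle I F mul e g)
    {a b : W x} (hab : ∀ c, g x a c = g x b c) : a = b := by
  rw [← sub_eq_zero]
  exact (h.metric_nondegenerate x).1 _ fun c => by simp [hab c]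

/-- A section is smooth when all its pairings with smooth sections are. -/
lemma IsFrobeniusAlgebraBundle.smoothSec_of_metric [FiniteDimensional ℝ F] [VectorBundle ℝ F W]
    [ContMDiffVectorBundle ∞ F W I]
    (h : IsFrobeniusAlgebraBundle I F mul e g)
    (hσ : ∀ t : ∀ x, W x, SmoothSec I F t x → SmoothNear I (fun y => g y (σ y) (t y)) x) :
    SmoothSec I F σ x := by
  classical
  let τ := trivializationAt F W x
  let b := Module.finBasis ℝ F
  let s := τ.localFrame b
  have hx : x ∈ τ.baseSet := mem_baseSet_trivializationAt' x
  have hs (i) : SmoothSec I F (s i) x := by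
    filter_upwards [τ.open_baseSet.mem_nhds hx] with y hy
    exact contMDiffAt_localFrame_of_mem ∞ τ b i hy
  let A : B → Matrix (Fin _) (Fin _) ℝ := fun y => Matrix.of fun i j => g y (s i y) (s j y)
  have hbasis {y} (hy : y ∈ τ.baseSet) (i) : s i y = τ.basisAt b hy i :=
    τ.localFrame_apply_of_mem_baseSet b hy
  have hA {y} (hy : y ∈ τ.baseSet) : A y = LinearMap.BilinForm.toMatrix (τ.basisAt b hy) (g y) := by
    ext i j
    simp only [A, Matrix.of_apply, LinearMap.BilinForm.toMatrix_apply, hbasis hy]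
  have hdet {y} (hy : y ∈ τ.baseSet) : (A y).det ≠ 0 := by
    rw [hA hy]
    exact (LinearMap.BilinForm.nondegenerate_iff_det_ne_zero _).1 (h.metric_nondegenerate y)
  have hAs (i j) : SmoothNear I (fun y => A y i j) x := h.smoothNear_metric (hs i) (hs j)
  have key : SmoothSec I F
      (fun y => ∑ i, (∑ j, g y (σ y) (s j y) * (A y)⁻¹ j i) • s i y) x :=
    .sum fun i _ => SmoothNear.smul
      (.sum fun j _ => (hσ _ (hs j)).mul (.matrix_inv hAs (hdet hx) j i)) (hs i)
  refine key.congr ?_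
  filter_upwards [τ.open_baseSet.mem_nhds hx] with y hy
  set c := (τ.basisAt b hy).repr (σ y)
  have h1 : σ y = ∑ i, c i • s i y := by
    simp only [hbasis hy]; exact ((τ.basisAt b hy).sum_repr _).symm
  have h2 (j) : g y (σ y) (s j y) = Matrix.vecMul c (A y) j := by
    rw [h1]; simp [Matrix.vecMul, dotProduct, A]
  conv_lhs => rw [h1]
  congr! 2 with i
  simp only [h2]
  change _ = Matrix.vecMul (Matrix.vecMul c (A y)) (A y)⁻¹ i
  rw [Matrix.vecMul_vecMul, Matrix.mul_nonsing_inv _ (isUnit_iff_ne_zero.2 (hdet hy)),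
    Matrix.vecMul_one]

end Algebra

section Connection

variable {E : Type*} [NormedAddCommGroup E] [NormedSpace ℝ E]
  {H : Type*} [TopologicalSpace H] {I : ModelWithCorners ℝ E H}
  {B : Type*} [TopologicalSpace B] [ChartedSpace H B] [IsManifold I ∞ B]
  {F : Type*} [NormedAddCommGroup F] [NormedSpace ℝ F]
  {W : B → Type*} [TopologicalSpace (TotalSpace F W)]
  [∀ x, AddCommGroup (W x)] [∀ x, Module ℝ (W x)] [∀ x, TopologicalSpace (W x)]
  [∀ x, IsTopologicalAddGroup (W x)] [∀ x, ContinuousSMul ℝ (W x)]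
  [FiberBundle F W] 
  {D : CovariantDerivative I F W} {f : B → ℝ} {s t : ∀ x, W x} {x : B}

lemma cov_add (hs : SmoothSec I F s x) (ht : SmoothSec I F t x) :
    D (fun y => s y + t y) x = D s x + D t x :=
  D.isCovariantDerivativeOnUniv.add hs.mdifferentiableAt ht.mdifferentiableAt

lemma cov_smul (hf : SmoothNear I f x) (hs : SmoothSec I F s x) (v : TangentSpace I x) :
    D (fun y => f y • s y) x v = f x • D s x v + mvfderiv I f x v • s x := by
  have := D.isCovariantDerivativeOnUniv.leibniz hs.mdifferentiableAt hf.mdifferentiableAt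
  exact congr($this v)

lemma cov_congr (hs : SmoothSec I F s x) (hst : ∀ᶠ y in 𝓝 x, t y = s y) : D t x = D s x :=
  D.isCovariantDerivativeOnUniv.congr_of_eventuallyEq (hs.congr hst).mdifferentiableAt
    hs.mdifferentiableAt Filter.univ_mem hst

lemma cov_zero [VectorBundle ℝ F W] (v : TangentSpace I x) :
    D (fun y => (0 : W y)) x v = 0 := by
  have := congr_fun D.zero x
  exact congr($this v)

lemma cov_sum [VectorBundle ℝ F W] {ι : Type*} {u : Finset ι} {s : ι → ∀ x, W x}
    (hs : ∀ i ∈ u, SmoothSec I F (s i) x) (v : TangentSpace I x) :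
    D (fun y => ∑ i ∈ u, s i y) x v = ∑ i ∈ u, D (s i) x v := by
  classical
  induction u using Finset.induction_on with
  | empty => simpa using cov_zero v
  | insert i u hi ih =>
    simp only [Finset.sum_insert hi]
    rw [cov_add (hs i (by simp)) (.sum fun j hj => hs j (by simp [hj])),
      add_apply, ih fun j hj => hs j (by simp [hj])]

lemma isParallelMetric_iff {g : ∀ x, LinearMap.BilinForm ℝ (W x)} :
    IsParallelMetric D g ↔ ∀ (s t : ∀ x, W x) (x : B), SmoothSec I F s x → SmoothSec I F t x →
      ∀ X : TangentSpace I x, mvfderiv I (fun y => g y (s y) (t y)) x X =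
        g x (D s x X) (t x) + g x (s x) (D t x X) := by
  constructor
  · intro h s t x hs ht X
    obtain ⟨U, hU, hx, hs', ht'⟩ := hs.exists_smoothOn₂ ht
    exact h U hU s t hs' ht' x hx X
  · intro h U hU s t hs ht x hx X
    exact h s t x (hs.smoothSec hU hx) (ht.smoothSec hU hx) X

lemma isParallelMul_iff {mul : ∀ x, W x →ₗ[ℝ] W x →ₗ[ℝ] W x} :
    IsParallelMul D mul ↔ ∀ (s t : ∀ x, W x) (x : B), SmoothSec I F s x → SmoothSec I F t x →
      ∀ X : TangentSpace I x, D (fun y => mul y (s y) (t y)) x X =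
        mul x (D s x X) (t x) + mul x (s x) (D t x X) := by
  constructor
  · intro h s t x hs ht X
    obtain ⟨U, hU, hx, hs', ht'⟩ := hs.exists_smoothOn₂ ht
    exact h U hU s t hs' ht' x hx X
  · intro h U hU s t hs ht x hx X
    exact h s t x (hs.smoothSec hU hx) (ht.smoothSec hU hx) X

lemma isParallelFunctional_iff {l : ∀ x, W x →ₗ[ℝ] ℝ} :
    IsParallelFunctional D l ↔ ∀ (s : ∀ x, W x) (x : B), SmoothSec I F s x →
      ∀ X : TangentSpace I x, mvfderiv I (fun y => l y (s y)) x X = l x (D s x X) := by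
  constructor
  · intro h s x hs X
    obtain ⟨U, hU, hx, hs'⟩ := hs.exists_smoothOn
    exact h U hU s hs' x hx X
  · intro h U hU s hs x hx X
    exact h s x (hs.smoothSec hU hx) X

lemma isSmoothFunctional_iff {l : ∀ x, W x →ₗ[ℝ] ℝ} :
    IsSmoothFunctional I F l ↔ ∀ (s : ∀ x, W x) (x : B), SmoothSec I F s x →
      SmoothNear I (fun y => l y (s y)) x := by
  constructor
  · intro h s x hs
    obtain ⟨U, hU, hx, hs'⟩ := hs.exists_smoothOn
    exact smoothNear_of_contMDiffOn hU (h U hU s hs') hx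
  · intro h U hU s hs x hx
    exact (h s x (hs.smoothSec hU hx)).contMDiffAt.contMDiffWithinAt

lemma isSmoothMorphism_iff {a : ∀ x, W x →ₗ[ℝ] TangentSpace I x} :
    IsSmoothMorphism I F a ↔ ∀ (s : ∀ x, W x) (x : B), SmoothSec I F s x →
      SmoothSec I E (fun y => a y (s y)) x := by
  constructor
  · intro h s x hs
    obtain ⟨U, hU, hx, hs'⟩ := hs.exists_smoothOn
    exact (h U hU s hs').smoothSec hU hx
  · intro h U hU s hs x hx
    exact (h s x (hs.smoothSec hU hx)).contMDiffAt.contMDiffWithinAt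

lemma isFlat_iff :
    IsFlat D ↔ ∀ (X Y : ∀ x : B, TangentSpace I x) (s : ∀ x, W x) (x : B),
      SmoothSec I E X x → SmoothSec I E Y x → SmoothSec I F s x → curvature D X Y s x = 0 := by
  constructor
  · intro h X Y s x hX hY hs
    obtain ⟨U, hU, hUo, hxU⟩ := eventually_nhds_iff.1 ((hX.and hY).and hs)
    exact h U hUo X Y s (fun y hy => (hU y hy).1.1.contMDiffWithinAt)
      (fun y hy => (hU y hy).1.2.contMDiffWithinAt)
      (fun y hy => (hU y hy).2.contMDiffWithinAt) x hxU
  · intro h U hU X Y s hX hY hs x hx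
    exact h X Y s x (hX.smoothSec hU hx) (hY.smoothSec hU hx) (hs.smoothSec hU hx)

variable (D) in
/-- The connection `D` maps germs of smooth sections to germs of smooth sections. -/
def IsSmoothCov : Prop := ∀ (X : ∀ x : B, TangentSpace I x) (s : ∀ x, W x) (x : B),
  SmoothSec I E X x → SmoothSec I F s x → SmoothSec I F (fun y => D s y (X y)) x

end Connection

section LeviCivita

variable {E : Type*} [NormedAddCommGroup E] [NormedSpace ℝ E] [FiniteDimensional ℝ E]
  {H : Type*} [TopologicalSpace H] {I : ModelWithCorners ℝ E H}
  {M : Type*} [TopologicalSpace M] [ChartedSpace H M] [IsManifold I ∞ M]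
  {mul : ∀ x : M, TangentSpace I x →ₗ[ℝ] TangentSpace I x →ₗ[ℝ] TangentSpace I x}
  {e : ∀ x : M, TangentSpace I x} {g : ∀ x : M, LinearMap.BilinForm ℝ (TangentSpace I x)}
  {nabla : CovariantDerivative I E (TangentSpace I : M → Type _)}
  {X Y Z T : ∀ x : M, TangentSpace I x} {x : M}

lemma IsLeviCivita.torsion_free (h : IsLeviCivita nabla g) (hX : SmoothSec I E X x)
    (hY : SmoothSec I E Y x) : nabla Y x (X x) - nabla X x (Y x) = mlieBracket I X Y x :=
  CovariantDerivative.torsion_eq_zero_iff _ |>.1 h.1 hX.mdifferentiableAt hY.mdifferentiableAt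

lemma IsLeviCivita.metric (h : IsLeviCivita nabla g) (hX : SmoothSec I E X x)
    (hY : SmoothSec I E Y x) (v : TangentSpace I x) :
    mvfderiv I (fun y => g y (X y) (Y y)) x v = g x (nabla X x v) (Y x) + g x (X x) (nabla Y x v) :=
  isParallelMetric_iff.1 h.2 X Y x hX hY v

lemma IsLeviCivita.koszul (h : IsLeviCivita nabla g) (hg : ∀ x, (g x).IsSymm)
    (hX : SmoothSec I E X x) (hY : SmoothSec I E Y x) (hZ : SmoothSec I E Z x) :
    2 * g x (nabla Y x (X x)) (Z x) =
      mvfderiv I (fun y => g y (Y y) (Z y)) x (X x) + mvfderiv I (fun y => g y (X y) (Z y)) x (Y x)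
      - mvfderiv I (fun y => g y (X y) (Y y)) x (Z x) + g x (mlieBracket I X Y x) (Z x)
      - g x (mlieBracket I X Z x) (Y x) - g x (mlieBracket I Y Z x) (X x) := by
  rw [h.metric hY hZ, h.metric hX hZ, h.metric hX hY, ← h.torsion_free hX hY,
    ← h.torsion_free hX hZ, ← h.torsion_free hY hZ]
  have hs (a b) : g x a b = g x b a := (hg x).eq a b
  simp only [map_sub, LinearMap.sub_apply]
  rw [hs (Y x), hs (X x) (nabla Z x (Y x)), hs (X x) (nabla Y x (Z x))]
  ring

lemma IsLeviCivita.isSmoothCov (h : IsLeviCivita nabla g) (hF : IsAlmostFrobenius I mul e g) :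
    IsSmoothCov nabla := by
  intro X Y x hX hY
  refine hF.smoothSec_of_metric fun Z hZ => ?_
  have key : SmoothNear I (fun x => (1 / 2 : ℝ) *
      (mvfderiv I (fun y => g y (Y y) (Z y)) x (X x) + mvfderiv I (fun y => g y (X y) (Z y)) x (Y x)
      - mvfderiv I (fun y => g y (X y) (Y y)) x (Z x) + g x (mlieBracket I X Y x) (Z x)
      - g x (mlieBracket I X Z x) (Y x) - g x (mlieBracket I Y Z x) (X x))) x :=
    (smoothNear_const _).mul ((((((hF.smoothNear_metric hY hZ).dirDeriv hX).add
      ((hF.smoothNear_metric hX hZ).dirDeriv hY)).sub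
      ((hF.smoothNear_metric hX hY).dirDeriv hZ)).add
      (hF.smoothNear_metric (hX.mlieBracket hY) hZ)).sub
      (hF.smoothNear_metric (hX.mlieBracket hZ) hY) |>.sub
      (hF.smoothNear_metric (hY.mlieBracket hZ) hX))
  refine key.congr ?_
  filter_upwards [hX.eventually, hY.eventually, hZ.eventually] with y h1 h2 h3
  rw [← h.koszul hF.metric_symm h1 h2 h3]
  ring

end LeviCivita

section Chain

variable {E : Type*} [NormedAddCommGroup E] [NormedSpace ℝ E]
  {H : Type*} [TopologicalSpace H] {I : ModelWithCorners ℝ E H}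
  {M : Type*} [TopologicalSpace M] [ChartedSpace H M]
  {E' : Type*} [NormedAddCommGroup E'] [NormedSpace ℝ E']
  {H' : Type*} [TopologicalSpace H'] {I' : ModelWithCorners ℝ E' H'}
  {M' : Type*} [TopologicalSpace M'] [ChartedSpace H' M']
  {G : Type*} [NormedAddCommGroup G] [NormedSpace ℝ G]

lemma mvfderiv_comp_mfderiv {f : M' → M} {g : M → G} {x : M'}
    (hg : MDifferentiableAt I 𝓘(ℝ, G) g (f x)) (hf : MDifferentiableAt I' I f x)
    (v : TangentSpace I' x) :
    mvfderiv I' (fun y => g (f y)) x v = mvfderiv I g (f x) (mfderiv I' I f x v) := by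
  have := mfderiv_comp x hg hf
  exact congr($this v)

lemma mfderiv_comp_apply_of_eq' {E'' : Type*} [NormedAddCommGroup E''] [NormedSpace ℝ E'']
    {H'' : Type*} [TopologicalSpace H''] {I'' : ModelWithCorners ℝ E'' H''}
    {M'' : Type*} [TopologicalSpace M''] [ChartedSpace H'' M'']
    {f : M' → M} {g : M → M''} {x : M'} {y : M} (hg : MDifferentiableAt I I'' g y)
    (hf : MDifferentiableAt I' I f x) (hy : f x = y) (v : E') :
    (mfderiv I' I'' (fun z => g (f z)) x : E' →L[ℝ] E'') v =
      (mfderiv I I'' g y : E →L[ℝ] E'') ((mfderiv I' I f x : E' →L[ℝ] E) v) := by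
  subst hy
  have := mfderiv_comp x hg hf
  exact congr($this v)

lemma mvfderiv_congr {f g : M → G} {x : M} (h : ∀ᶠ y in 𝓝 x, f y = g y) (v : TangentSpace I x) :
    mvfderiv I f x v = mvfderiv I g x v := by
  have := Filter.EventuallyEq.mfderiv_eq (I := I) (I' := 𝓘(ℝ, G)) h
  exact congr($this v)

lemma mvfderiv_const_apply (c : G) {x : M} (v : TangentSpace I x) :
    mvfderiv I (fun _ : M => c) x v = 0 := by
  rw [mvfderiv_const]; rfl

lemma SmoothNear.comp {f : M' → M} {g : M → G} {x : M'} (hg : SmoothNear I g (f x))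
    (hf : ContMDiff I' I ∞ f) : SmoothNear I' (fun y => g (f y)) x := by
  filter_upwards [hf.continuous.continuousAt.eventually hg] with y hy
  exact hy.comp y (hf y)

lemma mvfderiv_fun_add' {f g : M → G} {x : M} (hf : SmoothNear I f x) (hg : SmoothNear I g x)
    (v : TangentSpace I x) :
    mvfderiv I (fun y => f y + g y) x v = mvfderiv I f x v + mvfderiv I g x v := by
  rw [mvfderiv_fun_add hf.mdifferentiableAt hg.mdifferentiableAt]; rfl

lemma mvfderiv_fun_neg' {f : M → G} {x : M} (v : TangentSpace I x) :
    mvfderiv I (fun y => - f y) x v = - mvfderiv I f x v := by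
  rw [mvfderiv_fun_neg]; rfl

lemma mvfderiv_fun_mul' {f g : M → ℝ} {x : M} (hf : SmoothNear I f x) (hg : SmoothNear I g x)
    (v : TangentSpace I x) :
    mvfderiv I (fun y => f y * g y) x v = f x * mvfderiv I g x v + g x * mvfderiv I f x v := by
  rw [mvfderiv_fun_mul hf.mdifferentiableAt hg.mdifferentiableAt]; rfl

lemma mvfderiv_fun_sum' {ι : Type*} {u : Finset ι} {f : ι → M → G} {x : M}
    (hf : ∀ i ∈ u, SmoothNear I (f i) x) (v : TangentSpace I x) :
    mvfderiv I (fun y => ∑ i ∈ u, f i y) x v = ∑ i ∈ u, mvfderiv I (f i) x v := by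
  classical
  induction u using Finset.induction_on with
  | empty => simpa using mvfderiv_const_apply (0 : G) v
  | insert i u hi ih =>
    simp only [Finset.sum_insert hi]
    rw [mvfderiv_fun_add' (hf i (by simp)) (.sum fun j hj => hf j (by simp [hj])),
      ih fun j hj => hf j (by simp [hj])]

end Chain

section TotalSpaceGeometry

variable {E : Type*} [NormedAddCommGroup E] [NormedSpace ℝ E]
  {H : Type*} [TopologicalSpace H] {I : ModelWithCorners ℝ E H}
  {M : Type*} [TopologicalSpace M] [ChartedSpace H M] [IsManifold I ∞ M]
  {F : Type*} [NormedAddCommGroup F] [NormedSpace ℝ F]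
  {V : M → Type*} [TopologicalSpace (TotalSpace F V)]
  [∀ x, AddCommGroup (V x)] [∀ x, Module ℝ (V x)] [∀ x, TopologicalSpace (V x)]
  [FiberBundle F V] [VectorBundle ℝ F V] [ContMDiffVectorBundle ∞ F V I]
  {e : Trivialization F (TotalSpace.proj : TotalSpace F V → M)} [MemTrivializationAtlas e]
  {s t : ∀ x : M, V x} {X Y : ∀ x : M, TangentSpace I x} {x : M} {v : TotalSpace F V}

variable (e) in
/-- The fibre coordinate of a point of the total space in a trivialization. -/
def fib (w : TotalSpace F V) : F := (e w).2

lemma smoothNear_fib (hv : v.proj ∈ e.baseSet) : SmoothNear (I.prod 𝓘(ℝ, F)) (fib e) v := by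
  have hv' : v ∈ e.source := e.mem_source.2 hv
  filter_upwards [e.open_source.mem_nhds hv'] with w hw
  exact ((e.contMDiffOn (IB := I) (n := ∞) w hw).contMDiffAt (e.open_source.mem_nhds hw)).snd

lemma smoothSec_iff_fib (hx : x ∈ e.baseSet) :
    SmoothSec I F s x ↔ SmoothNear I (fun y => fib e ⟨y, s y⟩) x :=
  smoothSec_iff_trivialization e hx

lemma SmoothNear.comp_proj {G : Type*} [NormedAddCommGroup G] [NormedSpace ℝ G] {f : M → G}
    (hf : SmoothNear I f v.proj) :
    SmoothNear (I.prod 𝓘(ℝ, F)) (fun w : TotalSpace F V => f w.proj) v :=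
  SmoothNear.comp (I := I) (f := (TotalSpace.proj : TotalSpace F V → M)) hf (contMDiff_proj V)

lemma mdifferentiableAt_proj (v : TotalSpace F V) :
    MDifferentiableAt (I.prod 𝓘(ℝ, F)) I (TotalSpace.proj : TotalSpace F V → M) v :=
  (contMDiff_proj V (n := 1) v).mdifferentiableAt one_ne_zero

lemma mvfderiv_comp_proj {G : Type*} [NormedAddCommGroup G] [NormedSpace ℝ G] {f : M → G}
    (hf : SmoothNear I f v.proj) (A : TangentSpace (I.prod 𝓘(ℝ, F)) v) :
    mvfderiv (I.prod 𝓘(ℝ, F)) (fun w : TotalSpace F V => f w.proj) v A =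
      mvfderiv I f v.proj (projDeriv I v A) :=
  mvfderiv_comp_mfderiv hf.mdifferentiableAt (mdifferentiableAt_proj v) A

lemma fib_mk (hx : x ∈ e.baseSet) (w : V x) :
    fib e ⟨x, w⟩ = e.continuousLinearMapAt ℝ x w :=
  (e.continuousLinearMapAt_apply_of_mem (R := ℝ) hx w).symm

lemma extChartAt_total {v w : TotalSpace F V}
    (hw : w.proj ∈ (trivializationAt F V v.proj).baseSet) :
    extChartAt (I.prod 𝓘(ℝ, F)) v w =
      (extChartAt I v.proj w.proj, fib (trivializationAt F V v.proj) w) := by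
  rw [FiberBundle.extChartAt]
  have h := Trivialization.coe_fst (trivializationAt F V v.proj) (Trivialization.mem_source _ |>.2 hw)
  simp only [PartialEquiv.coe_trans, Function.comp, PartialEquiv.prod_coe, PartialEquiv.refl_coe, id]
  exact Prod.ext (congrArg (extChartAt I v.proj) h) rfl

lemma eventually_extChartAt_total (v : TotalSpace F V) : ∀ᶠ w in 𝓝 v,
    extChartAt (I.prod 𝓘(ℝ, F)) v w =
      (extChartAt I v.proj w.proj, fib (trivializationAt F V v.proj) w) := by
  have := (FiberBundle.continuous_proj F V).continuousAt.eventually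
    ((trivializationAt F V v.proj).open_baseSet.mem_nhds (mem_baseSet_trivializationAt' v.proj))
  filter_upwards [this] with w hw using extChartAt_total hw

/-- Tangent vectors of the total space are determined by their projection and their fibre
coordinate. -/
lemma tangent_total_ext {A A' : TangentSpace (I.prod 𝓘(ℝ, F)) v}
    (h : projDeriv I v A = projDeriv I v A')
    (h' : mvfderiv (I.prod 𝓘(ℝ, F)) (fib (trivializationAt F V v.proj)) v A =
      mvfderiv (I.prod 𝓘(ℝ, F)) (fib (trivializationAt F V v.proj)) v A') : A = A' := by
  apply mvfderiv_extChartAt_injective v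
  have hc := smoothNear_extChartAt (I := I.prod 𝓘(ℝ, F)) v (mem_chart_source _ v)
  have h0 := smoothNear_extChartAt (I := I) v.proj (mem_chart_source _ v.proj)
  have hev := eventually_extChartAt_total (I := I) v
  apply Prod.ext
  · have h1 (A) := mvfderiv_clm_comp (ContinuousLinearMap.fst ℝ E F) hc A
    have h2 : ∀ᶠ w in 𝓝 v, ContinuousLinearMap.fst ℝ E F (extChartAt (I.prod 𝓘(ℝ, F)) v w) =
        extChartAt I v.proj w.proj := hev.mono fun w hw => by rw [hw]; rfl
    refine (h1 A).symm.trans (Eq.trans ?_ (h1 A'))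
    rw [mvfderiv_congr h2, mvfderiv_congr h2, mvfderiv_comp_proj h0, mvfderiv_comp_proj h0, h]
  · have h1 (A) := mvfderiv_clm_comp (ContinuousLinearMap.snd ℝ E F) hc A
    have h2 : ∀ᶠ w in 𝓝 v, ContinuousLinearMap.snd ℝ E F (extChartAt (I.prod 𝓘(ℝ, F)) v w) =
        fib (trivializationAt F V v.proj) w := hev.mono fun w hw => by rw [hw]; rfl
    refine (h1 A).symm.trans (Eq.trans ?_ (h1 A'))
    rw [mvfderiv_congr h2, mvfderiv_congr h2]
    exact h'

lemma smoothSec_total [FiniteDimensional ℝ E] [FiniteDimensional ℝ F]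
    {A : ∀ v : TotalSpace F V, TangentSpace (I.prod 𝓘(ℝ, F)) v}
    (h : ∀ f : M → ℝ, SmoothNear I f v.proj →
      SmoothNear (I.prod 𝓘(ℝ, F)) (fun w => mvfderiv I f w.proj (projDeriv I w (A w))) v)
    (h' : SmoothNear (I.prod 𝓘(ℝ, F))
      (fun w => mvfderiv (I.prod 𝓘(ℝ, F)) (fib (trivializationAt F V v.proj)) w (A w)) v) :
    SmoothSec (I.prod 𝓘(ℝ, F)) (E × F) A v := by
  refine smoothSec_of_mvfderiv fun L => ?_
  let L₁ := L.comp (ContinuousLinearMap.inl ℝ E F)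
  let L₂ := L.comp (ContinuousLinearMap.inr ℝ E F)
  have h0 := smoothNear_extChartAt (I := I) v.proj (mem_chart_source _ v.proj)
  have hf : SmoothNear (I.prod 𝓘(ℝ, F)) (fib (trivializationAt F V v.proj)) v :=
    smoothNear_fib (mem_baseSet_trivializationAt' _)
  have hL : ∀ᶠ w in 𝓝 v, L (extChartAt (I.prod 𝓘(ℝ, F)) v w) =
      L₁ (extChartAt I v.proj w.proj) + L₂ (fib (trivializationAt F V v.proj) w) := by
    filter_upwards [eventually_extChartAt_total (I := I) v] with w hw
    rw [hw]
    simp only [L₁, L₂, ContinuousLinearMap.comp_apply, ← map_add]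
    simp
  refine ((h _ (h0.clm_comp L₁)).add (h'.clm_comp L₂)).congr ?_
  filter_upwards [(h0.comp_proj (F := F) (V := V)).eventually, hf.eventually, hL.eventually_nhds,
    (contMDiff_proj V (IB := I) (n := ∞)).continuous.continuousAt.eventually h0.eventually]
    with w hw1 hw2 hL hw3
  rw [mvfderiv_congr hL, mvfderiv_fun_add' (hw1.clm_comp L₁) (hw2.clm_comp L₂),
    mvfderiv_clm_comp L₂ hw2]
  congr 1
  exact mvfderiv_comp_proj (hw3.clm_comp L₁) (A w)

lemma vertLift_aux (v : TotalSpace F V) :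
    ContMDiffAt 𝓘(ℝ, F) (I.prod 𝓘(ℝ, F)) ∞ (fun f : F => TotalSpace.mk' F v.proj
      (v.2 + (trivializationAt F V v.proj).symmL ℝ v.proj f)) 0 := by
  rw [contMDiffAt_totalSpace]
  refine ⟨contMDiffAt_const, ?_⟩
  have hp : v.proj ∈ (trivializationAt F V v.proj).baseSet := mem_baseSet_trivializationAt' _
  have : (fun f : F => (trivializationAt F V v.proj (TotalSpace.mk' F v.proj
      (v.2 + (trivializationAt F V v.proj).symmL ℝ v.proj f))).2) =
      fun f => (trivializationAt F V v.proj).continuousLinearMapAt ℝ v.proj v.2 + f := by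
    ext f
    rw [← Trivialization.continuousLinearMapAt_apply_of_mem (R := ℝ) _ hp, map_add,
      Trivialization.continuousLinearMapAt_symmL _ hp]
  rw [contMDiffAt_iff_contDiffAt]
  exact this ▸ (contDiff_const.add contDiff_id).contDiffAt

@[simp]
lemma projDeriv_vertLift (v : TotalSpace F V) (w : V v.proj) :
    projDeriv I v (vertLift I v w) = 0 := by
  have hι := (vertLift_aux (I := I) v).mdifferentiableAt (by simp)
  have h0 : TotalSpace.mk' F v.proj
      (v.2 + (trivializationAt F V v.proj).symmL ℝ v.proj 0) = v := by simp
  have h := mfderiv_comp_apply_of_eq' (mdifferentiableAt_proj (I := I) v) hι h0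
    ((trivializationAt F V v.proj).continuousLinearMapAt ℝ v.proj w)
  refine h.symm.trans ?_
  have h1 : mfderiv 𝓘(ℝ, F) I (fun _ : F => v.proj) 0 = 0 := mfderiv_const
  exact congr($h1 _)

lemma mvfderiv_fib_vertLift (hv : v.proj ∈ e.baseSet) (w : V v.proj) :
    mvfderiv (I.prod 𝓘(ℝ, F)) (fib e) v (vertLift I v w) = fib e ⟨v.proj, w⟩ := by
  set τ := trivializationAt F V v.proj
  have hτ : v.proj ∈ τ.baseSet := mem_baseSet_trivializationAt' _
  have hι := (vertLift_aux (I := I) v).mdifferentiableAt (by simp)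
  have h0 : TotalSpace.mk' F v.proj (v.2 + τ.symmL ℝ v.proj 0) = v := by simp
  have h := mfderiv_comp_apply_of_eq' (smoothNear_fib (I := I) hv).mdifferentiableAt hι h0
    (τ.continuousLinearMapAt ℝ v.proj w)
  let L : F →L[ℝ] F := (e.continuousLinearMapAt ℝ v.proj).comp (τ.symmL ℝ v.proj)
  have h2 : (fun f : F => fib e (TotalSpace.mk' F v.proj (v.2 + τ.symmL ℝ v.proj f))) =
      fun f => e.continuousLinearMapAt ℝ v.proj v.2 + L f := by
    ext f
    simp only [TotalSpace.mk', fib_mk hv, map_add]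
    rfl
  have h3 : mfderiv 𝓘(ℝ, F) 𝓘(ℝ, F) (fun f => e.continuousLinearMapAt ℝ v.proj v.2 + L f) 0 = L := by
    rw [mfderiv_eq_fderiv, fderiv_const_add, L.fderiv]
  rw [fib_mk hv]
  refine h.symm.trans ?_
  have h4 : mfderiv 𝓘(ℝ, F) 𝓘(ℝ, F) (fun f : F => fib e (TotalSpace.mk' F v.proj
      (v.2 + τ.symmL ℝ v.proj f))) 0 = L := by rw [h2]; exact h3
  refine (congr($h4 (τ.continuousLinearMapAt ℝ v.proj w))).trans ?_
  simp only [L, ContinuousLinearMap.comp_apply, τ.symmL_continuousLinearMapAt hτ]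
  rfl

end TotalSpaceGeometry

section Lifts

variable {E : Type*} [NormedAddCommGroup E] [NormedSpace ℝ E]
  {H : Type*} [TopologicalSpace H] {I : ModelWithCorners ℝ E H}
  {M : Type*} [TopologicalSpace M] [ChartedSpace H M] [IsManifold I ∞ M]
  {F : Type*} [NormedAddCommGroup F] [NormedSpace ℝ F] [FiniteDimensional ℝ F]
  {V : M → Type*} [TopologicalSpace (TotalSpace F V)]
  [∀ x, AddCommGroup (V x)] [∀ x, Module ℝ (V x)] [∀ x, TopologicalSpace (V x)]
  [∀ x, IsTopologicalAddGroup (V x)] [∀ x, ContinuousSMul ℝ (V x)]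
  [FiberBundle F V] [VectorBundle ℝ F V] [ContMDiffVectorBundle ∞ F V I]
  {D : CovariantDerivative I F V}
  {e : Trivialization F (TotalSpace.proj : TotalSpace F V → M)} [MemTrivializationAtlas e]
  {s t : ∀ x : M, V x} {X Y : ∀ x : M, TangentSpace I x} {x : M} {v : TotalSpace F V}

variable (e) in
/-- The section which is constant in the trivialization `e`. -/
def constSec (f : F) (y : M) : V y := e.symm y f

lemma fib_constSec (hx : x ∈ e.baseSet) (f : F) : fib e ⟨x, constSec e f x⟩ = f := by
  simp [fib, constSec, hx]

lemma smoothSec_constSec (hx : x ∈ e.baseSet) (f : F) : SmoothSec I F (constSec e f) x := by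
  rw [smoothSec_iff_fib hx]
  refine (smoothNear_const f).congr ?_
  filter_upwards [e.open_baseSet.mem_nhds hx] with y hy using fib_constSec hy f

lemma eq_sum_constSec (hx : x ∈ e.baseSet) (w : V x) :
    w = ∑ k, (Module.finBasis ℝ F).repr (fib e ⟨x, w⟩) k •
      constSec e (Module.finBasis ℝ F k) x := by
  have h1 (f : F) : constSec e f x = e.symmL ℝ x f := (e.symmL_apply hx f).symm
  simp only [h1, ← map_smul, ← map_sum, Module.Basis.sum_repr]
  rw [fib_mk hx, e.symmL_continuousLinearMapAt hx]

/-- The coordinates in the model fibre, as continuous linear functionals. -/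
def coordL (F : Type*) [NormedAddCommGroup F] [NormedSpace ℝ F] [FiniteDimensional ℝ F]
    (k : Fin (Module.finrank ℝ F)) : F →L[ℝ] ℝ :=
  ((Module.finBasis ℝ F).coord k).toContinuousLinearMap

lemma coordL_apply (k : Fin (Module.finrank ℝ F)) (f : F) :
    coordL F k f = (Module.finBasis ℝ F).repr f k := rfl

lemma sum_coordL (f : F) : ∑ k, coordL F k f • Module.finBasis ℝ F k = f :=
  (Module.finBasis ℝ F).sum_repr f

variable (D e) in
/-- The connection form of `D` in the trivialization `e`. -/
def connForm (x : M) (X : TangentSpace I x) (f : F) : F :=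
  ∑ k, coordL F k f • fib e ⟨x, D (constSec e (Module.finBasis ℝ F k)) x X⟩

lemma fib_cov (hx : x ∈ e.baseSet) (hs : SmoothSec I F s x) (X : TangentSpace I x) :
    fib e ⟨x, D s x X⟩ =
      mvfderiv I (fun y => fib e ⟨y, s y⟩) x X + connForm D e x X (fib e ⟨x, s x⟩) := by
  have hs' := (smoothSec_iff_fib hx).1 hs
  have hc (k) := hs'.clm_comp (coordL F k)
  have h1 : ∀ᶠ y in 𝓝 x, s y = ∑ k, coordL F k (fib e ⟨y, s y⟩) •
      constSec e (Module.finBasis ℝ F k) y := by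
    filter_upwards [e.open_baseSet.mem_nhds hx] with y hy using eq_sum_constSec hy (s y)
  rw [cov_congr (.sum fun k _ => (hc k).smul (smoothSec_constSec hx _)) h1,
    cov_sum fun k _ => (hc k).smul (smoothSec_constSec hx _), fib_mk hx, map_sum]
  have h2 (k) := cov_smul (D := D) (hc k) (smoothSec_constSec hx (Module.finBasis ℝ F k)) X
  simp only [h2, map_add, map_smul]
  simp only [← fib_mk hx, fib_constSec hx]
  simp only [Finset.sum_add_distrib]
  rw [add_comm]
  congr 1
  have h3 (k) := mvfderiv_clm_comp (coordL F k) hs' X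
  simp only [h3]
  exact sum_coordL _

variable (I) in
/-- The differential at `v.proj` of a section through `v`. -/
def secDeriv (s : ∀ x : M, V x) (v : TotalSpace F V) :
    TangentSpace I v.proj →L[ℝ] TangentSpace (I.prod 𝓘(ℝ, F)) v :=
  mfderiv I (I.prod 𝓘(ℝ, F)) (fun y => TotalSpace.mk' F y (s y)) v.proj

lemma mfderiv_section_fib (hx : v.proj ∈ e.baseSet) (hs : SmoothSec I F s v.proj)
    (hv : s v.proj = v.2) (X : TangentSpace I v.proj) :
    mvfderiv (I.prod 𝓘(ℝ, F)) (fib e) v (secDeriv I s v X) =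
      mvfderiv I (fun y => fib e ⟨y, s y⟩) v.proj X := by
  have h0 : TotalSpace.mk' F v.proj (s v.proj) = v := by rw [hv]
  exact (mfderiv_comp_apply_of_eq' (smoothNear_fib (I := I) hx).mdifferentiableAt
    hs.mdifferentiableAt h0 X).symm

lemma mfderiv_section_proj (hs : SmoothSec I F s v.proj)
    (hv : s v.proj = v.2) (X : TangentSpace I v.proj) :
    projDeriv I v (secDeriv I s v X) = X := by
  have h0 : TotalSpace.mk' F v.proj (s v.proj) = v := by rw [hv]
  have h := (mfderiv_comp_apply_of_eq' (mdifferentiableAt_proj (I := I) v)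
    hs.mdifferentiableAt h0 X).symm
  have h2 : mfderiv I I (fun y : M => y) v.proj = ContinuousLinearMap.id ℝ _ := mfderiv_id
  exact h.trans congr($h2 X)

lemma horLift_eq (X : TangentSpace I v.proj) : horLift D v X =
    secDeriv I (extend F v.2) v X -
    vertLift I v (D (extend F v.2) v.proj X) := rfl

lemma mvfderiv_fib_horLift (hv : v.proj ∈ e.baseSet) (X : TangentSpace I v.proj) :
    mvfderiv (I.prod 𝓘(ℝ, F)) (fib e) v (horLift D v X) = - connForm D e v.proj X (fib e v) := by
  have hs := smoothSec_extend I F v.2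
  have h1 := mfderiv_section_fib hv hs (extend_apply_self F v.2) X
  rw [horLift_eq, map_sub]
  rw [h1, mvfderiv_fib_vertLift hv, fib_cov hv hs, extend_apply_self]
  abel

@[simp]
lemma projDeriv_horLift (X : TangentSpace I v.proj) : projDeriv I v (horLift D v X) = X := by
  have hs := smoothSec_extend I F v.2
  have h1 := mfderiv_section_proj hs (extend_apply_self F v.2) X
  rw [horLift_eq, map_sub, h1, projDeriv_vertLift, sub_zero]

lemma fib_eq_of_eq {w w' : V x} (hx : x ∈ e.baseSet) (h : fib e ⟨x, w⟩ = fib e ⟨x, w'⟩) :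
    w = w' := by
  rw [fib_mk hx, fib_mk hx] at h
  rw [← e.symmL_continuousLinearMapAt (R := ℝ) hx w, h, e.symmL_continuousLinearMapAt hx]

lemma connForm_trivializationAt (X : TangentSpace I v.proj) :
    fib (trivializationAt F V v.proj) ⟨v.proj, D (extend F v.2) v.proj X⟩ =
      connForm D (trivializationAt F V v.proj) v.proj X (fib (trivializationAt F V v.proj) v) := by
  have hp : v.proj ∈ (trivializationAt F V v.proj).baseSet := mem_baseSet_trivializationAt' _
  rw [fib_cov hp (smoothSec_extend I F v.2), extend_apply_self]
  have : ∀ᶠ y in 𝓝 v.proj, fib (trivializationAt F V v.proj) ⟨y, extend F v.2 y⟩ =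
      fib (trivializationAt F V v.proj) v := by
    filter_upwards [(trivializationAt F V v.proj).open_baseSet.mem_nhds hp] with y hy
    exact fib_constSec hy _
  rw [mvfderiv_congr this, mvfderiv_const_apply, zero_add]

lemma fib_vertPart_trivializationAt (A : TangentSpace (I.prod 𝓘(ℝ, F)) v) :
    fib (trivializationAt F V v.proj) ⟨v.proj, vertPart D v A⟩ =
      mvfderiv (I.prod 𝓘(ℝ, F)) (fib (trivializationAt F V v.proj)) v A +
      connForm D (trivializationAt F V v.proj) v.proj (projDeriv I v A)
        (fib (trivializationAt F V v.proj) v) := by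
  have hp : v.proj ∈ (trivializationAt F V v.proj).baseSet := mem_baseSet_trivializationAt' _
  rw [← connForm_trivializationAt, fib_mk hp, fib_mk hp]
  simp only [vertPart, add_apply, ContinuousLinearMap.comp_apply, map_add,
    Trivialization.continuousLinearMapAt_symmL _ hp]
  rfl

lemma horLift_add_vertLift (D : CovariantDerivative I F V) (A : TangentSpace (I.prod 𝓘(ℝ, F)) v) :
    horLift D v (projDeriv I v A) + vertLift I v (vertPart D v A) = A := by
  have hp : v.proj ∈ (trivializationAt F V v.proj).baseSet := mem_baseSet_trivializationAt' _
  apply tangent_total_ext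
  · simp
  · rw [map_add, mvfderiv_fib_horLift hp, mvfderiv_fib_vertLift hp, fib_vertPart_trivializationAt]
    abel

@[simp]
lemma vertPart_vertLift (w : V v.proj) : vertPart D v (vertLift I v w) = w := by
  have hp : v.proj ∈ (trivializationAt F V v.proj).baseSet := mem_baseSet_trivializationAt' _
  have h := congrArg (mvfderiv (I.prod 𝓘(ℝ, F)) (fib (trivializationAt F V v.proj)) v)
    (horLift_add_vertLift D (vertLift I v w))
  rw [projDeriv_vertLift, map_zero, zero_add, mvfderiv_fib_vertLift hp,
    mvfderiv_fib_vertLift hp] at h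
  exact fib_eq_of_eq hp h

@[simp]
lemma vertPart_horLift (X : TangentSpace I v.proj) : vertPart D v (horLift D v X) = 0 := by
  have h := horLift_add_vertLift D (horLift D v X)
  rw [projDeriv_horLift, add_eq_left] at h
  rw [← vertPart_vertLift (D := D) (I := I) (v := v) (vertPart D v (horLift D v X)), h, map_zero]

/-- Tangent vectors of the total space are determined by their horizontal and vertical parts. -/
lemma tangent_total_ext' (D : CovariantDerivative I F V) {A A' : TangentSpace (I.prod 𝓘(ℝ, F)) v}
    (h : projDeriv I v A = projDeriv I v A') (h' : vertPart D v A = vertPart D v A') : A = A' := by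
  rw [← horLift_add_vertLift D A, h, h', horLift_add_vertLift]

lemma fib_vertPart (hv : v.proj ∈ e.baseSet) (A : TangentSpace (I.prod 𝓘(ℝ, F)) v) :
    fib e ⟨v.proj, vertPart D v A⟩ = mvfderiv (I.prod 𝓘(ℝ, F)) (fib e) v A +
      connForm D e v.proj (projDeriv I v A) (fib e v) := by
  conv_rhs => rw [← horLift_add_vertLift D A]
  rw [map_add, mvfderiv_fib_horLift hv, mvfderiv_fib_vertLift hv]
  simp

section Smooth

lemma SmoothNear.smul_fun {G : Type*} [NormedAddCommGroup G] [NormedSpace ℝ G] {B : Type*}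
    [TopologicalSpace B] [ChartedSpace H B] {a : B → ℝ} {f : B → G} {x : B}
    (ha : SmoothNear I a x) (hf : SmoothNear I f x) : SmoothNear I (fun y => a y • f y) x := by
  filter_upwards [ha, hf] with y hy hy' using hy.smul hy'

variable (D) in
/-- A connection which is smooth in the sense of Mathlib preserves germs of smooth sections. -/
lemma isSmoothCov_of_contMDiff [FiniteDimensional ℝ E] [T2Space M]
    (hD : CovariantDerivative.ContMDiffCovariantDerivative D ∞) : IsSmoothCov D := by
  intro X s x hX hs
  have := hD.contMDiff
  obtain ⟨U, hU, hUo, hxU⟩ := eventually_nhds_iff.1 hs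
  obtain ⟨χ, -, hχ⟩ := (SmoothBumpFunction.nhds_basis_tsupport (I := I) x).mem_iff.1
    (hUo.mem_nhds hxU)
  have h1 : ContMDiff I (I.prod 𝓘(ℝ, F)) ∞ (fun y => TotalSpace.mk' F y (χ y • s y)) := by
    intro y
    by_cases hy : y ∈ tsupport χ
    · exact χ.contMDiffAt.smul_section (hU y (hχ hy))
    · have : ∀ᶠ z in 𝓝 y, χ z = 0 := by
        filter_upwards [(isClosed_tsupport χ).isOpen_compl.mem_nhds hy] with z hz
        exact image_eq_zero_of_notMem_tsupport hz
      refine (contMDiffAt_zeroSection (n := ∞) ℝ V (IB := I) (F := F)).congr_of_eventuallyEq ?_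
      filter_upwards [this] with z hz
      simp [hz, zeroSection]
  have h2 := hD.contMDiff.contMDiff (σ := fun y => χ y • s y) (by exact h1.contMDiffOn)
  have h3 : SmoothSec I F (fun y => D (fun z => χ z • s z) y (X y)) x := by
    filter_upwards [hX] with y hy
    have h4 := (h2 y (mem_univ y)).contMDiffAt Filter.univ_mem
    exact ContMDiffAt.clm_bundle_apply h4 hy
  refine h3.congr ?_
  have h5 : ∀ᶠ y in 𝓝 x, χ y • s y = s y := by
    filter_upwards [χ.eventuallyEq_one] with y hy
    simp [hy]
  filter_upwards [h5.eventually_nhds, hs.eventually] with y hy hsy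
  rw [cov_congr hsy hy]

lemma IsSmoothCov.smoothNear_connForm (hD : IsSmoothCov D) (hx : x ∈ e.baseSet)
    (hX : SmoothSec I E X x) (f : F) : SmoothNear I (fun y => connForm D e y (X y) f) x := by
  refine .sum fun k _ => (smoothNear_const _).smul_fun ?_
  exact (smoothSec_iff_fib hx).1 (hD X _ x hX (smoothSec_constSec hx _))

lemma connForm_eq_sum (X : TangentSpace I x) (f : F) :
    connForm D e x X f = ∑ k, coordL F k f • connForm D e x X (Module.finBasis ℝ F k) := by
  simp only [connForm]
  refine Finset.sum_congr rfl fun k _ => ?_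
  congr 1
  simp [coordL_apply, Finsupp.single_apply]

/-- The horizontal lift of a vector field. -/
def horField (D : CovariantDerivative I F V) (X : ∀ x : M, TangentSpace I x) (v : TotalSpace F V) :
    TangentSpace (I.prod 𝓘(ℝ, F)) v := horLift D v (X v.proj)

variable (I) in
/-- The vertical lift of a section. -/
def vertField (s : ∀ x : M, V x) (v : TotalSpace F V) : TangentSpace (I.prod 𝓘(ℝ, F)) v :=
  vertLift I v (s v.proj)

lemma eventually_proj {P : M → Prop} (h : ∀ᶠ x in 𝓝 v.proj, P x) :
    ∀ᶠ w : TotalSpace F V in 𝓝 v, P w.proj :=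
  (FiberBundle.continuous_proj F V).continuousAt.eventually h

lemma smoothSec_vertField [FiniteDimensional ℝ E] (hs : SmoothSec I F s v.proj) :
    SmoothSec (I.prod 𝓘(ℝ, F)) (E × F) (vertField I s) v := by
  have hp : v.proj ∈ (trivializationAt F V v.proj).baseSet := mem_baseSet_trivializationAt' _
  refine smoothSec_total (fun f hf => ?_) ?_
  · simp only [vertField, projDeriv_vertLift, map_zero]
    exact smoothNear_const 0
  · refine ((smoothSec_iff_fib hp).1 hs).comp_proj.congr ?_
    filter_upwards [eventually_proj ((trivializationAt F V v.proj).open_baseSet.mem_nhds hp)]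
      with w hw
    exact mvfderiv_fib_vertLift hw _

lemma IsSmoothCov.smoothNear_connForm_fib (hD : IsSmoothCov D) (hv : v.proj ∈ e.baseSet)
    (hX : SmoothSec I E X v.proj) : SmoothNear (I.prod 𝓘(ℝ, F))
      (fun w => connForm D e w.proj (X w.proj) (fib e w)) v := by
  simp only [fun w : TotalSpace F V => connForm_eq_sum (D := D) (e := e) (X w.proj) (fib e w)]
  refine .sum fun k _ => SmoothNear.smul_fun ((smoothNear_fib hv).clm_comp (coordL F k)) ?_
  exact (hD.smoothNear_connForm hv hX _).comp_proj

lemma smoothSec_horField [FiniteDimensional ℝ E] (hD : IsSmoothCov D)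
    (hX : SmoothSec I E X v.proj) :
    SmoothSec (I.prod 𝓘(ℝ, F)) (E × F) (horField D X) v := by
  have hp : v.proj ∈ (trivializationAt F V v.proj).baseSet := mem_baseSet_trivializationAt' _
  refine smoothSec_total (fun f hf => ?_) ?_
  · simp only [horField, projDeriv_horLift]
    exact (hf.dirDeriv hX).comp_proj
  · refine (hD.smoothNear_connForm_fib hp hX).neg.congr ?_
    filter_upwards [eventually_proj ((trivializationAt F V v.proj).open_baseSet.mem_nhds hp)]
      with w hw
    exact mvfderiv_fib_horLift hw _

end Smooth

end Lifts

section BracketVector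

variable {E : Type*} [NormedAddCommGroup E] [NormedSpace ℝ E] [CompleteSpace E]
  {H : Type*} [TopologicalSpace H] {I : ModelWithCorners ℝ E H}
  {B : Type*} [TopologicalSpace B] [ChartedSpace H B] [IsManifold I ∞ B]
  {G : Type*} [NormedAddCommGroup G] [NormedSpace ℝ G]
  {f : B → G} {X Y Z : ∀ x : B, TangentSpace I x} {x : B}

lemma mvfderiv_mlieBracket_vector (hf : SmoothNear I f x) (hX : SmoothSec I E X x)
    (hY : SmoothSec I E Y x) :
    mvfderiv I f x (mlieBracket I X Y x) =
      mvfderiv I (fun y => mvfderiv I f y (Y y)) x (X x) -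
        mvfderiv I (fun y => mvfderiv I f y (X y)) x (Y x) := by
  apply (SeparatingDual.eq_iff_forall_dual_eq (R := ℝ)).2
  intro L
  have h (Z : ∀ x : B, TangentSpace I x) : ∀ᶠ y in 𝓝 x,
      mvfderiv I (fun z => L (f z)) y (Z y) = L (mvfderiv I f y (Z y)) := by
    filter_upwards [hf.eventually] with y hy using mvfderiv_clm_comp L hy _
  have key := mvfderiv_mlieBracket (hf.clm_comp L) hX hY
  rwa [mvfderiv_clm_comp L hf, mvfderiv_congr (h X), mvfderiv_congr (h Y),
    mvfderiv_clm_comp L (hf.dirDeriv hX), mvfderiv_clm_comp L (hf.dirDeriv hY), ← map_sub] at key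

lemma mlieBracket_fun_zero_right : mlieBracket I X (fun y => (0 : TangentSpace I y)) x = 0 := by
  exact congr_fun (mlieBracket_zero_right (I := I) (W := X)) x

lemma mlieBracket_fun_zero_left : mlieBracket I (fun y => (0 : TangentSpace I y)) X x = 0 := by
  exact congr_fun (mlieBracket_zero_left (I := I) (W := X)) x

lemma mvfderiv_fun_smul' {a : B → ℝ} (ha : SmoothNear I a x) (hf : SmoothNear I f x)
    (v : TangentSpace I x) :
    mvfderiv I (fun y => a y • f y) x v = a x • mvfderiv I f x v + mvfderiv I a x v • f x := by
  rw [mvfderiv_fun_smul ha.mdifferentiableAt hf.mdifferentiableAt]; rfl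

end BracketVector

section BracketLifts

variable {E : Type*} [NormedAddCommGroup E] [NormedSpace ℝ E] [FiniteDimensional ℝ E]
  [CompleteSpace E]
  {H : Type*} [TopologicalSpace H] {I : ModelWithCorners ℝ E H}
  {M : Type*} [TopologicalSpace M] [ChartedSpace H M] [IsManifold I ∞ M]
  {F : Type*} [NormedAddCommGroup F] [NormedSpace ℝ F] [FiniteDimensional ℝ F] [CompleteSpace F]
  {V : M → Type*} [TopologicalSpace (TotalSpace F V)]
  [∀ x, AddCommGroup (V x)] [∀ x, Module ℝ (V x)] [∀ x, TopologicalSpace (V x)]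
  [∀ x, IsTopologicalAddGroup (V x)] [∀ x, ContinuousSMul ℝ (V x)]
  [FiberBundle F V] [VectorBundle ℝ F V] [ContMDiffVectorBundle ∞ F V I]
  {D : CovariantDerivative I F V}
  {e : Trivialization F (TotalSpace.proj : TotalSpace F V → M)} [MemTrivializationAtlas e]
  {s t : ∀ x : M, V x} {X Y : ∀ x : M, TangentSpace I x} {x : M} {v : TotalSpace F V}

/-- Vector fields on the total space which project to vector fields on the base: so do their
brackets. -/
lemma projDeriv_mlieBracket {A A' : ∀ v : TotalSpace F V, TangentSpace (I.prod 𝓘(ℝ, F)) v}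
    (hA : SmoothSec (I.prod 𝓘(ℝ, F)) (E × F) A v) (hA' : SmoothSec (I.prod 𝓘(ℝ, F)) (E × F) A' v)
    (hX : SmoothSec I E X v.proj) (hY : SmoothSec I E Y v.proj)
    (hAX : ∀ w, projDeriv I w (A w) = X w.proj) (hAY : ∀ w, projDeriv I w (A' w) = Y w.proj) :
    projDeriv I v (mlieBracket (I.prod 𝓘(ℝ, F)) A A' v) = mlieBracket I X Y v.proj := by
  refine tangent_ext fun f hf => ?_
  have h (A : ∀ v : TotalSpace F V, TangentSpace (I.prod 𝓘(ℝ, F)) v)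
      (X : ∀ x : M, TangentSpace I x) (hAX : ∀ w, projDeriv I w (A w) = X w.proj) :
      ∀ᶠ w in 𝓝 v, mvfderiv (I.prod 𝓘(ℝ, F)) (fun w : TotalSpace F V => f w.proj) w (A w) =
        mvfderiv I f w.proj (X w.proj) := by
    filter_upwards [eventually_proj hf.eventually] with w hw
    rw [mvfderiv_comp_proj hw, hAX]
  have key := mvfderiv_mlieBracket (hf.comp_proj (F := F) (V := V)) hA hA'
  rw [mvfderiv_comp_proj hf, mvfderiv_congr (h A X hAX), mvfderiv_congr (h A' Y hAY),
    mvfderiv_comp_proj (f := fun y => mvfderiv I f y (X y)) (hf.dirDeriv hX),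
    mvfderiv_comp_proj (f := fun y => mvfderiv I f y (Y y)) (hf.dirDeriv hY), hAX, hAY] at key
  rw [key, mvfderiv_mlieBracket hf hX hY]

lemma connForm_add (X : TangentSpace I x) (f f' : F) :
    connForm D e x X (f + f') = connForm D e x X f + connForm D e x X f' := by
  simp only [connForm, map_add, add_smul, Finset.sum_add_distrib]

lemma connForm_neg (X : TangentSpace I x) (f : F) :
    connForm D e x X (-f) = - connForm D e x X f := by
  simp only [connForm, map_neg, neg_smul, Finset.sum_neg_distrib]

lemma eventually_mem_baseSet (hx : x ∈ e.baseSet) : ∀ᶠ y in 𝓝 x, y ∈ e.baseSet :=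
  e.open_baseSet.mem_nhds hx

lemma mvfderiv_connForm (hD : IsSmoothCov D) (hx : x ∈ e.baseSet) (hX : SmoothSec I E X x)
    {h : M → F} (hh : SmoothNear I h x) (ξ : TangentSpace I x) :
    mvfderiv I (fun y => connForm D e y (X y) (h y)) x ξ =
      (∑ k, coordL F k (h x) •
        mvfderiv I (fun y => connForm D e y (X y) (Module.finBasis ℝ F k)) x ξ) +
      connForm D e x (X x) (mvfderiv I h x ξ) := by
  simp only [fun y : M => connForm_eq_sum (D := D) (e := e) (X y) (h y)]
  have h1 (k) := hh.clm_comp (coordL F k)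
  have h2 (k) := hD.smoothNear_connForm hx hX (Module.finBasis ℝ F k)
  rw [mvfderiv_fun_sum' fun k _ => (h1 k).smul_fun (h2 k),
    connForm_eq_sum (D := D) (e := e) (X x) (mvfderiv I h x ξ), ← Finset.sum_add_distrib]
  refine Finset.sum_congr rfl fun k _ => ?_
  rw [mvfderiv_fun_smul' (h1 k) (h2 k), mvfderiv_clm_comp _ hh]

lemma mvfderiv_connForm_fib (hD : IsSmoothCov D) (hv : v.proj ∈ e.baseSet)
    (hX : SmoothSec I E X v.proj) (A : TangentSpace (I.prod 𝓘(ℝ, F)) v) :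
    mvfderiv (I.prod 𝓘(ℝ, F)) (fun w => connForm D e w.proj (X w.proj) (fib e w)) v A =
      (∑ k, coordL F k (fib e v) • mvfderiv I
        (fun y => connForm D e y (X y) (Module.finBasis ℝ F k)) v.proj (projDeriv I v A)) +
      connForm D e v.proj (X v.proj) (mvfderiv (I.prod 𝓘(ℝ, F)) (fib e) v A) := by
  simp only [fun w : TotalSpace F V => connForm_eq_sum (D := D) (e := e) (X w.proj) (fib e w)]
  have h0 := smoothNear_fib (I := I) hv
  have h1 (k) := h0.clm_comp (coordL F k)
  have h2 (k) := hD.smoothNear_connForm hv hX (Module.finBasis ℝ F k)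
  rw [mvfderiv_fun_sum' fun k _ => (h1 k).smul_fun (h2 k).comp_proj,
    connForm_eq_sum (D := D) (e := e) (X v.proj) (mvfderiv _ (fib e) v A),
    ← Finset.sum_add_distrib]
  refine Finset.sum_congr rfl fun k _ => ?_
  rw [mvfderiv_fun_smul' (h1 k) (h2 k).comp_proj, mvfderiv_clm_comp _ h0, mvfderiv_comp_proj (h2 k)]

lemma eventually_fib_vertField (hv : v.proj ∈ e.baseSet) : ∀ᶠ w in 𝓝 v,
    mvfderiv (I.prod 𝓘(ℝ, F)) (fib e) w (vertField I s w) = fib e ⟨w.proj, s w.proj⟩ := by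
  filter_upwards [eventually_proj (eventually_mem_baseSet hv)] with w hw
    using mvfderiv_fib_vertLift hw _

lemma eventually_fib_horField (hv : v.proj ∈ e.baseSet) : ∀ᶠ w in 𝓝 v,
    mvfderiv (I.prod 𝓘(ℝ, F)) (fib e) w (horField D X w) =
      - connForm D e w.proj (X w.proj) (fib e w) := by
  filter_upwards [eventually_proj (eventually_mem_baseSet hv)] with w hw
    using mvfderiv_fib_horLift hw _

@[simp]
lemma projDeriv_horField (w : TotalSpace F V) : projDeriv I w (horField D X w) = X w.proj :=
  projDeriv_horLift _

@[simp]
lemma projDeriv_vertField (w : TotalSpace F V) : projDeriv I w (vertField I s w) = 0 :=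
  projDeriv_vertLift _ _

@[simp]
lemma vertPart_horField (w : TotalSpace F V) : vertPart D w (horField D X w) = 0 :=
  vertPart_horLift _

@[simp]
lemma vertPart_vertField (w : TotalSpace F V) : vertPart D w (vertField I s w) = s w.proj :=
  vertPart_vertLift _

lemma mlieBracket_vertField_vertField
    (hs : SmoothSec I F s v.proj) (ht : SmoothSec I F t v.proj) :
    mlieBracket (I.prod 𝓘(ℝ, F)) (vertField I s) (vertField I t) v = 0 := by
  have hp : v.proj ∈ (trivializationAt F V v.proj).baseSet := mem_baseSet_trivializationAt' _
  have hs' := smoothSec_vertField hs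
  have ht' := smoothSec_vertField ht
  apply tangent_total_ext
  · rw [projDeriv_mlieBracket hs' ht' smoothSec_zero smoothSec_zero (by simp) (by simp),
      mlieBracket_fun_zero_left, map_zero]
  · rw [mvfderiv_mlieBracket_vector (smoothNear_fib hp) hs' ht',
      mvfderiv_congr (eventually_fib_vertField hp), mvfderiv_congr (eventually_fib_vertField hp),
      mvfderiv_comp_proj ((smoothSec_iff_fib hp).1 hs),
      mvfderiv_comp_proj ((smoothSec_iff_fib hp).1 ht)]
    simp

lemma mlieBracket_horField_vertField (hD : IsSmoothCov D)
    (hX : SmoothSec I E X v.proj) (hs : SmoothSec I F s v.proj) :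
    mlieBracket (I.prod 𝓘(ℝ, F)) (horField D X) (vertField I s) v =
      vertLift I v (D s v.proj (X v.proj)) := by
  have hp : v.proj ∈ (trivializationAt F V v.proj).baseSet := mem_baseSet_trivializationAt' _
  have hX' := smoothSec_horField hD hX
  have hs' := smoothSec_vertField hs
  apply tangent_total_ext
  · rw [projDeriv_mlieBracket hX' hs' hX smoothSec_zero (by simp) (by simp),
      mlieBracket_fun_zero_right, projDeriv_vertLift]
  · rw [mvfderiv_mlieBracket_vector (smoothNear_fib hp) hX' hs',
      mvfderiv_congr (eventually_fib_vertField hp), mvfderiv_congr (eventually_fib_horField hp),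
      mvfderiv_comp_proj ((smoothSec_iff_fib hp).1 hs), mvfderiv_fun_neg',
      mvfderiv_connForm_fib hD hp hX, (eventually_fib_vertField hp).self_of_nhds,
      mvfderiv_fib_vertLift hp, fib_cov hp hs]
    simp

lemma fib_cov_cov (hD : IsSmoothCov D) (hx : x ∈ e.baseSet) (hY : SmoothSec I E Y x) (hs : SmoothSec I F s x) :
    fib e ⟨x, D (fun y => D s y (Y y)) x (X x)⟩ =
      mvfderiv I (fun y => mvfderiv I (fun z => fib e ⟨z, s z⟩) y (Y y)) x (X x) +
      ((∑ k, coordL F k (fib e ⟨x, s x⟩) •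
        mvfderiv I (fun y => connForm D e y (Y y) (Module.finBasis ℝ F k)) x (X x)) +
      connForm D e x (Y x) (mvfderiv I (fun z => fib e ⟨z, s z⟩) x (X x))) +
      (connForm D e x (X x) (mvfderiv I (fun z => fib e ⟨z, s z⟩) x (Y x)) +
      connForm D e x (X x) (connForm D e x (Y x) (fib e ⟨x, s x⟩))) := by
  have hs' := (smoothSec_iff_fib hx).1 hs
  have h1 : ∀ᶠ y in 𝓝 x, fib e ⟨y, D s y (Y y)⟩ =
      mvfderiv I (fun z => fib e ⟨z, s z⟩) y (Y y) + connForm D e y (Y y) (fib e ⟨y, s y⟩) := by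
    filter_upwards [eventually_mem_baseSet hx, hs.eventually] with y hy hsy using fib_cov hy hsy _
  have h2 : SmoothNear I (fun y => connForm D e y (Y y) (fib e ⟨y, s y⟩)) x := by
    simp only [fun y : M => connForm_eq_sum (D := D) (e := e) (Y y) (fib e ⟨y, s y⟩)]
    exact .sum fun k _ => SmoothNear.smul_fun (hs'.clm_comp (coordL F k))
      (hD.smoothNear_connForm hx hY _)
  rw [fib_cov hx (hD Y s x hY hs), mvfderiv_congr h1, mvfderiv_fun_add' (hs'.dirDeriv hY) h2,
    mvfderiv_connForm hD hx hY hs', h1.self_of_nhds, connForm_add]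

lemma fib_sub (hx : x ∈ e.baseSet) (a b : V x) :
    fib e ⟨x, a - b⟩ = fib e ⟨x, a⟩ - fib e ⟨x, b⟩ := by
  rw [fib_mk hx, fib_mk hx, fib_mk hx, map_sub]

lemma fib_neg (hx : x ∈ e.baseSet) (a : V x) : fib e ⟨x, -a⟩ = - fib e ⟨x, a⟩ := by
  rw [fib_mk hx, fib_mk hx, map_neg]

/-- The vertical part of the bracket of two horizontal lifts is given by the curvature. -/
lemma vertPart_mlieBracket_horField (hD : IsSmoothCov D)
    (hX : SmoothSec I E X v.proj) (hY : SmoothSec I E Y v.proj) (hs : SmoothSec I F s v.proj)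
    (hsv : s v.proj = v.2) :
    vertPart D v (mlieBracket (I.prod 𝓘(ℝ, F)) (horField D X) (horField D Y) v) =
      - curvature D X Y s v.proj := by
  set e := trivializationAt F V v.proj
  have hp : v.proj ∈ e.baseSet := mem_baseSet_trivializationAt' _
  have hX' := smoothSec_horField hD hX
  have hY' := smoothSec_horField hD hY
  have hv : fib e ⟨v.proj, s v.proj⟩ = fib e v := by rw [hsv]
  apply fib_eq_of_eq hp
  rw [fib_vertPart hp, projDeriv_mlieBracket hX' hY' hX hY (by simp) (by simp), fib_neg hp,
    curvature, fib_sub hp, fib_sub hp, fib_cov_cov hD hp hY hs, fib_cov_cov hD hp hX hs,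
    fib_cov hp hs, mvfderiv_mlieBracket_vector (smoothNear_fib hp) hX' hY',
    mvfderiv_mlieBracket_vector ((smoothSec_iff_fib hp).1 hs) hX hY,
    mvfderiv_congr (eventually_fib_horField hp), mvfderiv_congr (eventually_fib_horField hp),
    mvfderiv_fun_neg', mvfderiv_fun_neg', mvfderiv_connForm_fib hD hp hX,
    mvfderiv_connForm_fib hD hp hY, (eventually_fib_horField hp).self_of_nhds,
    (eventually_fib_horField hp).self_of_nhds, connForm_neg, connForm_neg, hv,
    projDeriv_horField, projDeriv_horField]
  abel

lemma mlieBracket_horField_horField (hD : IsSmoothCov D) (hflat : IsFlat D)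
    (hX : SmoothSec I E X v.proj) (hY : SmoothSec I E Y v.proj) :
    mlieBracket (I.prod 𝓘(ℝ, F)) (horField D X) (horField D Y) v =
      horLift D v (mlieBracket I X Y v.proj) := by
  apply tangent_total_ext' D
  · rw [projDeriv_mlieBracket (smoothSec_horField hD hX) (smoothSec_horField hD hY) hX hY
      (by simp) (by simp), projDeriv_horLift]
  · have hs := smoothSec_extend I F v.2
    rw [vertPart_mlieBracket_horField hD hX hY hs (extend_apply_self F v.2),
      isFlat_iff.1 hflat X Y _ _ hX hY hs, neg_zero, vertPart_horLift]

end BracketLifts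

section FMultiplication

variable {E : Type*} [NormedAddCommGroup E] [NormedSpace ℝ E] [FiniteDimensional ℝ E]
  {H : Type*} [TopologicalSpace H] {I : ModelWithCorners ℝ E H}
  {B : Type*} [TopologicalSpace B] [ChartedSpace H B] [IsManifold I ∞ B]
  {mul : ∀ x : B, TangentSpace I x →ₗ[ℝ] TangentSpace I x →ₗ[ℝ] TangentSpace I x}

lemma isFMultiplication_iff : IsFMultiplication I mul ↔
    ∀ (X Y Z T : ∀ x : B, TangentSpace I x) (x : B),
      SmoothSec I E X x → SmoothSec I E Y x → SmoothSec I E Z x → SmoothSec I E T x →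
      lieDerivMul I mul (fun y => mul y (X y) (Y y)) Z T x =
        mul x (X x) (lieDerivMul I mul Y Z T x) + mul x (Y x) (lieDerivMul I mul X Z T x) := by
  constructor
  · intro h X Y Z T x hX hY hZ hT
    obtain ⟨U, hU, hUo, hxU⟩ := eventually_nhds_iff.1 ((hX.and hY).and (hZ.and hT))
    exact h U hUo X Y Z T (fun y hy => (hU y hy).1.1.contMDiffWithinAt)
      (fun y hy => (hU y hy).1.2.contMDiffWithinAt) (fun y hy => (hU y hy).2.1.contMDiffWithinAt)
      (fun y hy => (hU y hy).2.2.contMDiffWithinAt) x hxU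
  · intro h U hU X Y Z T hX hY hZ hT x hx
    exact h X Y Z T x (hX.smoothSec hU hx) (hY.smoothSec hU hx) (hZ.smoothSec hU hx)
      (hT.smoothSec hU hx)

end FMultiplication

section TotalLifts

variable {E : Type*} [NormedAddCommGroup E] [NormedSpace ℝ E] [FiniteDimensional ℝ E]
  [CompleteSpace E]
  {H : Type*} [TopologicalSpace H] {I : ModelWithCorners ℝ E H}
  {M : Type*} [TopologicalSpace M] [ChartedSpace H M] [IsManifold I ∞ M]
  {F : Type*} [NormedAddCommGroup F] [NormedSpace ℝ F] [FiniteDimensional ℝ F] [CompleteSpace F]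
  {V : M → Type*} [TopologicalSpace (TotalSpace F V)]
  [∀ x, AddCommGroup (V x)] [∀ x, Module ℝ (V x)] [∀ x, TopologicalSpace (V x)]
  [∀ x, IsTopologicalAddGroup (V x)] [∀ x, ContinuousSMul ℝ (V x)]
  [FiberBundle F V] [VectorBundle ℝ F V] [ContMDiffVectorBundle ∞ F V I]
  {D : CovariantDerivative I F V}
  {mulM : ∀ x : M, TangentSpace I x →ₗ[ℝ] TangentSpace I x →ₗ[ℝ] TangentSpace I x}
  {gM : ∀ x : M, LinearMap.BilinForm ℝ (TangentSpace I x)}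
  {mulV : ∀ x, V x →ₗ[ℝ] V x →ₗ[ℝ] V x} {gV : ∀ x, LinearMap.BilinForm ℝ (V x)}
  {α : ∀ x, V x →ₗ[ℝ] TangentSpace I x}
  {r s t : ∀ x : M, V x} {X Y Z T : ∀ x : M, TangentSpace I x} {x : M} {v : TotalSpace F V}

lemma totalMul_apply (A B : TangentSpace (I.prod 𝓘(ℝ, F)) v) :
    totalMul D mulM mulV α v A B =
      horLift D v (mulM v.proj (projDeriv I v A) (projDeriv I v B) +
        mulM v.proj (α v.proj (vertPart D v A)) (projDeriv I v B) +
        mulM v.proj (α v.proj (vertPart D v B)) (projDeriv I v A)) +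
      vertLift I v (mulV v.proj (vertPart D v A) (vertPart D v B)) := rfl

lemma totalMetric_apply (A B : TangentSpace (I.prod 𝓘(ℝ, F)) v) :
    totalMetric D gM gV α v A B =
      gM v.proj (projDeriv I v A) (projDeriv I v B) +
      gM v.proj (α v.proj (vertPart D v A)) (projDeriv I v B) +
      gM v.proj (α v.proj (vertPart D v B)) (projDeriv I v A) +
      gV v.proj (vertPart D v A) (vertPart D v B) := rfl

lemma vertPart_totalMul (A B : TangentSpace (I.prod 𝓘(ℝ, F)) v) :
    vertPart D v (totalMul D mulM mulV α v A B) =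
      mulV v.proj (vertPart D v A) (vertPart D v B) := by
  rw [totalMul_apply, map_add, vertPart_horLift, vertPart_vertLift, zero_add]

lemma projDeriv_totalMul (A B : TangentSpace (I.prod 𝓘(ℝ, F)) v) :
    projDeriv I v (totalMul D mulM mulV α v A B) =
      mulM v.proj (projDeriv I v A) (projDeriv I v B) +
        mulM v.proj (α v.proj (vertPart D v A)) (projDeriv I v B) +
        mulM v.proj (α v.proj (vertPart D v B)) (projDeriv I v A) := by
  rw [totalMul_apply, map_add, projDeriv_horLift, projDeriv_vertLift, add_zero]

lemma totalMul_horLift_horLift (a b : TangentSpace I v.proj) :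
    totalMul D mulM mulV α v (horLift D v a) (horLift D v b) = horLift D v (mulM v.proj a b) := by
  simp [totalMul_apply]

lemma totalMul_vertLift_horLift (a : V v.proj) (b : TangentSpace I v.proj) :
    totalMul D mulM mulV α v (vertLift I v a) (horLift D v b) =
      horLift D v (mulM v.proj (α v.proj a) b) := by
  simp [totalMul_apply]

lemma totalMul_horLift_vertLift (a : V v.proj) (b : TangentSpace I v.proj) :
    totalMul D mulM mulV α v (horLift D v b) (vertLift I v a) =
      horLift D v (mulM v.proj (α v.proj a) b) := by
  simp [totalMul_apply]

lemma totalMul_vertLift_vertLift (a b : V v.proj) :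
    totalMul D mulM mulV α v (vertLift I v a) (vertLift I v b) =
      vertLift I v (mulV v.proj a b) := by
  simp [totalMul_apply]

lemma totalMul_horField_horField (w : TotalSpace F V) :
    totalMul D mulM mulV α w (horField D X w) (horField D Y w) =
      horField D (fun y => mulM y (X y) (Y y)) w := totalMul_horLift_horLift _ _

lemma totalMul_vertField_horField (w : TotalSpace F V) :
    totalMul D mulM mulV α w (vertField I s w) (horField D Y w) =
      horField D (fun y => mulM y (α y (s y)) (Y y)) w := totalMul_vertLift_horLift _ _

lemma totalMul_horField_vertField (w : TotalSpace F V) :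
    totalMul D mulM mulV α w (horField D Y w) (vertField I s w) =
      horField D (fun y => mulM y (α y (s y)) (Y y)) w := totalMul_horLift_vertLift _ _

lemma totalMul_vertField_vertField (w : TotalSpace F V) :
    totalMul D mulM mulV α w (vertField I s w) (vertField I t w) =
      vertField I (fun y => mulV y (s y) (t y)) w := totalMul_vertLift_vertLift _ _

lemma totalMetric_horLift_horLift (a b : TangentSpace I v.proj) :
    totalMetric D gM gV α v (horLift D v a) (horLift D v b) = gM v.proj a b := by
  simp [totalMetric_apply]

lemma totalMetric_vertLift_horLift (a : V v.proj) (b : TangentSpace I v.proj) :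
    totalMetric D gM gV α v (vertLift I v a) (horLift D v b) = gM v.proj (α v.proj a) b := by
  simp [totalMetric_apply]

lemma totalMetric_horLift_vertLift (a : V v.proj) (b : TangentSpace I v.proj) :
    totalMetric D gM gV α v (horLift D v b) (vertLift I v a) = gM v.proj (α v.proj a) b := by
  simp [totalMetric_apply]

lemma totalMetric_vertLift_vertLift (a b : V v.proj) :
    totalMetric D gM gV α v (vertLift I v a) (vertLift I v b) = gV v.proj a b := by
  simp [totalMetric_apply]

lemma totalMetric_horField_horField (w : TotalSpace F V) :
    totalMetric D gM gV α w (horField D X w) (horField D Y w) = gM w.proj (X w.proj) (Y w.proj) :=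
  totalMetric_horLift_horLift _ _

lemma totalMetric_vertField_horField (w : TotalSpace F V) :
    totalMetric D gM gV α w (vertField I s w) (horField D Y w) =
      gM w.proj (α w.proj (s w.proj)) (Y w.proj) :=
  totalMetric_vertLift_horLift _ _

lemma totalMetric_horField_vertField (w : TotalSpace F V) :
    totalMetric D gM gV α w (horField D Y w) (vertField I s w) =
      gM w.proj (α w.proj (s w.proj)) (Y w.proj) :=
  totalMetric_horLift_vertLift _ _

lemma totalMetric_vertField_vertField (w : TotalSpace F V) :
    totalMetric D gM gV α w (vertField I s w) (vertField I t w) =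
      gV w.proj (s w.proj) (t w.proj) :=
  totalMetric_vertLift_vertLift _ _

lemma mlieBracket_vertField_horField (hD : IsSmoothCov D)
    (hX : SmoothSec I E X v.proj) (hs : SmoothSec I F s v.proj) :
    mlieBracket (I.prod 𝓘(ℝ, F)) (vertField I s) (horField D X) v =
      - vertLift I v (D s v.proj (X v.proj)) := by
  rw [mlieBracket_swap_apply, mlieBracket_horField_vertField hD hX hs]

lemma vertPart_lieDerivMul (A A' A'' : ∀ v : TotalSpace F V, TangentSpace (I.prod 𝓘(ℝ, F)) v) :
    vertPart D v (lieDerivMul (I.prod 𝓘(ℝ, F)) (totalMul D mulM mulV α) A A' A'' v) =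
      vertPart D v (mlieBracket (I.prod 𝓘(ℝ, F)) A
        (fun w => totalMul D mulM mulV α w (A' w) (A'' w)) v) -
      mulV v.proj (vertPart D v (mlieBracket (I.prod 𝓘(ℝ, F)) A A' v)) (vertPart D v (A'' v)) -
      mulV v.proj (vertPart D v (A' v)) (vertPart D v (mlieBracket (I.prod 𝓘(ℝ, F)) A A'' v)) := by
  rw [lieDerivMul, map_sub, map_sub, vertPart_totalMul, vertPart_totalMul]

lemma lieDerivMul_horField_horField_horField (hD : IsSmoothCov D) (hflat : IsFlat D)
    (hX : SmoothSec I E X v.proj) (hZ : SmoothSec I E Z v.proj) (hT : SmoothSec I E T v.proj)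
    (hZT : SmoothSec I E (fun y => mulM y (Z y) (T y)) v.proj) :
    lieDerivMul (I.prod 𝓘(ℝ, F)) (totalMul D mulM mulV α) (horField D X) (horField D Z)
      (horField D T) v = horLift D v (lieDerivMul I mulM X Z T v.proj) := by
  simp only [lieDerivMul, totalMul_horField_horField]
  rw [mlieBracket_horField_horField hD hflat hX hZT, mlieBracket_horField_horField hD hflat hX hZ,
    mlieBracket_horField_horField hD hflat hX hT]
  simp only [horField, totalMul_horLift_horLift, map_sub]

lemma lieDerivMul_horField_horField_vertField (hD : IsSmoothCov D) (hflat : IsFlat D)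
    (hX : SmoothSec I E X v.proj) (hZ : SmoothSec I E Z v.proj) (ht : SmoothSec I F t v.proj)
    (hZt : SmoothSec I E (fun y => mulM y (α y (t y)) (Z y)) v.proj) :
    lieDerivMul (I.prod 𝓘(ℝ, F)) (totalMul D mulM mulV α) (horField D X) (horField D Z)
      (vertField I t) v =
      horLift D v (mlieBracket I X (fun y => mulM y (α y (t y)) (Z y)) v.proj -
        mulM v.proj (α v.proj (t v.proj)) (mlieBracket I X Z v.proj) -
        mulM v.proj (α v.proj (D t v.proj (X v.proj))) (Z v.proj)) := by
  simp only [lieDerivMul, totalMul_horField_vertField]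
  rw [mlieBracket_horField_horField hD hflat hX hZt, mlieBracket_horField_horField hD hflat hX hZ,
    mlieBracket_horField_vertField hD hX ht]
  simp only [horField, vertField, totalMul_horLift_vertLift, map_sub]

lemma lieDerivMul_horField_vertField_vertField (hD : IsSmoothCov D)
    (hX : SmoothSec I E X v.proj) (hs : SmoothSec I F s v.proj) (ht : SmoothSec I F t v.proj)
    (hst : SmoothSec I F (fun y => mulV y (s y) (t y)) v.proj) :
    lieDerivMul (I.prod 𝓘(ℝ, F)) (totalMul D mulM mulV α) (horField D X) (vertField I s)
      (vertField I t) v =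
      vertLift I v (D (fun y => mulV y (s y) (t y)) v.proj (X v.proj) -
        mulV v.proj (D s v.proj (X v.proj)) (t v.proj) -
        mulV v.proj (s v.proj) (D t v.proj (X v.proj))) := by
  simp only [lieDerivMul, totalMul_vertField_vertField]
  rw [mlieBracket_horField_vertField hD hX hst, mlieBracket_horField_vertField hD hX hs,
    mlieBracket_horField_vertField hD hX ht]
  simp only [vertField, totalMul_vertLift_vertLift, map_sub]

lemma lieDerivMul_vertField_horField_horField (hD : IsSmoothCov D)
    (hs : SmoothSec I F s v.proj) (hZ : SmoothSec I E Z v.proj) (hT : SmoothSec I E T v.proj)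
    (hZT : SmoothSec I E (fun y => mulM y (Z y) (T y)) v.proj) :
    lieDerivMul (I.prod 𝓘(ℝ, F)) (totalMul D mulM mulV α) (vertField I s) (horField D Z)
      (horField D T) v =
      - vertLift I v (D s v.proj (mulM v.proj (Z v.proj) (T v.proj))) +
        horLift D v (mulM v.proj (α v.proj (D s v.proj (Z v.proj))) (T v.proj)) +
        horLift D v (mulM v.proj (α v.proj (D s v.proj (T v.proj))) (Z v.proj)) := by
  simp only [lieDerivMul, totalMul_horField_horField]
  rw [mlieBracket_vertField_horField hD hZT hs, mlieBracket_vertField_horField hD hZ hs,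
    mlieBracket_vertField_horField hD hT hs]
  simp only [horField, map_neg, LinearMap.neg_apply, totalMul_horLift_vertLift,
    totalMul_vertLift_horLift, sub_neg_eq_add]

lemma lieDerivMul_vertField_horField_vertField (hD : IsSmoothCov D)
    (hs : SmoothSec I F s v.proj) (hZ : SmoothSec I E Z v.proj) (ht : SmoothSec I F t v.proj)
    (hZt : SmoothSec I E (fun y => mulM y (α y (t y)) (Z y)) v.proj) :
    lieDerivMul (I.prod 𝓘(ℝ, F)) (totalMul D mulM mulV α) (vertField I s) (horField D Z)
      (vertField I t) v =
      vertLift I v (mulV v.proj (D s v.proj (Z v.proj)) (t v.proj) -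
        D s v.proj (mulM v.proj (α v.proj (t v.proj)) (Z v.proj))) := by
  simp only [lieDerivMul, totalMul_horField_vertField]
  rw [mlieBracket_vertField_horField hD hZt hs, mlieBracket_vertField_horField hD hZ hs,
    mlieBracket_vertField_vertField hs ht]
  simp only [vertField, map_neg, LinearMap.neg_apply, totalMul_vertLift_vertLift, map_zero,
    map_sub]
  abel

lemma lieDerivMul_vertField_vertField_vertField
    (hr : SmoothSec I F r v.proj) (hs : SmoothSec I F s v.proj) (ht : SmoothSec I F t v.proj)
    (hst : SmoothSec I F (fun y => mulV y (s y) (t y)) v.proj) :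
    lieDerivMul (I.prod 𝓘(ℝ, F)) (totalMul D mulM mulV α) (vertField I r) (vertField I s)
      (vertField I t) v = 0 := by
  simp only [lieDerivMul, totalMul_vertField_vertField]
  rw [mlieBracket_vertField_vertField hr hst, mlieBracket_vertField_vertField hr hs,
    mlieBracket_vertField_vertField hr ht]
  simp

end TotalLifts

section Necessity

variable {E : Type*} [NormedAddCommGroup E] [NormedSpace ℝ E] [FiniteDimensional ℝ E]
  [CompleteSpace E]
  {H : Type*} [TopologicalSpace H] {I : ModelWithCorners ℝ E H}
  {M : Type*} [TopologicalSpace M] [ChartedSpace H M] [IsManifold I ∞ M]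
  {F : Type*} [NormedAddCommGroup F] [NormedSpace ℝ F] [FiniteDimensional ℝ F] [CompleteSpace F]
  {V : M → Type*} [TopologicalSpace (TotalSpace F V)]
  [∀ x, AddCommGroup (V x)] [∀ x, Module ℝ (V x)] [∀ x, TopologicalSpace (V x)]
  [∀ x, IsTopologicalAddGroup (V x)] [∀ x, ContinuousSMul ℝ (V x)]
  [FiberBundle F V] [VectorBundle ℝ F V] [ContMDiffVectorBundle ∞ F V I]
  {D : CovariantDerivative I F V}
  {mulM : ∀ x : M, TangentSpace I x →ₗ[ℝ] TangentSpace I x →ₗ[ℝ] TangentSpace I x}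
  {eM : ∀ x : M, TangentSpace I x}
  {gM : ∀ x : M, LinearMap.BilinForm ℝ (TangentSpace I x)}
  {mulV : ∀ x, V x →ₗ[ℝ] V x →ₗ[ℝ] V x} {eV : ∀ x, V x} {gV : ∀ x, LinearMap.BilinForm ℝ (V x)}
  {α : ∀ x, V x →ₗ[ℝ] TangentSpace I x}
  {r s t : ∀ x : M, V x} {X Y Z T : ∀ x : M, TangentSpace I x} {x : M} {v : TotalSpace F V}

/-- The `F`-manifold identity on the total space forces the connection to be flat. -/
lemma isFlat_of_isFMultiplication (hD : IsSmoothCov D) (hM : IsAlmostFrobenius I mulM eM gM)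
    (hT : IsFMultiplication (I.prod 𝓘(ℝ, F)) (totalMul D mulM mulV α)) : IsFlat D := by
  refine isFlat_iff.2 fun X Y s x hX hY hs => ?_
  let v : TotalSpace F V := ⟨x, s x⟩
  have he := hM.smoothSec_unit x
  have hX' := smoothSec_horField (v := v) hD hX
  have hY' := smoothSec_horField (v := v) hD hY
  have he' := smoothSec_horField (v := v) hD he
  have key := congrArg (vertPart D v)
    (isFMultiplication_iff.1 hT _ _ _ _ v hX' he' hY' he')
  simp only [totalMul_horField_horField, map_add, vertPart_totalMul, vertPart_lieDerivMul,
    vertPart_horField, hM.mul_unit, map_zero, LinearMap.zero_apply, sub_zero, add_zero] at key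
  have h := vertPart_mlieBracket_horField (v := v) hD hX hY hs rfl
  rw [← neg_eq_zero, ← h]
  exact key

/-- The `F`-manifold identity on the total space forces the fibre multiplication to be parallel. -/
lemma isParallelMul_of_isFMultiplication (hD : IsSmoothCov D) (hM : IsAlmostFrobenius I mulM eM gM)
    (hV : IsFrobeniusAlgebraBundle I F mulV eV gV)
    (hT : IsFMultiplication (I.prod 𝓘(ℝ, F)) (totalMul D mulM mulV α)) : IsParallelMul D mulV := by
  refine isParallelMul_iff.2 fun s t x hs ht ξ => ?_
  let v : TotalSpace F V := ⟨x, s x⟩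
  let X : ∀ x : M, TangentSpace I x := extend E ξ
  have hX : SmoothSec I E X x := smoothSec_extend I E ξ
  have hXx : X x = ξ := extend_apply_self ..
  have he := hM.smoothSec_unit x
  have hX' := smoothSec_horField (v := v) hD hX
  have he' := smoothSec_horField (v := v) hD he
  have key := congrArg (vertPart D v)
    (isFMultiplication_iff.1 hT _ _ _ _ v hX' he' (smoothSec_vertField (v := v) hs)
      (smoothSec_vertField (v := v) ht))
  have h1 : horField D (fun y => mulM y (X y) (eM y)) = (horField D X : ∀ v : TotalSpace F V, _) := by
    simp only [hM.mul_unit]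
  simp only [totalMul_horField_horField, h1] at key
  rw [lieDerivMul_horField_vertField_vertField (v := v) hD hX hs ht (hV.smoothSec_mul hs ht)] at key
  simp only [map_add, vertPart_totalMul, vertPart_vertLift,
    vertPart_horField, map_zero, LinearMap.zero_apply, add_zero] at key
  rw [← hXx, ← sub_eq_zero, ← key]
  abel

lemma cov_unit_eq_zero (hV : IsFrobeniusAlgebraBundle I F mulV eV gV)
    (h : IsParallelMul D mulV) (x : M) : D eV x = 0 := by
  ext ξ
  have he := hV.smoothSec_unit x
  have key := isParallelMul_iff.1 h eV eV x he he ξ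
  simp only [hV.mul_unit, hV.unit_mul] at key
  simpa using key

lemma lieDerivMul_unit (hM : IsAlmostFrobenius I mulM eM gM) (hF : IsFMultiplication I mulM)
    (hZ : SmoothSec I E Z x) (hT : SmoothSec I E T x) : lieDerivMul I mulM eM Z T x = 0 := by
  have he := hM.smoothSec_unit x
  have key := isFMultiplication_iff.1 hF eM eM Z T x he he hZ hT
  simp only [hM.unit_mul] at key
  simpa using key

/-- The `F`-manifold identity on the total space, for one vertical and two horizontal fields. -/
lemma lieDerivMul_morphism (hD : IsSmoothCov D) (hM : IsAlmostFrobenius I mulM eM gM)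
    (hF : IsFMultiplication I mulM) (hα : IsSmoothMorphism I F α)
    (hT : IsFMultiplication (I.prod 𝓘(ℝ, F)) (totalMul D mulM mulV α))
    (hs : SmoothSec I F s x) (hZ : SmoothSec I E Z x) (hT' : SmoothSec I E T x) :
    lieDerivMul I mulM (fun y => α y (s y)) Z T x =
      - α x (D s x (mulM x (Z x) (T x))) + mulM x (α x (D s x (Z x))) (T x) +
        mulM x (α x (D s x (T x))) (Z x) := by
  have hflat := isFlat_of_isFMultiplication hD hM hT
  let v : TotalSpace F V := ⟨x, s x⟩
  have he := hM.smoothSec_unit x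
  have hαs := isSmoothMorphism_iff.1 hα s x hs
  have key := congrArg (projDeriv I v)
    (isFMultiplication_iff.1 hT _ _ _ _ v (smoothSec_vertField (v := v) hs)
      (smoothSec_horField (v := v) hD he) (smoothSec_horField (v := v) hD hZ)
      (smoothSec_horField (v := v) hD hT'))
  have h1 : horField D (fun y => mulM y (α y (s y)) (eM y)) =
      (horField D (fun y => α y (s y)) : ∀ v : TotalSpace F V, _) := by
    simp only [hM.mul_unit]
  simp only [totalMul_vertField_horField, h1] at key
  have hZT := hM.smoothSec_mul hZ hT'
  rw [lieDerivMul_horField_horField_horField (v := v) hD hflat hαs hZ hT' hZT,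
    lieDerivMul_horField_horField_horField (v := v) hD hflat he hZ hT' hZT,
    lieDerivMul_vertField_horField_horField (v := v) hD hs hZ hT' hZT,
    lieDerivMul_unit hM hF hZ hT'] at key
  simp only [map_add, map_neg, map_zero, horField, totalMul_horLift_horLift, zero_add,
    totalMul_horLift_vertLift, projDeriv_horLift, hM.mul_unit, hM.unit_mul] at key
  exact key

/-- When the fibre multiplication and `g(e, ·)` are parallel, so is the metric. -/
lemma isParallelMetric_of_unit (hV : IsFrobeniusAlgebraBundle I F mulV eV gV)
    (h : IsParallelMul D mulV)
    (h' : ∀ (t : ∀ x, V x) (x : M), SmoothSec I F t x → ∀ ξ : TangentSpace I x,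
      mvfderiv I (fun y => gV y (eV y) (t y)) x ξ = gV x (eV x) (D t x ξ)) :
    IsParallelMetric D gV := by
  refine isParallelMetric_iff.2 fun s t x hs ht ξ => ?_
  have h1 (y : M) (a b : V y) : gV y a b = gV y (eV y) (mulV y a b) := by
    rw [← hV.metric_invariant, hV.unit_mul]
  have h2 : (fun y => gV y (s y) (t y)) = fun y => gV y (eV y) (mulV y (s y) (t y)) :=
    funext fun y => h1 y _ _
  rw [h2, h1 x (D s x ξ), h1 x (s x), h' _ x (hV.smoothSec_mul hs ht), isParallelMul_iff.1 h s t x hs ht, map_add]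

lemma mvfderiv_comp_proj_vertField {f : M → ℝ} (hf : SmoothNear I f v.proj) :
    mvfderiv (I.prod 𝓘(ℝ, F)) (fun w : TotalSpace F V => f w.proj) v (vertField I s v) = 0 := by
  rw [mvfderiv_comp_proj hf, projDeriv_vertField, map_zero]

lemma mvfderiv_comp_proj_horField {f : M → ℝ} (hf : SmoothNear I f v.proj) :
    mvfderiv (I.prod 𝓘(ℝ, F)) (fun w : TotalSpace F V => f w.proj) v (horField D X v) =
      mvfderiv I f v.proj (X v.proj) := by
  rw [mvfderiv_comp_proj hf, projDeriv_horField]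

variable {nabla : CovariantDerivative (I.prod 𝓘(ℝ, F)) (E × F)
  (TangentSpace (I.prod 𝓘(ℝ, F)) : TotalSpace F V → Type _)}

lemma mvfderiv_metric_unit (hD : IsSmoothCov D) (hM : IsAlmostFrobenius I mulM eM gM)
    (hV : IsFrobeniusAlgebraBundle I F mulV eV gV) (hα : IsSmoothMorphism I F α)
    (hg : ∀ v, (totalMetric D gM gV α v).IsSymm)
    (hL : IsLeviCivita nabla (totalMetric D gM gV α)) (he : ∀ x, D eV x = 0)
    (hE : ∀ v, nabla (totalUnit I eV) v = 0) (ht : SmoothSec I F t x) (ξ : TangentSpace I x) :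
    mvfderiv I (fun y => gV y (eV y) (t y)) x ξ = gV x (eV x) (D t x ξ) := by
  let v : TotalSpace F V := ⟨x, 0⟩
  let X : ∀ x : M, TangentSpace I x := extend E ξ
  have hX : SmoothSec I E X x := smoothSec_extend I E ξ
  have hXx : X x = ξ := extend_apply_self ..
  have hu := hV.smoothSec_unit x
  have hαt := isSmoothMorphism_iff.1 hα t x ht
  have hαu := isSmoothMorphism_iff.1 hα eV x hu
  have key := hL.koszul (x := v) hg (smoothSec_horField hD hX) (smoothSec_vertField hu)
    (smoothSec_vertField ht)
  have hE' : nabla (vertField I eV) v = 0 := hE v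
  simp only [totalMetric_vertField_vertField, totalMetric_horField_vertField, hE'] at key
  rw [mvfderiv_comp_proj_horField (v := v) (hV.smoothNear_metric hu ht),
    mvfderiv_comp_proj_vertField (v := v) (hM.smoothNear_metric hαt hX),
    mvfderiv_comp_proj_vertField (v := v) (hM.smoothNear_metric hαu hX),
    mlieBracket_horField_vertField (v := v) hD hX hu, mlieBracket_horField_vertField (v := v) hD hX ht,
    mlieBracket_vertField_vertField (v := v) hu ht, he] at key
  simp only [vertField, totalMetric_vertLift_vertLift, zero_apply, map_zero,
    LinearMap.zero_apply] at key
  rw [← hXx, hV.symm (eV x)]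
  simp only [v] at key
  linarith

lemma nabla_vertField_vertField (hD : IsSmoothCov D) (hM : IsAlmostFrobenius I mulM eM gM)
    (hV : IsFrobeniusAlgebraBundle I F mulV eV gV) (hα : IsSmoothMorphism I F α)
    (hP : IsParallelMetric D gV)
    (hA : IsAlmostFrobenius (I.prod 𝓘(ℝ, F)) (totalMul D mulM mulV α) (totalUnit I eV)
      (totalMetric D gM gV α)) (hL : IsLeviCivita nabla (totalMetric D gM gV α))
    (hs : SmoothSec I F s v.proj) (ht : SmoothSec I F t v.proj) :
    nabla (vertField I t) v (vertField I s v) = 0 := by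
  refine hA.eq_of_metric_eq fun C => ?_
  rw [← horLift_add_vertLift D C, map_zero, LinearMap.zero_apply, map_add]
  have hαt := isSmoothMorphism_iff.1 hα t _ ht
  have hαs := isSmoothMorphism_iff.1 hα s _ hs
  have h1 (r : V v.proj) : totalMetric D gM gV α v
      (nabla (vertField I t) v (vertField I s v)) (vertLift I v r) = 0 := by
    have hr := smoothSec_extend I F r
    have hrr : extend F r v.proj = r := extend_apply_self ..
    have key := hL.koszul (x := v) hA.metric_symm (smoothSec_vertField hs) (smoothSec_vertField ht)
      (smoothSec_vertField hr)
    simp only [totalMetric_vertField_vertField] at key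
    rw [mvfderiv_comp_proj_vertField (hV.smoothNear_metric ht hr),
      mvfderiv_comp_proj_vertField (hV.smoothNear_metric hs hr),
      mvfderiv_comp_proj_vertField (hV.smoothNear_metric hs ht),
      mlieBracket_vertField_vertField hs ht, mlieBracket_vertField_vertField hs hr,
      mlieBracket_vertField_vertField ht hr] at key
    simpa [vertField, hrr] using key
  have h2 (ξ : TangentSpace I v.proj) : totalMetric D gM gV α v
      (nabla (vertField I t) v (vertField I s v)) (horLift D v ξ) = 0 := by
    have hX : SmoothSec I E (extend E ξ) v.proj := smoothSec_extend I E ξ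
    have hXx : extend E ξ v.proj = ξ := extend_apply_self ..
    have key := hL.koszul (x := v) hA.metric_symm (smoothSec_vertField hs) (smoothSec_vertField ht)
      (smoothSec_horField hD hX)
    simp only [totalMetric_vertField_vertField, totalMetric_vertField_horField] at key
    rw [mvfderiv_comp_proj_vertField (hM.smoothNear_metric hαt hX),
      mvfderiv_comp_proj_vertField (hM.smoothNear_metric hαs hX),
      mvfderiv_comp_proj_horField (hV.smoothNear_metric hs ht),
      mlieBracket_vertField_vertField hs ht, mlieBracket_vertField_horField hD hX hs,
      mlieBracket_vertField_horField hD hX ht, isParallelMetric_iff.1 hP s t _ hs ht] at key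
    simp only [vertField, horField, map_neg, LinearMap.neg_apply, map_zero, LinearMap.zero_apply,
      totalMetric_vertLift_vertLift, hXx] at key
    have := hV.symm (s v.proj) (D t v.proj ξ)
    simp only [vertField]
    linarith
  rw [h1, h2, add_zero]

lemma totalMetric_nabla_horField_horField (hD : IsSmoothCov D)
    (hM : IsAlmostFrobenius I mulM eM gM) (hα : IsSmoothMorphism I F α)
    (hg : ∀ v, (totalMetric D gM gV α v).IsSymm) (hflat : IsFlat D)
    (hL : IsLeviCivita nabla (totalMetric D gM gV α))
    (hX : SmoothSec I E X v.proj) (hY : SmoothSec I E Y v.proj) (hs : SmoothSec I F s v.proj) :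
    2 * totalMetric D gM gV α v (nabla (horField D X) v (vertField I s v)) (horField D Y v) =
      mvfderiv I (fun y => gM y (α y (s y)) (Y y)) v.proj (X v.proj) -
      mvfderiv I (fun y => gM y (α y (s y)) (X y)) v.proj (Y v.proj) -
      gM v.proj (α v.proj (D s v.proj (X v.proj))) (Y v.proj) +
      gM v.proj (α v.proj (D s v.proj (Y v.proj))) (X v.proj) -
      gM v.proj (α v.proj (s v.proj)) (mlieBracket I X Y v.proj) := by
  have hαs := isSmoothMorphism_iff.1 hα s _ hs
  rw [hL.koszul (x := v) hg (smoothSec_vertField hs) (smoothSec_horField hD hX)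
    (smoothSec_horField hD hY)]
  simp only [totalMetric_vertField_horField, totalMetric_horField_horField]
  rw [mvfderiv_comp_proj_vertField (hM.smoothNear_metric hX hY),
    mvfderiv_comp_proj_horField (hM.smoothNear_metric hαs hY),
    mvfderiv_comp_proj_horField (hM.smoothNear_metric hαs hX),
    mlieBracket_vertField_horField hD hX hs, mlieBracket_vertField_horField hD hY hs,
    mlieBracket_horField_horField hD hflat hX hY]
  simp only [vertField, horField, map_neg, LinearMap.neg_apply, totalMetric_vertLift_horLift,
    totalMetric_horLift_vertLift]
  ring

/-- Flatness and positivity of the metric on the total space: the covariant derivatives of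
horizontal lifts in vertical directions vanish. -/
lemma nabla_horField_vertField (hD : IsSmoothCov D) (hM : IsAlmostFrobenius I mulM eM gM)
    (hV : IsFrobeniusAlgebraBundle I F mulV eV gV) (hα : IsSmoothMorphism I F α)
    (hP : IsParallelMetric D gV) (hflat : IsFlat D)
    (hA : IsAlmostFrobenius (I.prod 𝓘(ℝ, F)) (totalMul D mulM mulV α) (totalUnit I eV)
      (totalMetric D gM gV α)) (hL : IsLeviCivita nabla (totalMetric D gM gV α))
    (hflat' : IsFlat nabla) (hpos : ∀ v, IsPosDef (totalMetric D gM gV α v))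
    (hX : SmoothSec I E X v.proj) (hs : SmoothSec I F s v.proj) :
    nabla (horField D X) v (vertField I s v) = 0 := by
  have hX' := smoothSec_horField hD hX
  have hs' := smoothSec_vertField hs
  let S : ∀ w : TotalSpace F V, TangentSpace (I.prod 𝓘(ℝ, F)) w :=
    fun w => nabla (horField D X) w (vertField I s w)
  have hS : SmoothSec (I.prod 𝓘(ℝ, F)) (E × F) S v := hL.isSmoothCov hA _ _ v hs' hX'
  have hDs : SmoothSec I F (fun y => D s y (X y)) v.proj := hD X s _ hX hs
  have hev : ∀ᶠ w : TotalSpace F V in 𝓝 v, SmoothSec I E X w.proj ∧ SmoothSec I F s w.proj :=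
    eventually_proj (hX.eventually.and hs.eventually)
  -- the covariant derivative of `S` in the direction of `s` vanishes
  have h1 : nabla S v (vertField I s v) = 0 := by
    have hc := isFlat_iff.1 hflat' _ _ _ v hs' hX' hs'
    have e1 : ∀ᶠ w in 𝓝 v, nabla (vertField I s) w (horField D X w) =
        S w + vertField I (fun y => D s y (X y)) w := by
      filter_upwards [hev] with w hw
      have := hL.torsion_free (x := w) (smoothSec_horField hD hw.1) (smoothSec_vertField hw.2)
      rw [mlieBracket_horField_vertField hD hw.1 hw.2, sub_eq_iff_eq_add'] at this
      exact this
    have e2 : ∀ᶠ w in 𝓝 v, nabla (vertField I s) w (vertField I s w) = 0 := by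
      filter_upwards [hev] with w hw
      exact nabla_vertField_vertField hD hM hV hα hP hA hL hw.2 hw.2
    have e3 : nabla (vertField I s) v (vertLift I v (D s v.proj (X v.proj))) = 0 :=
      nabla_vertField_vertField hD hM hV hα hP hA hL hDs hs
    rw [curvature, cov_congr (hS.add (smoothSec_vertField hDs)) e1,
      cov_add hS (smoothSec_vertField hDs), cov_congr smoothSec_zero e2, cov_zero,
      mlieBracket_vertField_horField hD hX hs, map_neg, e3, add_apply,
      nabla_vertField_vertField hD hM hV hα hP hA hL hs hDs] at hc
    simpa using hc
  have h2 : ∀ᶠ w in 𝓝 v, totalMetric D gM gV α w (S w) (horField D X w) = 0 := by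
    filter_upwards [hev] with w hw
    have := totalMetric_nabla_horField_horField hD hM hα hA.metric_symm hflat hL hw.1 hw.1 hw.2
    rw [mlieBracket_self] at this
    simpa using this
  have h3 := hL.metric hS hX' (vertField I s v)
  rw [mvfderiv_congr h2, mvfderiv_const_apply, h1, map_zero, LinearMap.zero_apply, zero_add] at h3
  by_contra hne
  exact ((hpos v).2 _ hne).ne h3

/-- A symmetry forced by the flatness of a positive definite metric on the total space. -/
lemma metric_morphism_closed (hD : IsSmoothCov D) (hM : IsAlmostFrobenius I mulM eM gM)
    (hV : IsFrobeniusAlgebraBundle I F mulV eV gV) (hα : IsSmoothMorphism I F α)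
    (hP : IsParallelMetric D gV) (hflat : IsFlat D)
    (hA : IsAlmostFrobenius (I.prod 𝓘(ℝ, F)) (totalMul D mulM mulV α) (totalUnit I eV)
      (totalMetric D gM gV α)) (hL : IsLeviCivita nabla (totalMetric D gM gV α))
    (hflat' : IsFlat nabla) (hpos : ∀ v, IsPosDef (totalMetric D gM gV α v))
    (hX : SmoothSec I E X x) (hY : SmoothSec I E Y x) (hs : SmoothSec I F s x) :
    mvfderiv I (fun y => gM y (α y (s y)) (Y y)) x (X x) -
      mvfderiv I (fun y => gM y (α y (s y)) (X y)) x (Y x) -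
      gM x (α x (D s x (X x))) (Y x) + gM x (α x (D s x (Y x))) (X x) -
      gM x (α x (s x)) (mlieBracket I X Y x) = 0 := by
  let v : TotalSpace F V := ⟨x, 0⟩
  have h := totalMetric_nabla_horField_horField (v := v) hD hM hα hA.metric_symm hflat hL hX hY hs
  rw [nabla_horField_vertField (v := v) hD hM hV hα hP hflat hA hL hflat' hpos hX hs] at h
  simp only [map_zero, LinearMap.zero_apply, mul_zero] at h
  exact h.symm

end Necessity

section CoordinateFields

variable {n : ℕ} {M : Type*} [TopologicalSpace M] [ChartedSpace (EuclideanSpace ℝ (Fin n)) M]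
  [IsManifold (𝓡 n) ∞ M] {u : OpenPartialHomeomorph M (EuclideanSpace ℝ (Fin n))} {p : M}
  {i j k : Fin n}

lemma smoothNear_chart (hu : u ∈ IsManifold.maximalAtlas (𝓡 n) ∞ M) (hp : p ∈ u.source) :
    SmoothNear (𝓡 n) u p :=
  smoothNear_of_contMDiffOn u.open_source (contMDiffOn_of_mem_maximalAtlas hu) hp

lemma smoothNear_chart_symm (hu : u ∈ IsManifold.maximalAtlas (𝓡 n) ∞ M) (hp : p ∈ u.source) :
    ∀ᶠ z in 𝓝 (u p), ContMDiffAt (𝓡 n) (𝓡 n) ∞ u.symm z := by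
  filter_upwards [u.open_target.mem_nhds (u.map_source hp)] with z hz
  exact (contMDiffOn_symm_of_mem_maximalAtlas hu z hz).contMDiffAt (u.open_target.mem_nhds hz)

lemma smoothNear_chart_coord (hu : u ∈ IsManifold.maximalAtlas (𝓡 n) ∞ M) (hp : p ∈ u.source)
    (k : Fin n) : SmoothNear (𝓡 n) (fun q => u q k) p :=
  (smoothNear_chart hu hp).clm_comp (EuclideanSpace.proj k : EuclideanSpace ℝ (Fin n) →L[ℝ] ℝ)

lemma mvfderiv_coordField {G : Type*} [NormedAddCommGroup G] [NormedSpace ℝ G]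
    (hu : u ∈ IsManifold.maximalAtlas (𝓡 n) ∞ M) (hp : p ∈ u.source) (k : Fin n) {f : M → G}
    (hf : SmoothNear (𝓡 n) f p) : mvfderiv (𝓡 n) f p (coordField u k p) =
      fderiv ℝ (fun z => f (u.symm z)) (u p) (EuclideanSpace.single k 1) := by
  have h := (smoothNear_chart_symm hu hp).self_of_nhds.mdifferentiableAt (by simp)
  have := mfderiv_comp_apply_of_eq' hf.mdifferentiableAt h (u.left_inv hp)
    (EuclideanSpace.single k 1)
  refine this.symm.trans ?_
  rw [mfderiv_eq_fderiv]
  rfl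

lemma mvfderiv_chart_coordField (hu : u ∈ IsManifold.maximalAtlas (𝓡 n) ∞ M) (hp : p ∈ u.source)
    (k : Fin n) : mvfderiv (𝓡 n) u p (coordField u k p) = EuclideanSpace.single k 1 := by
  rw [mvfderiv_coordField hu hp k (smoothNear_chart hu hp)]
  have : (fun z => u (u.symm z)) =ᶠ[𝓝 (u p)] id := by
    filter_upwards [u.open_target.mem_nhds (u.map_source hp)] with z hz using u.right_inv hz
  rw [this.fderiv_eq, fderiv_id]
  rfl

lemma mvfderiv_chart_coord (hu : u ∈ IsManifold.maximalAtlas (𝓡 n) ∞ M) (hp : p ∈ u.source)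
    (k : Fin n) (ξ : TangentSpace (𝓡 n) p) :
    mvfderiv (𝓡 n) (fun q => u q k) p ξ = (mvfderiv (𝓡 n) u p ξ : EuclideanSpace ℝ (Fin n)) k :=
  mvfderiv_clm_comp (EuclideanSpace.proj k : EuclideanSpace ℝ (Fin n) →L[ℝ] ℝ)
    (smoothNear_chart hu hp) ξ

lemma mvfderiv_chart_coord_coordField (hu : u ∈ IsManifold.maximalAtlas (𝓡 n) ∞ M)
    (hp : p ∈ u.source) (i k : Fin n) :
    mvfderiv (𝓡 n) (fun q => u q k) p (coordField u i p) = if k = i then 1 else 0 := by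
  rw [mvfderiv_chart_coord hu hp, mvfderiv_chart_coordField hu hp]
  simp

lemma sum_coordField (hu : u ∈ IsManifold.maximalAtlas (𝓡 n) ∞ M) (hp : p ∈ u.source)
    (ξ : TangentSpace (𝓡 n) p) :
    ∑ k, mvfderiv (𝓡 n) (fun q => u q k) p ξ • coordField u k p = ξ := by
  have h1 : ∑ k, mvfderiv (𝓡 n) (fun q => u q k) p ξ • coordField u k p =
      (mfderiv (𝓡 n) (𝓡 n) u.symm (u p) : EuclideanSpace ℝ (Fin n) →L[ℝ] TangentSpace (𝓡 n) p)
        (mvfderiv (𝓡 n) u p ξ) := by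
    have h (w : EuclideanSpace ℝ (Fin n)) (φ : EuclideanSpace ℝ (Fin n) →L[ℝ] TangentSpace (𝓡 n) p) :
        ∑ k, w k • φ (EuclideanSpace.single k 1) = φ w := by
      have hs : ∑ k, w k • EuclideanSpace.single k (1 : ℝ) = w := by
        ext k
        simp [Finset.sum_apply, Pi.single_apply]
      conv_rhs => rw [← hs, map_sum]
      simp only [map_smul]
    simp only [mvfderiv_chart_coord hu hp]
    exact h _ _
  rw [h1]
  have h2 := (smoothNear_chart_symm hu hp).self_of_nhds.mdifferentiableAt (by simp)
  have h3 := mfderiv_comp_apply_of_eq' h2 (smoothNear_chart hu hp).mdifferentiableAt rfl ξ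
  refine h3.symm.trans ?_
  have h4 : (fun z => u.symm (u z)) =ᶠ[𝓝 p] id := by
    filter_upwards [u.open_source.mem_nhds hp] with z hz using u.left_inv hz
  rw [h4.mfderiv_eq, mfderiv_id]
  rfl

lemma tangent_ext_chart (hu : u ∈ IsManifold.maximalAtlas (𝓡 n) ∞ M) (hp : p ∈ u.source)
    {ξ ζ : TangentSpace (𝓡 n) p}
    (h : ∀ k, mvfderiv (𝓡 n) (fun q => u q k) p ξ = mvfderiv (𝓡 n) (fun q => u q k) p ζ) :
    ξ = ζ := by
  rw [← sum_coordField hu hp ξ, ← sum_coordField hu hp ζ]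
  simp only [h]

lemma coordField_ne_zero (hu : u ∈ IsManifold.maximalAtlas (𝓡 n) ∞ M) (hp : p ∈ u.source)
    (k : Fin n) : coordField u k p ≠ 0 := by
  intro h
  have := mvfderiv_chart_coord_coordField hu hp k k
  rw [h, map_zero, if_pos rfl] at this
  exact one_ne_zero this.symm

lemma smoothSec_coordField (hu : u ∈ IsManifold.maximalAtlas (𝓡 n) ∞ M) (hp : p ∈ u.source)
    (k : Fin n) : SmoothSec (𝓡 n) (EuclideanSpace ℝ (Fin n)) (coordField u k) p := by
  refine smoothSec_of_mvfderiv fun L => ?_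
  have hf := (smoothNear_extChartAt (I := 𝓡 n) p (mem_chart_source _ p)).clm_comp L
  generalize (fun z => L (extChartAt (𝓡 n) p z)) = f at hf ⊢
  have h1 : ∀ᶠ y in 𝓝 p, mvfderiv (𝓡 n) f y (coordField u k y) =
      fderiv ℝ (fun z => f (u.symm z)) (u y) (EuclideanSpace.single k 1) := by
    filter_upwards [hf.eventually, u.open_source.mem_nhds hp] with y hy hyu
      using mvfderiv_coordField hu hyu k hy
  refine SmoothNear.congr ?_ h1
  have h2 : ∀ᶠ z in 𝓝 (u p), ContMDiffAt (𝓡 n) 𝓘(ℝ, ℝ) ∞ (fun z => f (u.symm z)) z := by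
    have hc : Filter.Tendsto u.symm (𝓝 (u p)) (𝓝 p) := by
      have := (u.symm.continuousAt (u.map_source hp)).tendsto
      rwa [u.left_inv hp] at this
    filter_upwards [smoothNear_chart_symm hu hp, hc.eventually hf] with z hz hz'
    exact ContMDiffAt.comp (g := f) z hz' hz
  have h3 := (smoothNear_chart hu hp).contMDiffAt.continuousAt.eventually h2
  filter_upwards [h3, smoothNear_chart hu hp] with y hy hy'
  have h4 : ContDiffAt ℝ ∞ (fderiv ℝ (fun z => f (u.symm z))) (u y) :=
    (contMDiffAt_iff_contDiffAt.1 hy).fderiv_right (m := ∞) (by simp)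
  have h5 : ContDiffAt ℝ ∞
      (fun w => fderiv ℝ (fun z => f (u.symm z)) w (EuclideanSpace.single k 1)) (u y) :=
    h4.clm_apply contDiffAt_const
  exact ContMDiffAt.comp y (contMDiffAt_iff_contDiffAt.2 h5) hy'

lemma mlieBracket_coordField (hu : u ∈ IsManifold.maximalAtlas (𝓡 n) ∞ M) (hp : p ∈ u.source)
    (i j : Fin n) : mlieBracket (𝓡 n) (coordField u i) (coordField u j) p = 0 := by
  refine tangent_ext_chart hu hp fun k => ?_
  rw [mvfderiv_mlieBracket (smoothNear_chart_coord hu hp k) (smoothSec_coordField hu hp i)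
    (smoothSec_coordField hu hp j), map_zero]
  have h (i : Fin n) : ∀ᶠ y in 𝓝 p, mvfderiv (𝓡 n) (fun q => u q k) y (coordField u i y) =
      if k = i then 1 else 0 := by
    filter_upwards [u.open_source.mem_nhds hp] with y hy
      using mvfderiv_chart_coord_coordField hu hy i k
  rw [mvfderiv_congr (h i), mvfderiv_congr (h j), mvfderiv_const_apply, mvfderiv_const_apply,
    sub_zero]

lemma SmoothNear.coordDeriv (hu : u ∈ IsManifold.maximalAtlas (𝓡 n) ∞ M) (hp : p ∈ u.source)
    {f : M → ℝ} (hf : SmoothNear (𝓡 n) f p) (k : Fin n) :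
    SmoothNear (𝓡 n) (coordDeriv u k f) p :=
  hf.dirDeriv (smoothSec_coordField hu hp k)

lemma coordDeriv_comm (hu : u ∈ IsManifold.maximalAtlas (𝓡 n) ∞ M) (hp : p ∈ u.source)
    {f : M → ℝ} (hf : SmoothNear (𝓡 n) f p) (i j : Fin n) :
    coordDeriv u i (coordDeriv u j f) p = coordDeriv u j (coordDeriv u i f) p := by
  have := mvfderiv_mlieBracket hf (smoothSec_coordField hu hp i) (smoothSec_coordField hu hp j)
  rw [mlieBracket_coordField hu hp, map_zero] at this
  exact (sub_eq_zero.1 this.symm)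

lemma smoothSec_of_chart_coord (hu : u ∈ IsManifold.maximalAtlas (𝓡 n) ∞ M) (hp : p ∈ u.source)
    {X : ∀ x : M, TangentSpace (𝓡 n) x} (hX : SmoothSec (𝓡 n) (EuclideanSpace ℝ (Fin n)) X p)
    (k : Fin n) : SmoothNear (𝓡 n) (fun y => mvfderiv (𝓡 n) (fun q => u q k) y (X y)) p :=
  (smoothNear_chart_coord hu hp k).dirDeriv hX

variable {mul : ∀ x : M, TangentSpace (𝓡 n) x →ₗ[ℝ] TangentSpace (𝓡 n) x →ₗ[ℝ] TangentSpace (𝓡 n) x}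
  {e : ∀ x : M, TangentSpace (𝓡 n) x} {g : ∀ x : M, LinearMap.BilinForm ℝ (TangentSpace (𝓡 n) x)}

lemma IsCanonical.unit_eq (hc : IsCanonical mul u) (hM : IsAlmostFrobenius (𝓡 n) mul e g)
    (hp : p ∈ u.source) : e p = ∑ k, coordField u k p := by
  have h (ξ : TangentSpace (𝓡 n) p) : mul p ξ (∑ k, coordField u k p) = ξ := by
    conv_lhs => rw [← sum_coordField hc.1 hp ξ]
    simp only [map_sum, map_smul, LinearMap.sum_apply, LinearMap.smul_apply, hc.2 p hp]
    simp only [smul_ite, smul_zero, Finset.sum_ite_eq', Finset.mem_univ, if_true]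
    rw [sum_coordField hc.1 hp ξ]
  rw [← h (e p), hM.unit_mul]

lemma IsCanonical.mul_coordField (hc : IsCanonical mul u) (hp : p ∈ u.source) (k : Fin n)
    (ξ : TangentSpace (𝓡 n) p) : mul p ξ (coordField u k p) =
      mvfderiv (𝓡 n) (fun q => u q k) p ξ • coordField u k p := by
  conv_lhs => rw [← sum_coordField hc.1 hp ξ]
  simp only [map_sum, map_smul, LinearMap.sum_apply, LinearMap.smul_apply, hc.2 p hp]
  simp

lemma IsMetricPotential.metric_coordField {η : M → ℝ} (hη : IsMetricPotential g u η)
    (hu : u ∈ IsManifold.maximalAtlas (𝓡 n) ∞ M) (hp : p ∈ u.source) (k : Fin n)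
    (ξ : TangentSpace (𝓡 n) p) : g p ξ (coordField u k p) =
      mvfderiv (𝓡 n) (fun q => u q k) p ξ * coordDeriv u k η p := by
  conv_lhs => rw [← sum_coordField hu hp ξ]
  simp only [map_sum, map_smul, LinearMap.sum_apply, LinearMap.smul_apply, hη.2 p hp]
  simp +contextual

lemma IsMetricPotential.metric_unit_unit {η : M → ℝ} (hη : IsMetricPotential g u η)
    (hc : IsCanonical mul u) (hM : IsAlmostFrobenius (𝓡 n) mul e g) (hp : p ∈ u.source) :
    g p (e p) (e p) = ∑ k, coordDeriv u k η p := by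
  simp only [hc.unit_eq hM hp, map_sum, LinearMap.sum_apply, hη.2 p hp]
  simp

lemma unit_ne_zero (hn : 0 < n) (hc : IsCanonical mul u) (hM : IsAlmostFrobenius (𝓡 n) mul e g)
    (hp : p ∈ u.source) : e p ≠ 0 := by
  intro h
  apply coordField_ne_zero hc.1 hp ⟨0, hn⟩
  rw [← hM.unit_mul p (coordField u ⟨0, hn⟩ p), h, map_zero, LinearMap.zero_apply]

end CoordinateFields

section NecessityCanonical

variable {n : ℕ} {M : Type*} [TopologicalSpace M] [ChartedSpace (EuclideanSpace ℝ (Fin n)) M]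
  [IsManifold (𝓡 n) ∞ M]
  {F : Type*} [NormedAddCommGroup F] [NormedSpace ℝ F] [FiniteDimensional ℝ F] [CompleteSpace F]
  {V : M → Type*} [TopologicalSpace (TotalSpace F V)]
  [∀ x, AddCommGroup (V x)] [∀ x, Module ℝ (V x)] [∀ x, TopologicalSpace (V x)]
  [∀ x, IsTopologicalAddGroup (V x)] [∀ x, ContinuousSMul ℝ (V x)]
  [FiberBundle F V] [VectorBundle ℝ F V] [ContMDiffVectorBundle ∞ F V (𝓡 n)]
  {mulM : ∀ x : M, TangentSpace (𝓡 n) x →ₗ[ℝ] TangentSpace (𝓡 n) x →ₗ[ℝ] TangentSpace (𝓡 n) x}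
  {eM : ∀ x : M, TangentSpace (𝓡 n) x}
  {gM : ∀ x : M, LinearMap.BilinForm ℝ (TangentSpace (𝓡 n) x)}
  {mulV : ∀ x, V x →ₗ[ℝ] V x →ₗ[ℝ] V x} {eV : ∀ x, V x} {gV : ∀ x, LinearMap.BilinForm ℝ (V x)}
  {D : CovariantDerivative (𝓡 n) F V} {α : ∀ x, V x →ₗ[ℝ] TangentSpace (𝓡 n) x}
  {u : OpenPartialHomeomorph M (EuclideanSpace ℝ (Fin n))} {η : M → ℝ} {s : ∀ x, V x} {p : M}

lemma mlieBracket_morphism_coordField (hD : IsSmoothCov D)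
    (hM : IsAlmostFrobenius (𝓡 n) mulM eM gM) (hF : IsFMultiplication (𝓡 n) mulM)
    (hα : IsSmoothMorphism (𝓡 n) F α)
    (hT : IsFMultiplication ((𝓡 n).prod 𝓘(ℝ, F)) (totalMul D mulM mulV α))
    (hc : IsCanonical mulM u) (hp : p ∈ u.source) (hs : SmoothSec (𝓡 n) F s p) (i : Fin n) :
    mlieBracket (𝓡 n) (fun y => α y (s y)) (coordField u i) p =
      - α p (D s p (coordField u i p)) := by
  have hi := smoothSec_coordField hc.1 hp i
  have key := lieDerivMul_morphism hD hM hF hα hT hs hi hi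
  have h1 : ∀ᶠ y in 𝓝 p, mulM y (coordField u i y) (coordField u i y) = coordField u i y := by
    filter_upwards [u.open_source.mem_nhds hp] with y hy
    simpa using hc.2 y hy i i
  rw [lieDerivMul, mlieBracket_congr_right h1, h1.self_of_nhds,
    hM.mul_comm p (coordField u i p) (mlieBracket _ _ _ _), hc.mul_coordField hp i,
    hc.mul_coordField hp i] at key
  set a := mlieBracket (𝓡 n) (fun y => α y (s y)) (coordField u i) p
  set b := α p (D s p (coordField u i p))
  have h2 : a + b = (2 * mvfderiv (𝓡 n) (fun q => u q i) p (a + b)) • coordField u i p := by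
    rw [map_add, ← sub_eq_zero]
    rw [← sub_eq_zero] at key
    rw [← key]
    module
  have h3 := congrArg (mvfderiv (𝓡 n) (fun q => u q i) p) h2
  rw [map_smul, mvfderiv_chart_coord_coordField hc.1 hp, if_pos rfl, smul_eq_mul] at h3
  have h4 : mvfderiv (𝓡 n) (fun q => u q i) p (a + b) = 0 := by linarith
  rw [h4, mul_zero, zero_smul] at h2
  exact eq_neg_of_add_eq_zero_left h2

/-- The coordinates of the morphism in canonical coordinates are parallel. -/
lemma mvfderiv_coord_morphism (hD : IsSmoothCov D)
    (hM : IsAlmostFrobenius (𝓡 n) mulM eM gM) (hF : IsFMultiplication (𝓡 n) mulM)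
    (hα : IsSmoothMorphism (𝓡 n) F α)
    (hT : IsFMultiplication ((𝓡 n).prod 𝓘(ℝ, F)) (totalMul D mulM mulV α))
    (hc : IsCanonical mulM u) (hp : p ∈ u.source) (hs : SmoothSec (𝓡 n) F s p) (k : Fin n)
    (ξ : TangentSpace (𝓡 n) p) :
    mvfderiv (𝓡 n) (fun y => mvfderiv (𝓡 n) (fun q => u q k) y (α y (s y))) p ξ =
      mvfderiv (𝓡 n) (fun q => u q k) p (α p (D s p ξ)) := by
  have hαs := isSmoothMorphism_iff.1 hα s p hs
  rw [← sum_coordField hc.1 hp ξ]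
  simp only [map_sum, map_smul]
  refine Finset.sum_congr rfl fun i _ => ?_
  congr 1
  have key := mvfderiv_mlieBracket (smoothNear_chart_coord hc.1 hp k) hαs
    (smoothSec_coordField hc.1 hp i)
  have h : ∀ᶠ y in 𝓝 p, mvfderiv (𝓡 n) (fun q => u q k) y (coordField u i y) =
      if k = i then 1 else 0 := by
    filter_upwards [u.open_source.mem_nhds hp] with y hy
      using mvfderiv_chart_coord_coordField hc.1 hy i k
  rw [mlieBracket_morphism_coordField hD hM hF hα hT hc hp hs, mvfderiv_congr h,
    mvfderiv_const_apply, zero_sub, map_neg] at key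
  exact (neg_injective key).symm

lemma coordDeriv_ne_zero_of_rotationCoeff {i j : Fin n} (h : rotationCoeff u η i j p ≠ 0) :
    coordDeriv u j (coordDeriv u i η) p ≠ 0 := by
  intro h0
  simp [rotationCoeff, h0] at h

/-- All coordinates of the morphism in canonical coordinates agree. -/
lemma coord_morphism_eq (hD : IsSmoothCov D)
    (hM : IsAlmostFrobenius (𝓡 n) mulM eM gM) (hF : IsFMultiplication (𝓡 n) mulM)
    (hV : IsFrobeniusAlgebraBundle (𝓡 n) F mulV eV gV)
    (hα : IsSmoothMorphism (𝓡 n) F α) (hP : IsParallelMetric D gV)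
    (hT : IsFrobenius ((𝓡 n).prod 𝓘(ℝ, F)) (totalMul D mulM mulV α) (totalUnit (𝓡 n) eV)
      (totalMetric D gM gV α)) (hpos : ∀ v, IsPosDef (totalMetric D gM gV α v))
    (hc : IsCanonical mulM u) (hη : IsMetricPotential gM u η) (hp : p ∈ u.source)
    (hγ : ∀ i j : Fin n, i ≠ j → rotationCoeff u η i j p ≠ 0) (w : V p) (i j : Fin n) :
    mvfderiv (𝓡 n) (fun q => u q i) p (α p w) = mvfderiv (𝓡 n) (fun q => u q j) p (α p w) := by
  rcases eq_or_ne i j with rfl | hij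
  · rfl
  obtain ⟨nabla, hL, -, hflat'⟩ := hT.admissible_flat
  have hflat := isFlat_of_isFMultiplication hD hM hT.fMultiplication
  let s : ∀ x, V x := extend F w
  have hs : SmoothSec (𝓡 n) F s p := smoothSec_extend (𝓡 n) F w
  have hsw : s p = w := extend_apply_self ..
  have hαs := isSmoothMorphism_iff.1 hα s p hs
  have hηs := smoothNear_of_contMDiffOn u.open_source hη.1 hp
  have key := metric_morphism_closed hD hM hV hα hP hflat hT.almostFrobenius hL hflat' hpos
    (smoothSec_coordField hc.1 hp i) (smoothSec_coordField hc.1 hp j) hs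
  have h (k : Fin n) : ∀ᶠ y in 𝓝 p, gM y (α y (s y)) (coordField u k y) =
      mvfderiv (𝓡 n) (fun q => u q k) y (α y (s y)) * coordDeriv u k η y := by
    filter_upwards [u.open_source.mem_nhds hp] with y hy
      using hη.metric_coordField hc.1 hy k _
  have h' (i k : Fin n) : mvfderiv (𝓡 n) (fun y => gM y (α y (s y)) (coordField u k y)) p
      (coordField u i p) = mvfderiv (𝓡 n) (fun q => u q k) p (α p w) *
        coordDeriv u i (coordDeriv u k η) p + coordDeriv u k η p *
        mvfderiv (𝓡 n) (fun q => u q k) p (α p (D s p (coordField u i p))) := by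
    rw [mvfderiv_congr (h k), mvfderiv_fun_mul' (smoothSec_of_chart_coord hc.1 hp hαs k)
      (hηs.coordDeriv hc.1 hp k),
      mvfderiv_coord_morphism hD hM hF hα hT.fMultiplication hc hp hs, hsw]
    rfl
  rw [h' i j, h' j i, mlieBracket_coordField hc.1 hp, hη.metric_coordField hc.1 hp,
    hη.metric_coordField hc.1 hp, map_zero, sub_zero, coordDeriv_comm hc.1 hp hηs i j] at key
  have h2 : coordDeriv u j (coordDeriv u i η) p * (mvfderiv (𝓡 n) (fun q => u q i) p (α p w) -
      mvfderiv (𝓡 n) (fun q => u q j) p (α p w)) = 0 := by linarith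
  exact sub_eq_zero.1 ((mul_eq_zero.1 h2).resolve_left
    (coordDeriv_ne_zero_of_rotationCoeff (hγ i j hij)))

/-- A Frobenius structure with positive definite metric on the total space comes from a parallel
functional. -/
theorem conditions_of_isFrobenius (hn : 0 < n)
    (hM : IsSemisimpleFrobeniusWithRotation mulM eM gM)
    (hV : IsFrobeniusAlgebraBundle (𝓡 n) F mulV eV gV) (hD : IsSmoothCov D)
    (hα : IsSmoothMorphism (𝓡 n) F α) (hα_unit : ∀ x, α x (eV x) = eM x)
    (hα_mul : ∀ x (v w : V x), α x (mulV x v w) = mulM x (α x v) (α x w))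
    (hT : IsFrobenius ((𝓡 n).prod 𝓘(ℝ, F)) (totalMul D mulM mulV α) (totalUnit (𝓡 n) eV)
      (totalMetric D gM gV α)) (hpos : ∀ v, IsPosDef (totalMetric D gM gV α v)) :
    (IsFlat D ∧ IsParallelFrobeniusAlgebra D mulV eV gV) ∧
    ∃ l : ∀ x, V x →ₗ[ℝ] ℝ,
      (IsSmoothFunctional (𝓡 n) F l ∧ IsParallelFunctional D l ∧
        (∀ x, l x (eV x) = 1) ∧ (∀ x (v w : V x), l x (mulV x v w) = l x v * l x w) ∧
        ∀ x (v : V x), α x v = l x v • eM x) ∧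
      ∀ (u : OpenPartialHomeomorph M (EuclideanSpace ℝ (Fin n))) (η : M → ℝ),
        IsCanonical mulM u → IsMetricPotential gM u η → ∀ p ∈ u.source,
          (∀ k : Fin n, 0 < coordDeriv u k η p) ∧
          IsPosDef (gV p - (∑ k : Fin n, coordDeriv u k η p) •
            LinearMap.BilinForm.linMulLin (l p) (l p)) := by
  have hMA := hM.1.almostFrobenius
  have hMF := hM.1.fMultiplication
  have hTF := hT.fMultiplication
  have hTA := hT.almostFrobenius
  have hflat := isFlat_of_isFMultiplication hD hMA hTF
  have hmul := isParallelMul_of_isFMultiplication hD hMA hV hTF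
  have he := cov_unit_eq_zero hV hmul
  have hP : IsParallelMetric D gV := by
    obtain ⟨nabla, hL, hE, -⟩ := hT.admissible_flat
    exact isParallelMetric_of_unit hV hmul fun t x ht ξ =>
      mvfderiv_metric_unit hD hMA hV hα hTA.metric_symm hL he hE ht ξ
  choose u η hu hc hη hγ using hM.2
  let i₀ : Fin n := ⟨0, hn⟩
  have hcoord (x p : M) (hp : p ∈ (u x).source) (w : V p) :
      α p w = mvfderiv (𝓡 n) (fun q => u x q i₀) p (α p w) • eM p := by
    conv_lhs => rw [← sum_coordField (hc x).1 hp (α p w)]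
    rw [(hc x).unit_eq hMA hp, Finset.smul_sum]
    refine Finset.sum_congr rfl fun k _ => ?_
    rw [coord_morphism_eq hD hMA hMF hV hα hP hT hpos (hc x) (hη x) hp (hγ x p hp) w k i₀]
  have hne (x : M) : eM x ≠ 0 := unit_ne_zero hn (hc x) hMA (hu x)
  let l : ∀ x, V x →ₗ[ℝ] ℝ := fun x =>
    (mvfderiv (𝓡 n) (fun q => u x q i₀) x : TangentSpace (𝓡 n) x →L[ℝ] ℝ).toLinearMap ∘ₗ α x
  have hl (x : M) (w : V x) : α x w = l x w • eM x := hcoord x x (hu x) w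
  have hcancel (x : M) {a b : ℝ} (h : a • eM x = b • eM x) : a = b :=
    smul_left_injective ℝ (hne x) h
  have hleq (x p : M) (hp : p ∈ (u x).source) (w : V p) :
      l p w = mvfderiv (𝓡 n) (fun q => u x q i₀) p (α p w) :=
    hcancel p ((hl p w).symm.trans (hcoord x p hp w))
  have hlev (x : M) (s : ∀ x, V x) : ∀ᶠ y in 𝓝 x, l y (s y) =
      mvfderiv (𝓡 n) (fun q => u x q i₀) y (α y (s y)) := by
    filter_upwards [(u x).open_source.mem_nhds (hu x)] with y hy using hleq x y hy _
  refine ⟨⟨hflat, hmul, he, hP⟩, l, ⟨?_, ?_, fun x => ?_, fun x v w => ?_, hl⟩, ?_⟩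
  · refine isSmoothFunctional_iff.2 fun s x hs => ?_
    exact (smoothSec_of_chart_coord (hc x).1 (hu x) (isSmoothMorphism_iff.1 hα s x hs) i₀).congr
      (hlev x s)
  · refine isParallelFunctional_iff.2 fun s x hs ξ => ?_
    rw [mvfderiv_congr (hlev x s), mvfderiv_coord_morphism hD hMA hMF hα hTF (hc x) (hu x) hs]
    rfl
  · apply hcancel x
    rw [← hl, hα_unit, one_smul]
  · apply hcancel x
    rw [← hl, hα_mul, hl x v, hl x w, map_smul, map_smul, LinearMap.smul_apply, hMA.unit_mul,
      smul_smul, mul_comm]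
  · intro u η hc hη p hp
    let v : TotalSpace F V := ⟨p, 0⟩
    constructor
    · intro k
      have h1 : horLift D v (coordField u k p) ≠ 0 := fun h => by
        have := congrArg (projDeriv (𝓡 n) v) h
        rw [projDeriv_horLift, map_zero] at this
        exact coordField_ne_zero hc.1 hp k this
      have h2 := (hpos v).2 _ h1
      rw [totalMetric_horLift_horLift] at h2
      have h3 := hη.2 p hp k k
      rw [if_pos rfl] at h3
      rw [← h3]
      exact h2
    · refine ⟨?_, fun w hw => ?_⟩
      · constructor
        intro a b
        have := hV.symm (x := p) a b
        simp only [LinearMap.sub_apply, LinearMap.smul_apply, LinearMap.BilinForm.linMulLin_apply,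
          smul_eq_mul, this]
        ring
      · let A := vertLift (𝓡 n) v w - horLift D v (α p w)
        have hA : A ≠ 0 := fun h => by
          have := congrArg (vertPart D v) h
          rw [map_sub, vertPart_vertLift, vertPart_horLift, map_zero, sub_zero] at this
          exact hw this
        have h2 := (hpos v).2 A hA
        simp only [A, map_sub, LinearMap.sub_apply, totalMetric_horLift_horLift,
          totalMetric_vertLift_vertLift, totalMetric_horLift_vertLift,
          totalMetric_vertLift_horLift] at h2
        have h3 : gM p (α p w) (α p w) = l p w * l p w * ∑ k, coordDeriv u k η p := by
          rw [← hη.metric_unit_unit hc hMA hp, hl p w]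
          simp only [map_smul, LinearMap.smul_apply, smul_eq_mul]
          ring
        simp only [v, h3] at h2
        simp only [LinearMap.sub_apply, LinearMap.smul_apply, LinearMap.BilinForm.linMulLin_apply,
          smul_eq_mul]
        linarith

end NecessityCanonical

section LiftInduction

variable {n : ℕ} {M : Type*} [TopologicalSpace M] [ChartedSpace (EuclideanSpace ℝ (Fin n)) M]
  [IsManifold (𝓡 n) ∞ M]
  {F : Type*} [NormedAddCommGroup F] [NormedSpace ℝ F] [FiniteDimensional ℝ F] [CompleteSpace F]
  {V : M → Type*} [TopologicalSpace (TotalSpace F V)]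
  [∀ x, AddCommGroup (V x)] [∀ x, Module ℝ (V x)] [∀ x, TopologicalSpace (V x)]
  [∀ x, IsTopologicalAddGroup (V x)] [∀ x, ContinuousSMul ℝ (V x)]
  [FiberBundle F V] [VectorBundle ℝ F V] [ContMDiffVectorBundle ∞ F V (𝓡 n)]
  {mulM : ∀ x : M, TangentSpace (𝓡 n) x →ₗ[ℝ] TangentSpace (𝓡 n) x →ₗ[ℝ] TangentSpace (𝓡 n) x}
  {eM : ∀ x : M, TangentSpace (𝓡 n) x}
  {gM : ∀ x : M, LinearMap.BilinForm ℝ (TangentSpace (𝓡 n) x)}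
  {mulV : ∀ x, V x →ₗ[ℝ] V x →ₗ[ℝ] V x} {eV : ∀ x, V x} {gV : ∀ x, LinearMap.BilinForm ℝ (V x)}
  {D : CovariantDerivative (𝓡 n) F V} {α : ∀ x, V x →ₗ[ℝ] TangentSpace (𝓡 n) x}
  {u : OpenPartialHomeomorph M (EuclideanSpace ℝ (Fin n))} {η : M → ℝ} {s : ∀ x, V x} {p : M}
  {v : TotalSpace F V}

lemma sum_induction_fields {v : TotalSpace F V}
    {P : (∀ w : TotalSpace F V, TangentSpace ((𝓡 n).prod 𝓘(ℝ, F)) w) → Prop}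
    (zero : P fun _ => 0)
    (add : ∀ A B, SmoothSec ((𝓡 n).prod 𝓘(ℝ, F)) (EuclideanSpace ℝ (Fin n) × F) A v →
      SmoothSec ((𝓡 n).prod 𝓘(ℝ, F)) (EuclideanSpace ℝ (Fin n) × F) B v → P A → P B →
      P fun w => A w + B w) {ι : Type*} (a : Finset ι)
    (A : ι → ∀ w : TotalSpace F V, TangentSpace ((𝓡 n).prod 𝓘(ℝ, F)) w)
    (hA : ∀ i, SmoothSec ((𝓡 n).prod 𝓘(ℝ, F)) (EuclideanSpace ℝ (Fin n) × F) (A i) v)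
    (hP : ∀ i, P (A i)) : P fun w => ∑ i ∈ a, A i w := by
  classical
  induction a using Finset.induction_on with
  | empty => simpa using zero
  | insert i a hi ih =>
    simp only [Finset.sum_insert hi]
    exact add _ _ (hA i) (.sum fun i _ => hA i) (hP i) ih

/-- The components of a field on the total space along the coordinate fields. -/
def horCoeff (v : TotalSpace F V) (A : ∀ w : TotalSpace F V, TangentSpace ((𝓡 n).prod 𝓘(ℝ, F)) w)
    (i : Fin n) (w : TotalSpace F V) : ℝ :=
  mvfderiv ((𝓡 n).prod 𝓘(ℝ, F))
    (fun w : TotalSpace F V => chartAt (EuclideanSpace ℝ (Fin n)) v.proj w.proj i) w (A w)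

/-- The coordinate fields of the preferred chart at `v.proj`. -/
def chartField (v : TotalSpace F V) (i : Fin n) (p : M) : TangentSpace (𝓡 n) p :=
  coordField (chartAt (EuclideanSpace ℝ (Fin n)) v.proj) i p

variable (V) in
/-- The sections that are constant in the preferred trivialization at `v.proj`. -/
def fibreSec (v : TotalSpace F V) (k : Fin (Module.finrank ℝ F)) : ∀ p : M, V p :=
  constSec (trivializationAt F V v.proj) (Module.finBasis ℝ F k)

variable (D) in
/-- The components of a field on the total space along the vertical lifts of the fibre sections. -/
def vertCoeff (v : TotalSpace F V) (A : ∀ w : TotalSpace F V, TangentSpace ((𝓡 n).prod 𝓘(ℝ, F)) w)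
    (k : Fin (Module.finrank ℝ F)) (w : TotalSpace F V) : ℝ :=
  coordL F k (mvfderiv ((𝓡 n).prod 𝓘(ℝ, F)) (fib (trivializationAt F V v.proj)) w (A w) -
    ∑ i, horCoeff v A i w • mvfderiv ((𝓡 n).prod 𝓘(ℝ, F)) (fib (trivializationAt F V v.proj)) w
      (horField D (chartField v i) w))

lemma chart_mem (v : TotalSpace F V) : chartAt (EuclideanSpace ℝ (Fin n)) v.proj ∈
    IsManifold.maximalAtlas (𝓡 n) ∞ M := IsManifold.chart_mem_maximalAtlas _

lemma mem_chart (v : TotalSpace F V) :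
    v.proj ∈ (chartAt (EuclideanSpace ℝ (Fin n)) v.proj).source := mem_chart_source _ _

lemma smoothNear_chart_proj (v : TotalSpace F V) (i : Fin n) :
    SmoothNear ((𝓡 n).prod 𝓘(ℝ, F))
      (fun w : TotalSpace F V => chartAt (EuclideanSpace ℝ (Fin n)) v.proj w.proj i) v :=
  (smoothNear_chart_coord (chart_mem v) (mem_chart v) i).comp_proj

lemma smoothNear_fib_trivializationAt (v : TotalSpace F V) :
    SmoothNear ((𝓡 n).prod 𝓘(ℝ, F)) (fib (trivializationAt F V v.proj)) v :=
  smoothNear_fib (mem_baseSet_trivializationAt' _)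

lemma smoothSec_chartField (v : TotalSpace F V) (i : Fin n) :
    SmoothSec (𝓡 n) (EuclideanSpace ℝ (Fin n)) (chartField v i) v.proj :=
  smoothSec_coordField (chart_mem v) (mem_chart v) i

lemma smoothSec_fibreSec (v : TotalSpace F V) (k : Fin (Module.finrank ℝ F)) :
    SmoothSec (𝓡 n) F (fibreSec V v k) v.proj :=
  smoothSec_constSec (mem_baseSet_trivializationAt' _) _

lemma smoothNear_horCoeff {A : ∀ w : TotalSpace F V, TangentSpace ((𝓡 n).prod 𝓘(ℝ, F)) w}
    (hA : SmoothSec ((𝓡 n).prod 𝓘(ℝ, F)) (EuclideanSpace ℝ (Fin n) × F) A v) (i : Fin n) :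
    SmoothNear ((𝓡 n).prod 𝓘(ℝ, F)) (horCoeff v A i) v :=
  (smoothNear_chart_proj v i).dirDeriv hA

lemma smoothNear_vertCoeff (hD : IsSmoothCov D)
    {A : ∀ w : TotalSpace F V, TangentSpace ((𝓡 n).prod 𝓘(ℝ, F)) w}
    (hA : SmoothSec ((𝓡 n).prod 𝓘(ℝ, F)) (EuclideanSpace ℝ (Fin n) × F) A v)
    (k : Fin (Module.finrank ℝ F)) :
    SmoothNear ((𝓡 n).prod 𝓘(ℝ, F)) (vertCoeff D v A k) v := by
  have h := smoothNear_fib_trivializationAt (n := n) v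
  refine SmoothNear.clm_comp _ ((h.dirDeriv hA).sub (.sum fun i _ => ?_))
  exact (smoothNear_horCoeff hA i).smul_fun
    (h.dirDeriv (smoothSec_horField hD (smoothSec_chartField v i)))

lemma eventually_mem_chart (v : TotalSpace F V) : ∀ᶠ w : TotalSpace F V in 𝓝 v,
    w.proj ∈ (chartAt (EuclideanSpace ℝ (Fin n)) v.proj).source ∧
      w.proj ∈ (trivializationAt F V v.proj).baseSet :=
  eventually_proj (((chartAt (EuclideanSpace ℝ (Fin n)) v.proj).open_source.eventually_mem
    (mem_chart (n := n) v)).and ((trivializationAt F V v.proj).open_baseSet.eventually_mem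
    (mem_baseSet_trivializationAt' _)))

lemma horCoeff_eq {w : TotalSpace F V}
    (hw : w.proj ∈ (chartAt (EuclideanSpace ℝ (Fin n)) v.proj).source)
    (A : ∀ w : TotalSpace F V, TangentSpace ((𝓡 n).prod 𝓘(ℝ, F)) w) (i : Fin n) :
    horCoeff v A i w = mvfderiv (𝓡 n)
      (fun q => chartAt (EuclideanSpace ℝ (Fin n)) v.proj q i) w.proj (projDeriv (𝓡 n) w (A w)) :=
  mvfderiv_comp_proj (smoothNear_chart_coord (chart_mem v) hw i) (A w)

lemma projDeriv_eq_sum {w : TotalSpace F V}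
    (hw : w.proj ∈ (chartAt (EuclideanSpace ℝ (Fin n)) v.proj).source)
    (A : ∀ w : TotalSpace F V, TangentSpace ((𝓡 n).prod 𝓘(ℝ, F)) w) :
    projDeriv (𝓡 n) w (A w) = ∑ i, horCoeff v A i w • chartField v i w.proj := by
  simp only [horCoeff_eq hw]
  exact (sum_coordField (chart_mem v) hw _).symm

lemma vertCoeff_eq {w : TotalSpace F V}
    (hw : w.proj ∈ (chartAt (EuclideanSpace ℝ (Fin n)) v.proj).source)
    (hw' : w.proj ∈ (trivializationAt F V v.proj).baseSet)
    (A : ∀ w : TotalSpace F V, TangentSpace ((𝓡 n).prod 𝓘(ℝ, F)) w)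
    (k : Fin (Module.finrank ℝ F)) : vertCoeff D v A k w =
      coordL F k (fib (trivializationAt F V v.proj) ⟨w.proj, vertPart D w (A w)⟩) := by
  rw [vertCoeff]
  congr 1
  have h1 : projDeriv (𝓡 n) w (A w - ∑ i, horCoeff v A i w • horField D (chartField v i) w) = 0 := by
    simp only [map_sub, map_sum, map_smul, projDeriv_horField]
    rw [projDeriv_eq_sum hw, sub_self]
  have h2 : vertPart D w (A w - ∑ i, horCoeff v A i w • horField D (chartField v i) w) =
      vertPart D w (A w) := by
    simp only [map_sub, map_sum, map_smul, vertPart_horField, smul_zero, Finset.sum_const_zero,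
      sub_zero]
  have h3 := fib_vertPart (D := D) hw'
    (A w - ∑ i, horCoeff v A i w • horField D (chartField v i) w)
  rw [h1, h2] at h3
  rw [h3]
  simp only [map_sub, map_sum, map_smul]
  simp [connForm, fib_mk hw']

lemma vertPart_eq_sum {w : TotalSpace F V}
    (hw : w.proj ∈ (chartAt (EuclideanSpace ℝ (Fin n)) v.proj).source)
    (hw' : w.proj ∈ (trivializationAt F V v.proj).baseSet)
    (A : ∀ w : TotalSpace F V, TangentSpace ((𝓡 n).prod 𝓘(ℝ, F)) w) :
    vertPart D w (A w) = ∑ k, vertCoeff D v A k w • fibreSec V v k w.proj := by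
  simp only [vertCoeff_eq hw hw']
  exact eq_sum_constSec hw' _

lemma eventually_eq_sum_lifts (D : CovariantDerivative (𝓡 n) F V) (v : TotalSpace F V)
    (A : ∀ w : TotalSpace F V, TangentSpace ((𝓡 n).prod 𝓘(ℝ, F)) w) :
    ∀ᶠ w in 𝓝 v, A w = (∑ i, horCoeff v A i w • horField D (chartField v i) w) +
      ∑ k, vertCoeff D v A k w • vertField (𝓡 n) (fibreSec V v k) w := by
  filter_upwards [eventually_mem_chart (n := n) v] with w hw
  conv_lhs => rw [← horLift_add_vertLift D (A w), projDeriv_eq_sum hw.1, vertPart_eq_sum hw.1 hw.2]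
  simp only [map_sum, map_smul]
  rfl

/-- Smooth fields on the total space are locally combinations of horizontal and vertical lifts. -/
lemma lift_induction (hD : IsSmoothCov D)
    {P : (∀ w : TotalSpace F V, TangentSpace ((𝓡 n).prod 𝓘(ℝ, F)) w) → Prop}
    (hor : ∀ X, SmoothSec (𝓡 n) (EuclideanSpace ℝ (Fin n)) X v.proj → P (horField D X))
    (vert : ∀ s, SmoothSec (𝓡 n) F s v.proj → P (vertField (𝓡 n) s))
    (add : ∀ A B, SmoothSec ((𝓡 n).prod 𝓘(ℝ, F)) (EuclideanSpace ℝ (Fin n) × F) A v →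
      SmoothSec ((𝓡 n).prod 𝓘(ℝ, F)) (EuclideanSpace ℝ (Fin n) × F) B v → P A → P B →
      P fun w => A w + B w)
    (smul : ∀ (f : TotalSpace F V → ℝ) A, SmoothNear ((𝓡 n).prod 𝓘(ℝ, F)) f v →
      SmoothSec ((𝓡 n).prod 𝓘(ℝ, F)) (EuclideanSpace ℝ (Fin n) × F) A v → P A →
      P fun w => f w • A w)
    (congr : ∀ A B, SmoothSec ((𝓡 n).prod 𝓘(ℝ, F)) (EuclideanSpace ℝ (Fin n) × F) A v →
      (∀ᶠ w in 𝓝 v, B w = A w) → P A → P B)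
    (A : ∀ w : TotalSpace F V, TangentSpace ((𝓡 n).prod 𝓘(ℝ, F)) w)
    (hA : SmoothSec ((𝓡 n).prod 𝓘(ℝ, F)) (EuclideanSpace ℝ (Fin n) × F) A v) : P A := by
  have zero : P fun _ => 0 := by
    have h := smul (fun _ => 0) _ (smoothNear_const _) (smoothSec_horField hD smoothSec_zero)
      (hor _ smoothSec_zero)
    simpa using h
  have h1 (i) := smoothSec_horField hD (smoothSec_chartField v i)
  have h2 (k) := smoothSec_vertField (smoothSec_fibreSec (n := n) v k)
  have h3 (i) := (smoothNear_horCoeff hA i).smul (h1 i)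
  have h4 (k) := (smoothNear_vertCoeff hD hA k).smul (h2 k)
  refine congr _ A (.add (.sum fun i _ => h3 i) (.sum fun k _ => h4 k))
    (eventually_eq_sum_lifts D v A) ?_
  refine add _ _ (.sum fun i _ => h3 i) (.sum fun k _ => h4 k) ?_ ?_
  · exact sum_induction_fields zero add _ _ h3 fun i =>
      smul _ _ (smoothNear_horCoeff hA i) (h1 i) (hor _ (smoothSec_chartField v i))
  · exact sum_induction_fields zero add _ _ h4 fun k =>
      smul _ _ (smoothNear_vertCoeff hD hA k) (h2 k) (vert _ (smoothSec_fibreSec v k))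

end LiftInduction

section AlmostFrobenius

variable {n : ℕ} {M : Type*} [TopologicalSpace M] [ChartedSpace (EuclideanSpace ℝ (Fin n)) M]
  [IsManifold (𝓡 n) ∞ M]
  {F : Type*} [NormedAddCommGroup F] [NormedSpace ℝ F] [FiniteDimensional ℝ F] [CompleteSpace F]
  {V : M → Type*} [TopologicalSpace (TotalSpace F V)]
  [∀ x, AddCommGroup (V x)] [∀ x, Module ℝ (V x)] [∀ x, TopologicalSpace (V x)]
  [∀ x, IsTopologicalAddGroup (V x)] [∀ x, ContinuousSMul ℝ (V x)]
  [FiberBundle F V] [VectorBundle ℝ F V] [ContMDiffVectorBundle ∞ F V (𝓡 n)]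
  {mulM : ∀ x : M, TangentSpace (𝓡 n) x →ₗ[ℝ] TangentSpace (𝓡 n) x →ₗ[ℝ] TangentSpace (𝓡 n) x}
  {eM : ∀ x : M, TangentSpace (𝓡 n) x}
  {gM : ∀ x : M, LinearMap.BilinForm ℝ (TangentSpace (𝓡 n) x)}
  {mulV : ∀ x, V x →ₗ[ℝ] V x →ₗ[ℝ] V x} {eV : ∀ x, V x} {gV : ∀ x, LinearMap.BilinForm ℝ (V x)}
  {D : CovariantDerivative (𝓡 n) F V} {α : ∀ x, V x →ₗ[ℝ] TangentSpace (𝓡 n) x}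
  {u : OpenPartialHomeomorph M (EuclideanSpace ℝ (Fin n))} {η : M → ℝ} {s : ∀ x, V x} {p : M}
  {v : TotalSpace F V}

lemma smoothSec_totalMul (hD : IsSmoothCov D) (hM : IsAlmostFrobenius (𝓡 n) mulM eM gM)
    (hV : IsFrobeniusAlgebraBundle (𝓡 n) F mulV eV gV) (hα : IsSmoothMorphism (𝓡 n) F α)
    {A B : ∀ w : TotalSpace F V, TangentSpace ((𝓡 n).prod 𝓘(ℝ, F)) w}
    (hA : SmoothSec ((𝓡 n).prod 𝓘(ℝ, F)) (EuclideanSpace ℝ (Fin n) × F) A v)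
    (hB : SmoothSec ((𝓡 n).prod 𝓘(ℝ, F)) (EuclideanSpace ℝ (Fin n) × F) B v) :
    SmoothSec ((𝓡 n).prod 𝓘(ℝ, F)) (EuclideanSpace ℝ (Fin n) × F)
      (fun w => totalMul D mulM mulV α w (A w) (B w)) v := by
  have hα' (s) (hs : SmoothSec (𝓡 n) F s v.proj) := isSmoothMorphism_iff.1 hα s v.proj hs
  have step (A : ∀ w : TotalSpace F V, TangentSpace ((𝓡 n).prod 𝓘(ℝ, F)) w)
      (h1 : ∀ Y, SmoothSec (𝓡 n) (EuclideanSpace ℝ (Fin n)) Y v.proj →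
        SmoothSec ((𝓡 n).prod 𝓘(ℝ, F)) (EuclideanSpace ℝ (Fin n) × F)
        (fun w => totalMul D mulM mulV α w (A w) (horField D Y w)) v)
      (h2 : ∀ t, SmoothSec (𝓡 n) F t v.proj →
        SmoothSec ((𝓡 n).prod 𝓘(ℝ, F)) (EuclideanSpace ℝ (Fin n) × F)
        (fun w => totalMul D mulM mulV α w (A w) (vertField (𝓡 n) t w)) v) :
      SmoothSec ((𝓡 n).prod 𝓘(ℝ, F)) (EuclideanSpace ℝ (Fin n) × F)
        (fun w => totalMul D mulM mulV α w (A w) (B w)) v := by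
    refine lift_induction (P := fun B => SmoothSec ((𝓡 n).prod 𝓘(ℝ, F))
      (EuclideanSpace ℝ (Fin n) × F) (fun w => totalMul D mulM mulV α w (A w) (B w)) v) hD h1 h2
      (fun B B' _ _ h h' => ?_) (fun f B hf _ h => ?_) (fun B B' _ hBB h => ?_) B hB
    · simp only [map_add]; exact h.add h'
    · simp only [map_smul]; exact hf.smul h
    · exact h.congr (hBB.mono fun w hw => by rw [hw])
  refine lift_induction (P := fun A => SmoothSec ((𝓡 n).prod 𝓘(ℝ, F))
      (EuclideanSpace ℝ (Fin n) × F) (fun w => totalMul D mulM mulV α w (A w) (B w)) v) hD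
      (fun X hX => step _ (fun Y hY => ?_) fun t ht => ?_)
      (fun s hs => step _ (fun Y hY => ?_) fun t ht => ?_)
      (fun B B' _ _ h h' => ?_) (fun f B hf _ h => ?_) (fun B B' _ hBB h => ?_) A hA
  · simp only [totalMul_horField_horField]
    exact smoothSec_horField hD (hM.smoothSec_mul hX hY)
  · simp only [totalMul_horField_vertField]
    exact smoothSec_horField hD (hM.smoothSec_mul (hα' t ht) hX)
  · simp only [totalMul_vertField_horField]
    exact smoothSec_horField hD (hM.smoothSec_mul (hα' s hs) hY)
  · simp only [totalMul_vertField_vertField]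
    exact smoothSec_vertField (hV.smoothSec_mul hs ht)
  · simp only [map_add, LinearMap.add_apply]; exact h.add h'
  · simp only [map_smul, LinearMap.smul_apply]; exact hf.smul h
  · exact h.congr (hBB.mono fun w hw => by rw [hw])

lemma smoothNear_totalMetric (hD : IsSmoothCov D) (hM : IsAlmostFrobenius (𝓡 n) mulM eM gM)
    (hV : IsFrobeniusAlgebraBundle (𝓡 n) F mulV eV gV) (hα : IsSmoothMorphism (𝓡 n) F α)
    {A B : ∀ w : TotalSpace F V, TangentSpace ((𝓡 n).prod 𝓘(ℝ, F)) w}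
    (hA : SmoothSec ((𝓡 n).prod 𝓘(ℝ, F)) (EuclideanSpace ℝ (Fin n) × F) A v)
    (hB : SmoothSec ((𝓡 n).prod 𝓘(ℝ, F)) (EuclideanSpace ℝ (Fin n) × F) B v) :
    SmoothNear ((𝓡 n).prod 𝓘(ℝ, F)) (fun w => totalMetric D gM gV α w (A w) (B w)) v := by
  have hα' (s) (hs : SmoothSec (𝓡 n) F s v.proj) := isSmoothMorphism_iff.1 hα s v.proj hs
  have step (A : ∀ w : TotalSpace F V, TangentSpace ((𝓡 n).prod 𝓘(ℝ, F)) w)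
      (h1 : ∀ Y, SmoothSec (𝓡 n) (EuclideanSpace ℝ (Fin n)) Y v.proj →
        SmoothNear ((𝓡 n).prod 𝓘(ℝ, F))
        (fun w => totalMetric D gM gV α w (A w) (horField D Y w)) v)
      (h2 : ∀ t, SmoothSec (𝓡 n) F t v.proj →
        SmoothNear ((𝓡 n).prod 𝓘(ℝ, F))
        (fun w => totalMetric D gM gV α w (A w) (vertField (𝓡 n) t w)) v) :
      SmoothNear ((𝓡 n).prod 𝓘(ℝ, F)) (fun w => totalMetric D gM gV α w (A w) (B w)) v := by
    refine lift_induction (P := fun B => SmoothNear ((𝓡 n).prod 𝓘(ℝ, F))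
      (fun w => totalMetric D gM gV α w (A w) (B w)) v) hD h1 h2
      (fun B B' _ _ h h' => ?_) (fun f B hf _ h => ?_) (fun B B' _ hBB h => ?_) B hB
    · simp only [map_add]; exact h.add h'
    · simp only [map_smul, smul_eq_mul]; exact hf.mul h
    · exact h.congr (hBB.mono fun w hw => by rw [hw])
  refine lift_induction (P := fun A => SmoothNear ((𝓡 n).prod 𝓘(ℝ, F))
      (fun w => totalMetric D gM gV α w (A w) (B w)) v) hD
      (fun X hX => step _ (fun Y hY => ?_) fun t ht => ?_)
      (fun s hs => step _ (fun Y hY => ?_) fun t ht => ?_)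
      (fun B B' _ _ h h' => ?_) (fun f B hf _ h => ?_) (fun B B' _ hBB h => ?_) A hA
  · simp only [totalMetric_horField_horField]
    exact (hM.smoothNear_metric hX hY).comp_proj
  · simp only [totalMetric_horField_vertField]
    exact (hM.smoothNear_metric (hα' t ht) hX).comp_proj
  · simp only [totalMetric_vertField_horField]
    exact (hM.smoothNear_metric (hα' s hs) hY).comp_proj
  · simp only [totalMetric_vertField_vertField]
    exact (hV.smoothNear_metric hs ht).comp_proj
  · simp only [map_add, LinearMap.add_apply]; exact h.add h'
  · simp only [map_smul, LinearMap.smul_apply, smul_eq_mul]; exact hf.mul h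
  · exact h.congr (hBB.mono fun w hw => by rw [hw])

/-- The structure on the total space is almost Frobenius as soon as its metric is positive
definite. -/
theorem isAlmostFrobenius_total (hD : IsSmoothCov D) (hM : IsAlmostFrobenius (𝓡 n) mulM eM gM)
    (hV : IsFrobeniusAlgebraBundle (𝓡 n) F mulV eV gV) (hα : IsSmoothMorphism (𝓡 n) F α)
    (hα_unit : ∀ x, α x (eV x) = eM x)
    (hα_mul : ∀ x (v w : V x), α x (mulV x v w) = mulM x (α x v) (α x w))
    (hpos : ∀ v, IsPosDef (totalMetric D gM gV α v)) :
    IsAlmostFrobenius ((𝓡 n).prod 𝓘(ℝ, F)) (totalMul D mulM mulV α) (totalUnit (𝓡 n) eV)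
      (totalMetric D gM gV α) where
  smooth_mul U hU A B hA hB w hw := (smoothSec_totalMul hD hM hV hα (hA.smoothSec hU hw)
    (hB.smoothSec hU hw)).contMDiffAt.contMDiffWithinAt
  smooth_unit w _ := (smoothSec_vertField
    (hV.smoothSec_unit w.proj)).contMDiffAt.contMDiffWithinAt
  smooth_metric U hU A B hA hB w hw := (smoothNear_totalMetric hD hM hV hα (hA.smoothSec hU hw)
    (hB.smoothSec hU hw)).contMDiffAt.contMDiffWithinAt
  mul_comm w A B := by
    apply tangent_total_ext' D
    · rw [projDeriv_totalMul, projDeriv_totalMul, hM.mul_comm _ (projDeriv _ w A)]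
      abel
    · rw [vertPart_totalMul, vertPart_totalMul, hV.mul_comm]
  mul_assoc w A B C := by
    apply tangent_total_ext' D
    · simp only [projDeriv_totalMul, vertPart_totalMul, map_add, LinearMap.add_apply, hα_mul]
      set a := projDeriv (𝓡 n) w A
      set b := projDeriv (𝓡 n) w B
      set c := projDeriv (𝓡 n) w C
      set a' := α _ (vertPart D w A)
      set b' := α _ (vertPart D w B)
      set c' := α _ (vertPart D w C)
      simp only [hM.mul_assoc]
      rw [hM.mul_comm _ c' (mulM _ a b), hM.mul_comm _ c' (mulM _ a' b),
        hM.mul_comm _ c' (mulM _ b' a)]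
      simp only [hM.mul_assoc]
      have h1 : mulM _ b' (mulM _ a c) = mulM _ a (mulM _ b' c) := by
        rw [← hM.mul_assoc, hM.mul_comm _ b' a, hM.mul_assoc]
      rw [hM.mul_comm _ a c', hM.mul_comm _ b c', h1]
      abel
    · simp only [vertPart_totalMul, hV.mul_assoc]
  unit_mul w A := by
    apply tangent_total_ext' D
    · simp [projDeriv_totalMul, totalUnit, hα_unit, hM.unit_mul]
    · simp [vertPart_totalMul, totalUnit, hV.unit_mul]
  metric_symm w := (hpos w).1
  metric_nondegenerate w := by
    have h (A : TangentSpace ((𝓡 n).prod 𝓘(ℝ, F)) w) (hA : totalMetric D gM gV α w A A = 0) :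
        A = 0 := by
      by_contra hne
      exact ((hpos w).2 A hne).ne' hA
    exact ⟨fun A hA => h A (hA A), fun A hA => h A (hA A)⟩
  metric_invariant w A B C := by
    simp only [totalMetric_apply, projDeriv_totalMul, vertPart_totalMul, map_add,
      LinearMap.add_apply, hα_mul, hV.metric_invariant]
    set a := projDeriv (𝓡 n) w A
    set b := projDeriv (𝓡 n) w B
    set c := projDeriv (𝓡 n) w C
    set a' := α _ (vertPart D w A)
    set b' := α _ (vertPart D w B)
    set c' := α _ (vertPart D w C)
    have h1 (x y z) : gM w.proj (mulM _ x y) z = gM w.proj x (mulM _ y z) :=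
      hM.metric_invariant _ x y z
    simp only [h1]
    have h2 : gM _ b' (mulM _ a c) = gM _ a (mulM _ b' c) := by
      rw [← h1, hM.mul_comm _ b' a, h1]
    have h3 (x y) : gM _ c' (mulM _ x y) = gM _ x (mulM _ y c') := by rw [hM.symm, h1]
    rw [h2, h3, h3, h3, hM.mul_comm _ c' b, hM.mul_comm _ c' a]
    ring

end AlmostFrobenius

section FDefect

variable {E : Type*} [NormedAddCommGroup E] [NormedSpace ℝ E] [FiniteDimensional ℝ E]
  [CompleteSpace E] {H : Type*} [TopologicalSpace H] {I : ModelWithCorners ℝ E H}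
  {B : Type*} [TopologicalSpace B] [ChartedSpace H B] [IsManifold I ∞ B]
  {mul : ∀ x : B, TangentSpace I x →ₗ[ℝ] TangentSpace I x →ₗ[ℝ] TangentSpace I x}
  {e : ∀ x : B, TangentSpace I x} {g : ∀ x : B, LinearMap.BilinForm ℝ (TangentSpace I x)}
  {f : B → ℝ} {X X' Y Z T : ∀ x : B, TangentSpace I x} {x : B}

variable (I mul) in
/-- The defect of the identity `L_{X ∘ Y}(∘) = X ∘ L_Y(∘) + Y ∘ L_X(∘)`. -/
def fDefect (X Y Z T : ∀ x : B, TangentSpace I x) (x : B) : TangentSpace I x :=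
  lieDerivMul I mul (fun y => mul y (X y) (Y y)) Z T x - mul x (X x) (lieDerivMul I mul Y Z T x) -
    mul x (Y x) (lieDerivMul I mul X Z T x)

lemma isFMultiplication_iff_fDefect : IsFMultiplication I mul ↔
    ∀ (x : B) (X Y Z T : ∀ x : B, TangentSpace I x),
      SmoothSec I E X x → SmoothSec I E Y x → SmoothSec I E Z x → SmoothSec I E T x →
      fDefect I mul X Y Z T x = 0 := by
  rw [isFMultiplication_iff]
  simp only [fDefect, sub_sub, sub_eq_zero]
  exact ⟨fun h x X Y Z T => h X Y Z T x, fun h X Y Z T x => h x X Y Z T⟩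

lemma lieDerivMul_comm (h : IsAlmostFrobenius I mul e g) :
    lieDerivMul I mul X Z T x = lieDerivMul I mul X T Z x := by
  have h1 : (fun y => mul y (Z y) (T y)) = fun y => mul y (T y) (Z y) :=
    funext fun y => h.mul_comm y _ _
  rw [lieDerivMul, lieDerivMul, h1, h.mul_comm x (Z x), h.mul_comm x _ (T x)]
  abel

lemma fDefect_comm (h : IsAlmostFrobenius I mul e g) :
    fDefect I mul X Y Z T x = fDefect I mul Y X Z T x := by
  have h1 : (fun y => mul y (X y) (Y y)) = fun y => mul y (Y y) (X y) :=
    funext fun y => h.mul_comm y _ _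
  rw [fDefect, fDefect, h1]
  abel

lemma fDefect_comm_right (h : IsAlmostFrobenius I mul e g) :
    fDefect I mul X Y Z T x = fDefect I mul X Y T Z x := by
  simp only [fDefect, lieDerivMul_comm h (Z := Z) (T := T)]

lemma fDefect_swap (h : IsAlmostFrobenius I mul e g) :
    fDefect I mul Z T X Y x = - fDefect I mul X Y Z T x := by
  simp only [fDefect, lieDerivMul]
  rw [mlieBracket_swap_apply (V := fun y => mul y (Z y) (T y)) (W := fun y => mul y (X y) (Y y)),
    mlieBracket_swap_apply (V := fun y => mul y (Z y) (T y)) (W := X),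
    mlieBracket_swap_apply (V := fun y => mul y (Z y) (T y)) (W := Y),
    mlieBracket_swap_apply (V := T) (W := fun y => mul y (X y) (Y y)),
    mlieBracket_swap_apply (V := Z) (W := fun y => mul y (X y) (Y y)),
    mlieBracket_swap_apply (V := T) (W := X), mlieBracket_swap_apply (V := T) (W := Y),
    mlieBracket_swap_apply (V := Z) (W := X), mlieBracket_swap_apply (V := Z) (W := Y)]
  simp only [map_neg, map_sub, LinearMap.neg_apply]
  have hl (a b c : TangentSpace I x) : mul x a (mul x b c) = mul x b (mul x a c) := by
    rw [← h.mul_assoc, h.mul_comm x a b, h.mul_assoc]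
  rw [h.mul_comm x (mlieBracket I (fun y => mul y (X y) (Y y)) Z x) (T x),
    h.mul_comm x (mlieBracket I X (fun y => mul y (Z y) (T y)) x) (Y x),
    h.mul_comm x (mlieBracket I Y Z x) (T x), h.mul_comm x (mlieBracket I X Z x) (T x),
    h.mul_comm x (mlieBracket I X T x) (Y x), h.mul_comm x (mlieBracket I X Z x) (Y x),
    hl (X x) (T x), hl (X x) (Z x), hl (Y x) (T x), hl (Y x) (Z x)]
  abel

lemma lieDerivMul_add (hX : SmoothSec I E X x) (hX' : SmoothSec I E X' x) :
    lieDerivMul I mul (fun y => X y + X' y) Z T x =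
      lieDerivMul I mul X Z T x + lieDerivMul I mul X' Z T x := by
  simp only [lieDerivMul]
  rw [mlieBracket_fun_add_left hX hX', mlieBracket_fun_add_left hX hX',
    mlieBracket_fun_add_left hX hX']
  simp only [map_add, LinearMap.add_apply]
  abel

lemma lieDerivMul_smul (hf : SmoothNear I f x) (hX : SmoothSec I E X x) :
    lieDerivMul I mul (fun y => f y • X y) Z T x = f x • lieDerivMul I mul X Z T x -
      mvfderiv I f x (mul x (Z x) (T x)) • X x + mvfderiv I f x (Z x) • mul x (X x) (T x) +
      mvfderiv I f x (T x) • mul x (Z x) (X x) := by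
  simp only [lieDerivMul]
  rw [mlieBracket_fun_smul_left hf hX, mlieBracket_fun_smul_left hf hX,
    mlieBracket_fun_smul_left hf hX]
  simp only [map_add, LinearMap.add_apply, map_smul, LinearMap.smul_apply]
  module

lemma lieDerivMul_congr (h : ∀ᶠ y in 𝓝 x, X' y = X y) :
    lieDerivMul I mul X' Z T x = lieDerivMul I mul X Z T x := by
  rw [lieDerivMul, lieDerivMul, mlieBracket_congr_left h, mlieBracket_congr_left h,
    mlieBracket_congr_left h]

lemma fDefect_add (h : IsAlmostFrobenius I mul e g) (hX : SmoothSec I E X x)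
    (hX' : SmoothSec I E X' x) (hY : SmoothSec I E Y x) :
    fDefect I mul (fun y => X y + X' y) Y Z T x =
      fDefect I mul X Y Z T x + fDefect I mul X' Y Z T x := by
  simp only [fDefect, map_add, LinearMap.add_apply]
  rw [lieDerivMul_add (h.smoothSec_mul hX hY) (h.smoothSec_mul hX' hY), lieDerivMul_add hX hX',
    map_add]
  abel

lemma fDefect_smul (h : IsAlmostFrobenius I mul e g) (hf : SmoothNear I f x)
    (hX : SmoothSec I E X x) (hY : SmoothSec I E Y x) :
    fDefect I mul (fun y => f y • X y) Y Z T x = f x • fDefect I mul X Y Z T x := by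
  simp only [fDefect, map_smul, LinearMap.smul_apply]
  rw [lieDerivMul_smul hf (h.smoothSec_mul hX hY), lieDerivMul_smul hf hX]
  simp only [map_add, map_sub, map_smul]
  have h1 : mul x (Y x) (mul x (Z x) (X x)) = mul x (Z x) (mul x (X x) (Y x)) := by
    rw [h.mul_comm x (Y x), h.mul_assoc]
  rw [← h.mul_assoc x (Y x) (X x) (T x), h1, h.mul_comm x (Y x) (X x)]
  module

lemma fDefect_congr (hX : ∀ᶠ y in 𝓝 x, X' y = X y) :
    fDefect I mul X' Y Z T x = fDefect I mul X Y Z T x := by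
  have h1 : ∀ᶠ y in 𝓝 x, mul y (X' y) (Y y) = mul y (X y) (Y y) := hX.mono fun y hy => by rw [hy]
  rw [fDefect, fDefect, lieDerivMul_congr h1, lieDerivMul_congr hX, hX.self_of_nhds]

end FDefect

section FMultiplicationTotal

variable {n : ℕ} {M : Type*} [TopologicalSpace M] [ChartedSpace (EuclideanSpace ℝ (Fin n)) M]
  [IsManifold (𝓡 n) ∞ M]
  {F : Type*} [NormedAddCommGroup F] [NormedSpace ℝ F] [FiniteDimensional ℝ F] [CompleteSpace F]
  {V : M → Type*} [TopologicalSpace (TotalSpace F V)]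
  [∀ x, AddCommGroup (V x)] [∀ x, Module ℝ (V x)] [∀ x, TopologicalSpace (V x)]
  [∀ x, IsTopologicalAddGroup (V x)] [∀ x, ContinuousSMul ℝ (V x)]
  [FiberBundle F V] [VectorBundle ℝ F V] [ContMDiffVectorBundle ∞ F V (𝓡 n)]
  {mulM : ∀ x : M, TangentSpace (𝓡 n) x →ₗ[ℝ] TangentSpace (𝓡 n) x →ₗ[ℝ] TangentSpace (𝓡 n) x}
  {eM : ∀ x : M, TangentSpace (𝓡 n) x}
  {gM : ∀ x : M, LinearMap.BilinForm ℝ (TangentSpace (𝓡 n) x)}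
  {mulV : ∀ x, V x →ₗ[ℝ] V x →ₗ[ℝ] V x} {eV : ∀ x, V x} {gV : ∀ x, LinearMap.BilinForm ℝ (V x)}
  {D : CovariantDerivative (𝓡 n) F V} {α : ∀ x, V x →ₗ[ℝ] TangentSpace (𝓡 n) x}
  {u : OpenPartialHomeomorph M (EuclideanSpace ℝ (Fin n))} {η : M → ℝ} {s : ∀ x, V x} {p : M}
  {v : TotalSpace F V}

/-- The horizontal lifts of fields and the vertical lifts of sections which are smooth near the
projection of `v`. -/
def IsLift (D : CovariantDerivative (𝓡 n) F V) (v : TotalSpace F V)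
    (A : ∀ w : TotalSpace F V, TangentSpace ((𝓡 n).prod 𝓘(ℝ, F)) w) : Prop :=
  (∃ X, SmoothSec (𝓡 n) (EuclideanSpace ℝ (Fin n)) X v.proj ∧ A = horField D X) ∨
    ∃ s, SmoothSec (𝓡 n) F s v.proj ∧ A = vertField (𝓡 n) s

lemma IsLift.smoothSec {A : ∀ w : TotalSpace F V, TangentSpace ((𝓡 n).prod 𝓘(ℝ, F)) w}
    (hD : IsSmoothCov D) (hA : IsLift D v A) :
    SmoothSec ((𝓡 n).prod 𝓘(ℝ, F)) (EuclideanSpace ℝ (Fin n) × F) A v := by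
  rcases hA with ⟨X, hX, rfl⟩ | ⟨s, hs, rfl⟩
  exacts [smoothSec_horField hD hX, smoothSec_vertField hs]

/-- The `F`-manifold identity on the total space has to be checked on lifts only. -/
lemma isFMultiplication_of_isLift (hD : IsSmoothCov D)
    (hA : IsAlmostFrobenius ((𝓡 n).prod 𝓘(ℝ, F)) (totalMul D mulM mulV α) (totalUnit (𝓡 n) eV)
      (totalMetric D gM gV α))
    (H : ∀ (v : TotalSpace F V) X Y Z T, IsLift D v X → IsLift D v Y → IsLift D v Z → IsLift D v T →
      fDefect ((𝓡 n).prod 𝓘(ℝ, F)) (totalMul D mulM mulV α) X Y Z T v = 0) :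
    IsFMultiplication ((𝓡 n).prod 𝓘(ℝ, F)) (totalMul D mulM mulV α) := by
  refine isFMultiplication_iff_fDefect.2 fun v => ?_
  have step (Y Z T) (hY : SmoothSec ((𝓡 n).prod 𝓘(ℝ, F)) (EuclideanSpace ℝ (Fin n) × F) Y v)
      (h : ∀ X, IsLift D v X →
        fDefect ((𝓡 n).prod 𝓘(ℝ, F)) (totalMul D mulM mulV α) X Y Z T v = 0) (X)
      (hX : SmoothSec ((𝓡 n).prod 𝓘(ℝ, F)) (EuclideanSpace ℝ (Fin n) × F) X v) :
      fDefect ((𝓡 n).prod 𝓘(ℝ, F)) (totalMul D mulM mulV α) X Y Z T v = 0 := by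
    refine lift_induction (P := fun X =>
      fDefect ((𝓡 n).prod 𝓘(ℝ, F)) (totalMul D mulM mulV α) X Y Z T v = 0) hD
      (fun X hX => h _ (.inl ⟨X, hX, rfl⟩)) (fun s hs => h _ (.inr ⟨s, hs, rfl⟩))
      (fun X X' hX hX' h1 h2 => ?_) (fun f X hf hX h1 => ?_) (fun X X' _ hXX h1 => ?_) X hX
    · rw [fDefect_add hA hX hX' hY, h1, h2, add_zero]
    · rw [fDefect_smul hA hf hX hY, h1, smul_zero]
    · rw [fDefect_congr hXX, h1]
  intro X Y Z T hX hY hZ hT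
  refine step Y Z T hY (fun X hX => ?_) X hX
  rw [fDefect_comm hA]
  refine step X Z T (hX.smoothSec hD) (fun Y hY => ?_) Y hY
  rw [← neg_eq_zero, ← fDefect_swap hA]
  refine step T Y X hT (fun Z hZ => ?_) Z hZ
  rw [fDefect_comm hA]
  refine step Z Y X (hZ.smoothSec hD) (fun T hT => ?_) T hT
  exact H v T Z Y X hT hZ hY hX

/-- The induced multiplication makes the total space an `F`-manifold when all the data are
parallel. -/
theorem isFMultiplication_total (hD : IsSmoothCov D) (hM : IsAlmostFrobenius (𝓡 n) mulM eM gM)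
    (hMF : IsFMultiplication (𝓡 n) mulM)
    (hV : IsFrobeniusAlgebraBundle (𝓡 n) F mulV eV gV) (hα : IsSmoothMorphism (𝓡 n) F α)
    (hA : IsAlmostFrobenius ((𝓡 n).prod 𝓘(ℝ, F)) (totalMul D mulM mulV α) (totalUnit (𝓡 n) eV)
      (totalMetric D gM gV α)) (hflat : IsFlat D) (hmul : IsParallelMul D mulV)
    {l : ∀ x, V x →ₗ[ℝ] ℝ} (hl : IsSmoothFunctional (𝓡 n) F l) (hlD : IsParallelFunctional D l)
    (hlmul : ∀ x (v w : V x), l x (mulV x v w) = l x v * l x w)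
    (hαl : ∀ x (v : V x), α x v = l x v • eM x) :
    IsFMultiplication ((𝓡 n).prod 𝓘(ℝ, F)) (totalMul D mulM mulV α) := by
  have hαm (x : M) (w : V x) (ξ : TangentSpace (𝓡 n) x) : mulM x (α x w) ξ = l x w • ξ := by
    rw [hαl, map_smul, LinearMap.smul_apply, hM.unit_mul]
  have hαZ {t : ∀ x, V x} {Z : ∀ x : M, TangentSpace (𝓡 n) x} {x : M}
      (ht : SmoothSec (𝓡 n) F t x) (hZ : SmoothSec (𝓡 n) (EuclideanSpace ℝ (Fin n)) Z x) :=
    hM.smoothSec_mul (isSmoothMorphism_iff.1 hα t x ht) hZ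
  refine isFMultiplication_of_isLift hD hA fun v => ?_
  have hHV {X Z : ∀ x : M, TangentSpace (𝓡 n) x} {t : ∀ x, V x}
      (hX : SmoothSec (𝓡 n) (EuclideanSpace ℝ (Fin n)) X v.proj)
      (hZ : SmoothSec (𝓡 n) (EuclideanSpace ℝ (Fin n)) Z v.proj)
      (ht : SmoothSec (𝓡 n) F t v.proj) :
      lieDerivMul ((𝓡 n).prod 𝓘(ℝ, F)) (totalMul D mulM mulV α) (horField D X) (horField D Z)
        (vertField (𝓡 n) t) v = 0 := by
    rw [lieDerivMul_horField_horField_vertField hD hflat hX hZ ht (hαZ ht hZ)]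
    simp only [hαm]
    rw [mlieBracket_fun_smul_right (isSmoothFunctional_iff.1 hl t _ ht) hZ,
      isParallelFunctional_iff.1 hlD t _ ht, add_sub_cancel_right, sub_self, map_zero]
  have hVV {X : ∀ x : M, TangentSpace (𝓡 n) x} {s t : ∀ x, V x}
      (hX : SmoothSec (𝓡 n) (EuclideanSpace ℝ (Fin n)) X v.proj)
      (hs : SmoothSec (𝓡 n) F s v.proj) (ht : SmoothSec (𝓡 n) F t v.proj) :
      lieDerivMul ((𝓡 n).prod 𝓘(ℝ, F)) (totalMul D mulM mulV α) (horField D X) (vertField (𝓡 n) s)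
        (vertField (𝓡 n) t) v = 0 := by
    rw [lieDerivMul_horField_vertField_vertField hD hX hs ht (hV.smoothSec_mul hs ht),
      isParallelMul_iff.1 hmul s t _ hs ht, add_sub_cancel_left, sub_self, map_zero]
  have hHH (X Y Z T) (hX : SmoothSec (𝓡 n) (EuclideanSpace ℝ (Fin n)) X v.proj)
      (hY : SmoothSec (𝓡 n) (EuclideanSpace ℝ (Fin n)) Y v.proj) (hZ : IsLift D v Z)
      (hT : IsLift D v T) : fDefect ((𝓡 n).prod 𝓘(ℝ, F)) (totalMul D mulM mulV α) (horField D X)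
        (horField D Y) Z T v = 0 := by
    have hXY := hM.smoothSec_mul hX hY
    simp only [fDefect, totalMul_horField_horField]
    rcases hZ with ⟨Z, hZ, rfl⟩ | ⟨s, hs, rfl⟩ <;> rcases hT with ⟨T, hT, rfl⟩ | ⟨t, ht, rfl⟩
    · have hZT := hM.smoothSec_mul hZ hT
      rw [lieDerivMul_horField_horField_horField hD hflat hXY hZ hT hZT,
        lieDerivMul_horField_horField_horField hD hflat hX hZ hT hZT,
        lieDerivMul_horField_horField_horField hD hflat hY hZ hT hZT,
        isFMultiplication_iff.1 hMF X Y Z T _ hX hY hZ hT]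
      simp only [horField, totalMul_horLift_horLift, map_add]
      abel
    · rw [hHV hXY hZ ht, hHV hX hZ ht, hHV hY hZ ht]
      simp
    · rw [lieDerivMul_comm hA, lieDerivMul_comm hA (X := horField D X),
        lieDerivMul_comm hA (X := horField D Y), hHV hXY hT hs, hHV hX hT hs, hHV hY hT hs]
      simp
    · rw [hVV hXY hs ht, hVV hX hs ht, hVV hY hs ht]
      simp
  have hHVHV (X s Z t) (hX : SmoothSec (𝓡 n) (EuclideanSpace ℝ (Fin n)) X v.proj)
      (hs : SmoothSec (𝓡 n) F s v.proj)
      (hZ : SmoothSec (𝓡 n) (EuclideanSpace ℝ (Fin n)) Z v.proj)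
      (ht : SmoothSec (𝓡 n) F t v.proj) :
      fDefect ((𝓡 n).prod 𝓘(ℝ, F)) (totalMul D mulM mulV α) (horField D X) (vertField (𝓡 n) s)
        (horField D Z) (vertField (𝓡 n) t) v = 0 := by
    simp only [fDefect, totalMul_horField_vertField]
    rw [hHV (hαZ hs hX) hZ ht, hHV hX hZ ht,
      lieDerivMul_vertField_horField_vertField hD hs hZ ht (hαZ ht hZ)]
    simp only [horField, totalMul_horLift_vertLift, hαm, map_sub, map_smul, hlmul, map_zero]
    module
  have hHVV (X s T T') (hX : SmoothSec (𝓡 n) (EuclideanSpace ℝ (Fin n)) X v.proj)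
      (hs : SmoothSec (𝓡 n) F s v.proj) (hT : IsLift D v T) (hT' : IsLift D v T') :
      fDefect ((𝓡 n).prod 𝓘(ℝ, F)) (totalMul D mulM mulV α) (horField D X) (vertField (𝓡 n) s)
        T T' v = 0 := by
    have hT0 := hT
    rcases hT with ⟨Z, hZ, rfl⟩ | ⟨t, ht, rfl⟩ <;> rcases hT' with ⟨Z', hZ', rfl⟩ | ⟨t', ht', rfl⟩
    · rw [← neg_eq_zero, ← fDefect_swap hA]
      exact hHH _ _ _ _ hZ hZ' (.inl ⟨X, hX, rfl⟩) (.inr ⟨s, hs, rfl⟩)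
    · exact hHVHV _ _ _ _ hX hs hZ ht'
    · rw [fDefect_comm_right hA]
      exact hHVHV _ _ _ _ hX hs hZ' ht
    · simp only [fDefect, totalMul_horField_vertField]
      rw [hVV (hαZ hs hX) ht ht', hVV hX ht ht',
        lieDerivMul_vertField_vertField_vertField hs ht ht' (hV.smoothSec_mul ht ht')]
      simp
  intro X Y Z T hX hY hZ hT
  have hX0 := hX
  have hY0 := hY
  rcases hX with ⟨X, hX, rfl⟩ | ⟨r, hr, rfl⟩ <;> rcases hY with ⟨Y, hY, rfl⟩ | ⟨s, hs, rfl⟩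
  · exact hHH _ _ _ _ hX hY hZ hT
  · exact hHVV _ _ _ _ hX hs hZ hT
  · rw [fDefect_comm hA]
    exact hHVV _ _ _ _ hY hr hZ hT
  · have hZ0 := hZ
    have hT0 := hT
    rcases hZ with ⟨Z, hZ, rfl⟩ | ⟨t, ht, rfl⟩ <;> rcases hT with ⟨Z', hZ', rfl⟩ | ⟨t', ht', rfl⟩
    · rw [← neg_eq_zero, ← fDefect_swap hA]
      exact hHH _ _ _ _ hZ hZ' hX0 hY0
    · rw [← neg_eq_zero, ← fDefect_swap hA]
      exact hHVV _ _ _ _ hZ ht' hX0 hY0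
    · rw [fDefect_comm_right hA, ← neg_eq_zero, ← fDefect_swap hA]
      exact hHVV _ _ _ _ hZ' ht hX0 hY0
    · have hrs := hV.smoothSec_mul hr hs
      have htt := hV.smoothSec_mul ht ht'
      simp only [fDefect, totalMul_vertField_vertField]
      rw [lieDerivMul_vertField_vertField_vertField hrs ht ht' htt,
        lieDerivMul_vertField_vertField_vertField hr ht ht' htt,
        lieDerivMul_vertField_vertField_vertField hs ht ht' htt]
      simp

end FMultiplicationTotal

section DirectionalDerivative

variable {E : Type*} [NormedAddCommGroup E] [NormedSpace ℝ E]
  {H : Type*} [TopologicalSpace H] {I : ModelWithCorners ℝ E H}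
  {B : Type*} [TopologicalSpace B] [ChartedSpace H B] [IsManifold I ∞ B]
  {G : Type*} [NormedAddCommGroup G] [NormedSpace ℝ G]
  {X : ∀ x : B, TangentSpace I x} {x : B}

lemma SmoothNear.mdifferentiableAt_dirDeriv {f : B → G} (hf : SmoothNear I f x)
    (hX : MDifferentiableAt I (I.prod 𝓘(ℝ, E)) (fun y => TotalSpace.mk' E y (X y)) x) :
    MDifferentiableAt I 𝓘(ℝ, G) (fun y => mvfderiv I f y (X y)) x := by
  obtain ⟨U, hU, hUo, hxU⟩ := eventually_nhds_iff.1 hf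
  have h1 : ContMDiffOn I 𝓘(ℝ, G) ∞ f U := fun y hy => (hU y hy).contMDiffWithinAt
  have h2 := h1.contMDiffOn_tangentMapWithin (m := ∞) (by simp) hUo.uniqueMDiffOn
  have h3 := (contMDiff_snd_tangentBundle_modelSpace G 𝓘(ℝ, G) (n := ∞)).comp_contMDiffOn h2
  have hU' : IsOpen ((TotalSpace.proj : TangentBundle I B → B) ⁻¹' U) :=
    hUo.preimage (FiberBundle.continuous_proj E (TangentSpace I : B → Type _))
  have h4 := ((h3 ⟨x, X x⟩ hxU).contMDiffAt (hU'.mem_nhds hxU)).mdifferentiableAt (by simp)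
  have h5 := h4.comp x (f := fun y => TotalSpace.mk' E y (X y)) hX
  refine h5.congr_of_eventuallyEq ?_
  filter_upwards [hUo.mem_nhds hxU] with y hy
  simp only [Function.comp, tangentMapWithin, mfderivWithin_of_isOpen hUo hy]
  rfl

end DirectionalDerivative

section TotalConnection

variable {n : ℕ} {M : Type*} [TopologicalSpace M] [ChartedSpace (EuclideanSpace ℝ (Fin n)) M]
  [IsManifold (𝓡 n) ∞ M]
  {F : Type*} [NormedAddCommGroup F] [NormedSpace ℝ F] [FiniteDimensional ℝ F] [CompleteSpace F]
  {V : M → Type*} [TopologicalSpace (TotalSpace F V)]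
  [∀ x, AddCommGroup (V x)] [∀ x, Module ℝ (V x)] [∀ x, TopologicalSpace (V x)]
  [∀ x, IsTopologicalAddGroup (V x)] [∀ x, ContinuousSMul ℝ (V x)]
  [FiberBundle F V] [VectorBundle ℝ F V] [ContMDiffVectorBundle ∞ F V (𝓡 n)]
  {mulM : ∀ x : M, TangentSpace (𝓡 n) x →ₗ[ℝ] TangentSpace (𝓡 n) x →ₗ[ℝ] TangentSpace (𝓡 n) x}
  {eM : ∀ x : M, TangentSpace (𝓡 n) x}
  {gM : ∀ x : M, LinearMap.BilinForm ℝ (TangentSpace (𝓡 n) x)}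
  {mulV : ∀ x, V x →ₗ[ℝ] V x →ₗ[ℝ] V x} {eV : ∀ x, V x} {gV : ∀ x, LinearMap.BilinForm ℝ (V x)}
  {D : CovariantDerivative (𝓡 n) F V} {α : ∀ x, V x →ₗ[ℝ] TangentSpace (𝓡 n) x}
  {u : OpenPartialHomeomorph M (EuclideanSpace ℝ (Fin n))} {η : M → ℝ} {s : ∀ x, V x} {p : M}
  {nM : CovariantDerivative (𝓡 n) (EuclideanSpace ℝ (Fin n)) (TangentSpace (𝓡 n) : M → Type _)}
  {v : TotalSpace F V} {A B : ∀ w : TotalSpace F V, TangentSpace ((𝓡 n).prod 𝓘(ℝ, F)) w}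

lemma mdifferentiableAt_horCoeff (hA : MDifferentiableAt ((𝓡 n).prod 𝓘(ℝ, F))
      (((𝓡 n).prod 𝓘(ℝ, F)).prod 𝓘(ℝ, EuclideanSpace ℝ (Fin n) × F))
      (fun w => TotalSpace.mk' (EuclideanSpace ℝ (Fin n) × F) w (A w)) v) (i : Fin n) :
    MDifferentiableAt ((𝓡 n).prod 𝓘(ℝ, F)) 𝓘(ℝ, ℝ) (horCoeff v A i) v :=
  (smoothNear_chart_proj v i).mdifferentiableAt_dirDeriv hA

lemma mdifferentiableAt_vertCoeff (hD : IsSmoothCov D)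
    (hA : MDifferentiableAt ((𝓡 n).prod 𝓘(ℝ, F))
      (((𝓡 n).prod 𝓘(ℝ, F)).prod 𝓘(ℝ, EuclideanSpace ℝ (Fin n) × F))
      (fun w => TotalSpace.mk' (EuclideanSpace ℝ (Fin n) × F) w (A w)) v)
    (k : Fin (Module.finrank ℝ F)) :
    MDifferentiableAt ((𝓡 n).prod 𝓘(ℝ, F)) 𝓘(ℝ, ℝ) (vertCoeff D v A k) v := by
  have h := smoothNear_fib_trivializationAt (n := n) v
  have h1 := h.clm_comp (coordL F k)
  have h2 : ∀ᶠ w in 𝓝 v, vertCoeff D v A k w =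
      mvfderiv ((𝓡 n).prod 𝓘(ℝ, F))
        (fun w => coordL F k (fib (trivializationAt F V v.proj) w)) w (A w) -
      ∑ i, horCoeff v A i w * mvfderiv ((𝓡 n).prod 𝓘(ℝ, F))
        (fun w => coordL F k (fib (trivializationAt F V v.proj) w)) w
          (horField D (chartField v i) w) := by
    filter_upwards [h.eventually] with w hw
    simp only [mvfderiv_clm_comp (coordL F k) hw]
    simp only [vertCoeff, map_sub, map_sum, map_smul, smul_eq_mul]
  refine MDifferentiableAt.congr_of_eventuallyEq ?_ h2
  refine (h1.mdifferentiableAt_dirDeriv hA).sub ?_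
  have h3 (i : Fin n) := (mdifferentiableAt_horCoeff hA i).mul (h1.mdifferentiableAt_dirDeriv
    (smoothSec_horField hD (smoothSec_chartField v i)).mdifferentiableAt)
  exact (MDifferentiableAt.sum (t := Finset.univ) fun i _ => h3 i).congr_of_eventuallyEq
    (.of_forall fun w => by simp [Finset.sum_apply])

lemma horCoeff_add (i : Fin n) (w : TotalSpace F V) :
    horCoeff v (A + B) i w = horCoeff v A i w + horCoeff v B i w := by
  simp only [horCoeff, Pi.add_apply, map_add]

lemma horCoeff_smul (f : TotalSpace F V → ℝ) (i : Fin n) (w : TotalSpace F V) :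
    horCoeff v (f • A) i w = f w * horCoeff v A i w := by
  simp only [horCoeff, Pi.smul_apply', map_smul, smul_eq_mul]

lemma vertCoeff_add (k : Fin (Module.finrank ℝ F)) (w : TotalSpace F V) :
    vertCoeff D v (A + B) k w = vertCoeff D v A k w + vertCoeff D v B k w := by
  simp only [vertCoeff, horCoeff_add, Pi.add_apply, map_add, map_sub, add_smul,
    Finset.sum_add_distrib]
  ring

lemma vertCoeff_smul (f : TotalSpace F V → ℝ) (k : Fin (Module.finrank ℝ F))
    (w : TotalSpace F V) : vertCoeff D v (f • A) k w = f w * vertCoeff D v A k w := by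
  simp only [vertCoeff, horCoeff_smul, Pi.smul_apply', map_smul, mul_smul, ← Finset.smul_sum,
    ← smul_sub, smul_eq_mul]

variable (nM D) in
/-- The connection on the total space for which the covariant derivatives of lifts are the lifts
of covariant derivatives. -/
def totalCov (A : ∀ w : TotalSpace F V, TangentSpace ((𝓡 n).prod 𝓘(ℝ, F)) w)
    (v : TotalSpace F V) :
    TangentSpace ((𝓡 n).prod 𝓘(ℝ, F)) v →L[ℝ] TangentSpace ((𝓡 n).prod 𝓘(ℝ, F)) v :=
  (∑ i, (horCoeff v A i v • (horLift D v ∘L nM (chartField v i) v.proj ∘L projDeriv (𝓡 n) v) +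
    (mvfderiv ((𝓡 n).prod 𝓘(ℝ, F)) (horCoeff v A i) v).smulRight (horField D (chartField v i) v))) +
  ∑ k, (vertCoeff D v A k v •
      (vertLift (𝓡 n) v ∘L D (fibreSec V v k) v.proj ∘L projDeriv (𝓡 n) v) +
    (mvfderiv ((𝓡 n).prod 𝓘(ℝ, F)) (vertCoeff D v A k) v).smulRight
      (vertField (𝓡 n) (fibreSec V v k) v))

lemma totalCov_apply (C : TangentSpace ((𝓡 n).prod 𝓘(ℝ, F)) v) :
    totalCov D nM A v C =
      (∑ i, (horCoeff v A i v • horLift D v (nM (chartField v i) v.proj (projDeriv (𝓡 n) v C)) +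
        mvfderiv ((𝓡 n).prod 𝓘(ℝ, F)) (horCoeff v A i) v C • horField D (chartField v i) v)) +
      ∑ k, (vertCoeff D v A k v •
          vertLift (𝓡 n) v (D (fibreSec V v k) v.proj (projDeriv (𝓡 n) v C)) +
        mvfderiv ((𝓡 n).prod 𝓘(ℝ, F)) (vertCoeff D v A k) v C •
          vertField (𝓡 n) (fibreSec V v k) v) := by
  simp only [totalCov, add_apply, sum_apply, smul_apply,
    ContinuousLinearMap.comp_apply, ContinuousLinearMap.smulRight_apply]

variable (nM) in
lemma isCovariantDerivativeOn_totalCov (hD : IsSmoothCov D) :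
    IsCovariantDerivativeOn (EuclideanSpace ℝ (Fin n) × F) (totalCov D nM (V := V)) univ where
  add {A B v} hA hB _ := by
    ext C
    rw [add_apply, totalCov_apply, totalCov_apply, totalCov_apply]
    have h1 (i) : mvfderiv ((𝓡 n).prod 𝓘(ℝ, F)) (horCoeff v (A + B) i) v C =
        mvfderiv _ (horCoeff v A i) v C + mvfderiv _ (horCoeff v B i) v C := by
      rw [funext (horCoeff_add i), mvfderiv_fun_add (mdifferentiableAt_horCoeff hA i)
        (mdifferentiableAt_horCoeff hB i)]
      rfl
    have h2 (k) : mvfderiv ((𝓡 n).prod 𝓘(ℝ, F)) (vertCoeff D v (A + B) k) v C =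
        mvfderiv _ (vertCoeff D v A k) v C + mvfderiv _ (vertCoeff D v B k) v C := by
      rw [funext (vertCoeff_add k), mvfderiv_fun_add (mdifferentiableAt_vertCoeff hD hA k)
        (mdifferentiableAt_vertCoeff hD hB k)]
      rfl
    simp only [h1, h2, horCoeff_add, vertCoeff_add, add_smul, Finset.sum_add_distrib]
    abel
  leibniz {A f v} hA hf _ := by
    ext C
    have h1 (i) : mvfderiv ((𝓡 n).prod 𝓘(ℝ, F)) (horCoeff v (f • A) i) v C =
        f v * mvfderiv _ (horCoeff v A i) v C + mvfderiv _ f v C * horCoeff v A i v := by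
      rw [funext (horCoeff_smul f i), mvfderiv_fun_mul hf (mdifferentiableAt_horCoeff hA i)]
      exact congrArg _ (mul_comm _ _)
    have h2 (k) : mvfderiv ((𝓡 n).prod 𝓘(ℝ, F)) (vertCoeff D v (f • A) k) v C =
        f v * mvfderiv _ (vertCoeff D v A k) v C + mvfderiv _ f v C * vertCoeff D v A k v := by
      rw [funext (vertCoeff_smul f k), mvfderiv_fun_mul hf (mdifferentiableAt_vertCoeff hD hA k)]
      exact congrArg _ (mul_comm _ _)
    rw [add_apply, smul_apply, ContinuousLinearMap.smulRight_apply, totalCov_apply, totalCov_apply]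
    conv_rhs => rw [(eventually_eq_sum_lifts D v A).self_of_nhds]
    simp only [h1, h2, horCoeff_smul, vertCoeff_smul, add_smul, mul_smul, Finset.sum_add_distrib,
      smul_add, Finset.smul_sum]
    abel

variable (nM) in
/-- `totalCov` as a covariant derivative. -/
def totalConnection (hD : IsSmoothCov D) :
    CovariantDerivative ((𝓡 n).prod 𝓘(ℝ, F)) (EuclideanSpace ℝ (Fin n) × F)
      (TangentSpace ((𝓡 n).prod 𝓘(ℝ, F)) : TotalSpace F V → Type _) :=
  ⟨totalCov D nM, isCovariantDerivativeOn_totalCov nM hD⟩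

lemma totalConnection_horField (hD : IsSmoothCov D) {X : ∀ x : M, TangentSpace (𝓡 n) x}
    (hX : SmoothSec (𝓡 n) (EuclideanSpace ℝ (Fin n)) X v.proj)
    (C : TangentSpace ((𝓡 n).prod 𝓘(ℝ, F)) v) :
    totalConnection nM hD (horField D X) v C =
      horLift D v (nM X v.proj (projDeriv (𝓡 n) v C)) := by
  let a : Fin n → M → ℝ := fun i y => mvfderiv (𝓡 n)
    (fun q => chartAt (EuclideanSpace ℝ (Fin n)) v.proj q i) y (X y)
  have ha (i) : SmoothNear (𝓡 n) (a i) v.proj :=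
    smoothSec_of_chart_coord (chart_mem v) (mem_chart v) hX i
  have h1 (i) : ∀ᶠ w : TotalSpace F V in 𝓝 v, horCoeff v (horField D X) i w = a i w.proj := by
    filter_upwards [eventually_mem_chart (n := n) v] with w hw
    rw [horCoeff_eq hw.1, projDeriv_horField]
  have h2 (k) : ∀ᶠ w : TotalSpace F V in 𝓝 v, vertCoeff D v (horField D X) k w = 0 := by
    filter_upwards [eventually_mem_chart (n := n) v] with w hw
    rw [vertCoeff_eq hw.1 hw.2, vertPart_horField, fib_mk hw.2, map_zero, map_zero]
  have h3 : ∀ᶠ y in 𝓝 v.proj, X y = ∑ i, a i y • chartField v i y := by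
    filter_upwards [(chartAt (EuclideanSpace ℝ (Fin n)) v.proj).open_source.mem_nhds
      (mem_chart (n := n) v)] with y hy
    exact (sum_coordField (chart_mem v) hy (X y)).symm
  have hs (i) := (ha i).smul (smoothSec_chartField v i)
  refine (totalCov_apply C).trans ?_
  rw [cov_congr (.sum fun i _ => hs i) h3, cov_sum fun i _ => hs i, map_sum]
  have h4 (i : Fin n) := cov_smul (D := nM) (ha i) (smoothSec_chartField v i)
    (projDeriv (𝓡 n) v C)
  have h5 (i : Fin n) : mvfderiv ((𝓡 n).prod 𝓘(ℝ, F)) (horCoeff v (horField D X) i) v C =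
      mvfderiv (𝓡 n) (a i) v.proj (projDeriv (𝓡 n) v C) := by
    rw [mvfderiv_congr (h1 i), mvfderiv_comp_proj (ha i)]
  have h6 (k) : mvfderiv ((𝓡 n).prod 𝓘(ℝ, F)) (vertCoeff D v (horField D X) k) v C = 0 := by
    rw [mvfderiv_congr (h2 k), mvfderiv_const_apply]
  simp only [h4, h5, h6, fun i => (h1 i).self_of_nhds, fun k => (h2 k).self_of_nhds, map_add,
    map_smul, zero_smul, add_zero, Finset.sum_const_zero]
  rfl

lemma totalConnection_vertField (hD : IsSmoothCov D) (hs : SmoothSec (𝓡 n) F s v.proj)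
    (C : TangentSpace ((𝓡 n).prod 𝓘(ℝ, F)) v) :
    totalConnection nM hD (vertField (𝓡 n) s) v C =
      vertLift (𝓡 n) v (D s v.proj (projDeriv (𝓡 n) v C)) := by
  have hp : v.proj ∈ (trivializationAt F V v.proj).baseSet := mem_baseSet_trivializationAt' _
  let a : Fin (Module.finrank ℝ F) → M → ℝ := fun k y =>
    coordL F k (fib (trivializationAt F V v.proj) ⟨y, s y⟩)
  have ha (k) : SmoothNear (𝓡 n) (a k) v.proj := ((smoothSec_iff_fib hp).1 hs).clm_comp _
  have h1 (i) : ∀ᶠ w : TotalSpace F V in 𝓝 v, horCoeff v (vertField (𝓡 n) s) i w = 0 := by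
    filter_upwards [eventually_mem_chart (n := n) v] with w hw
    rw [horCoeff_eq hw.1, projDeriv_vertField, map_zero]
  have h2 (k) : ∀ᶠ w : TotalSpace F V in 𝓝 v,
      vertCoeff D v (vertField (𝓡 n) s) k w = a k w.proj := by
    filter_upwards [eventually_mem_chart (n := n) v] with w hw
    rw [vertCoeff_eq hw.1 hw.2, vertPart_vertField]
  have h3 : ∀ᶠ y in 𝓝 v.proj, s y = ∑ k, a k y • fibreSec V v k y := by
    filter_upwards [(trivializationAt F V v.proj).open_baseSet.mem_nhds hp] with y hy
      using eq_sum_constSec hy (s y)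
  have hss (k) := (ha k).smul (smoothSec_fibreSec v k)
  refine (totalCov_apply C).trans ?_
  rw [cov_congr (.sum fun k _ => hss k) h3, cov_sum fun k _ => hss k, map_sum]
  have h4 (k) := cov_smul (D := D) (ha k) (smoothSec_fibreSec v k) (projDeriv (𝓡 n) v C)
  have h5 (k) : mvfderiv ((𝓡 n).prod 𝓘(ℝ, F)) (vertCoeff D v (vertField (𝓡 n) s) k) v C =
      mvfderiv (𝓡 n) (a k) v.proj (projDeriv (𝓡 n) v C) := by
    rw [mvfderiv_congr (h2 k), mvfderiv_comp_proj (ha k)]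
  have h6 (i) : mvfderiv ((𝓡 n).prod 𝓘(ℝ, F)) (horCoeff v (vertField (𝓡 n) s) i) v C = 0 := by
    rw [mvfderiv_congr (h1 i), mvfderiv_const_apply]
  simp only [h4, h5, h6, fun i => (h1 i).self_of_nhds, fun k => (h2 k).self_of_nhds, map_add,
    map_smul, zero_smul, add_zero, zero_add, Finset.sum_const_zero]
  rfl

end TotalConnection

section CurvatureTensor

variable {E : Type*} [NormedAddCommGroup E] [NormedSpace ℝ E] [FiniteDimensional ℝ E]
  [CompleteSpace E] {H : Type*} [TopologicalSpace H] {I : ModelWithCorners ℝ E H}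
  {B : Type*} [TopologicalSpace B] [ChartedSpace H B] [IsManifold I ∞ B]
  {F : Type*} [NormedAddCommGroup F] [NormedSpace ℝ F]
  {W : B → Type*} [TopologicalSpace (TotalSpace F W)]
  [∀ x, AddCommGroup (W x)] [∀ x, Module ℝ (W x)] [∀ x, TopologicalSpace (W x)]
  [FiberBundle F W] [∀ x, IsTopologicalAddGroup (W x)] [∀ x, ContinuousSMul ℝ (W x)]
  [VectorBundle ℝ F W] [ContMDiffVectorBundle ∞ F W I]
  {D : CovariantDerivative I F W} {X X' Y : ∀ x : B, TangentSpace I x} {s t : ∀ x, W x}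
  {f : B → ℝ} {x : B}

lemma curvature_swap : curvature D Y X s x = - curvature D X Y s x := by
  rw [curvature, curvature, mlieBracket_swap_apply, map_neg]
  abel

lemma curvature_congr (hs : SmoothSec I F s x) (h : ∀ᶠ y in 𝓝 x, t y = s y)
    (hX : SmoothSec I E X x) (hY : SmoothSec I E Y x) (hD : IsSmoothCov D) :
    curvature D X Y t x = curvature D X Y s x := by
  have h1 (X : ∀ x : B, TangentSpace I x) : ∀ᶠ y in 𝓝 x, D t y (X y) = D s y (X y) := by
    filter_upwards [hs.eventually, h.eventually_nhds] with y hy hy'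
    rw [cov_congr hy hy']
  rw [curvature, curvature, cov_congr (hD X s x hX hs) (h1 X), cov_congr (hD Y s x hY hs) (h1 Y),
    cov_congr hs h]

lemma curvature_add (hs : SmoothSec I F s x) (ht : SmoothSec I F t x)
    (hX : SmoothSec I E X x) (hY : SmoothSec I E Y x) (hD : IsSmoothCov D) :
    curvature D X Y (fun y => s y + t y) x = curvature D X Y s x + curvature D X Y t x := by
  have h1 (X : ∀ x : B, TangentSpace I x) :
      ∀ᶠ y in 𝓝 x, D (fun y => s y + t y) y (X y) = D s y (X y) + D t y (X y) := by
    filter_upwards [hs.eventually, ht.eventually] with y hy hy'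
    rw [cov_add hy hy', add_apply]
  have h2 (X : ∀ x : B, TangentSpace I x) (hX : SmoothSec I E X x) :=
    (hD X s x hX hs).add (hD X t x hX ht)
  rw [curvature, cov_congr (h2 X hX) (h1 X), cov_congr (h2 Y hY) (h1 Y), cov_add hs ht,
    cov_add (hD X s x hX hs) (hD X t x hX ht), cov_add (hD Y s x hY hs) (hD Y t x hY ht)]
  simp only [curvature, add_apply]
  abel

lemma curvature_smul (hf : SmoothNear I f x) (hs : SmoothSec I F s x)
    (hX : SmoothSec I E X x) (hY : SmoothSec I E Y x) (hD : IsSmoothCov D) :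
    curvature D X Y (fun y => f y • s y) x = f x • curvature D X Y s x := by
  have h1 (X : ∀ x : B, TangentSpace I x) : ∀ᶠ y in 𝓝 x, D (fun y => f y • s y) y (X y) =
      f y • D s y (X y) + mvfderiv I f y (X y) • s y := by
    filter_upwards [hf.eventually, hs.eventually] with y hy hy'
    rw [cov_smul hy hy']
  have h2 (X : ∀ x : B, TangentSpace I x) (hX : SmoothSec I E X x) := hf.smul (hD X s x hX hs)
  have h3 (X : ∀ x : B, TangentSpace I x) (hX : SmoothSec I E X x) := (hf.dirDeriv hX).smul hs
  rw [curvature, cov_congr ((h2 X hX).add (h3 X hX)) (h1 X),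
    cov_congr ((h2 Y hY).add (h3 Y hY)) (h1 Y), cov_smul hf hs, cov_add (h2 X hX) (h3 X hX),
    cov_add (h2 Y hY) (h3 Y hY), add_apply, add_apply, cov_smul hf (hD X s x hX hs),
    cov_smul hf (hD Y s x hY hs), cov_smul (hf.dirDeriv hX) hs, cov_smul (hf.dirDeriv hY) hs,
    mvfderiv_mlieBracket hf hX hY, curvature]
  module

lemma curvature_congr_left (h : ∀ᶠ y in 𝓝 x, X' y = X y) (hX : SmoothSec I E X x)
    (hs : SmoothSec I F s x) (hD : IsSmoothCov D) :
    curvature D X' Y s x = curvature D X Y s x := by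
  have h1 : ∀ᶠ y in 𝓝 x, D s y (X' y) = D s y (X y) := h.mono fun y hy => by rw [hy]
  rw [curvature, curvature, cov_congr (hD X s x hX hs) h1, mlieBracket_congr_left h,
    h.self_of_nhds]

lemma curvature_add_left (hs : SmoothSec I F s x)
    (hX : SmoothSec I E X x) (hX' : SmoothSec I E X' x) (hD : IsSmoothCov D) :
    curvature D (fun y => X y + X' y) Y s x = curvature D X Y s x + curvature D X' Y s x := by
  simp only [curvature, map_add]
  rw [cov_add (hD X s x hX hs) (hD X' s x hX' hs), mlieBracket_fun_add_left hX hX', map_add,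
    add_apply]
  abel

lemma curvature_smul_left (hf : SmoothNear I f x) (hs : SmoothSec I F s x)
    (hX : SmoothSec I E X x) (hD : IsSmoothCov D) :
    curvature D (fun y => f y • X y) Y s x = f x • curvature D X Y s x := by
  simp only [curvature, map_smul]
  rw [cov_smul hf (hD X s x hX hs), mlieBracket_fun_smul_left hf hX, map_add, map_smul, map_smul]
  module

end CurvatureTensor

section Sufficiency

variable {n : ℕ} {M : Type*} [TopologicalSpace M] [ChartedSpace (EuclideanSpace ℝ (Fin n)) M]
  [IsManifold (𝓡 n) ∞ M]
  {F : Type*} [NormedAddCommGroup F] [NormedSpace ℝ F] [FiniteDimensional ℝ F] [CompleteSpace F]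
  {V : M → Type*} [TopologicalSpace (TotalSpace F V)]
  [∀ x, AddCommGroup (V x)] [∀ x, Module ℝ (V x)] [∀ x, TopologicalSpace (V x)]
  [∀ x, IsTopologicalAddGroup (V x)] [∀ x, ContinuousSMul ℝ (V x)]
  [FiberBundle F V] [VectorBundle ℝ F V] [ContMDiffVectorBundle ∞ F V (𝓡 n)]
  {mulM : ∀ x : M, TangentSpace (𝓡 n) x →ₗ[ℝ] TangentSpace (𝓡 n) x →ₗ[ℝ] TangentSpace (𝓡 n) x}
  {eM : ∀ x : M, TangentSpace (𝓡 n) x}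
  {gM : ∀ x : M, LinearMap.BilinForm ℝ (TangentSpace (𝓡 n) x)}
  {mulV : ∀ x, V x →ₗ[ℝ] V x →ₗ[ℝ] V x} {eV : ∀ x, V x} {gV : ∀ x, LinearMap.BilinForm ℝ (V x)}
  {D : CovariantDerivative (𝓡 n) F V} {α : ∀ x, V x →ₗ[ℝ] TangentSpace (𝓡 n) x}
  {u : OpenPartialHomeomorph M (EuclideanSpace ℝ (Fin n))} {η : M → ℝ} {s : ∀ x, V x} {p : M}
  {nM : CovariantDerivative (𝓡 n) (EuclideanSpace ℝ (Fin n)) (TangentSpace (𝓡 n) : M → Type _)}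
  {v : TotalSpace F V} {l : ∀ x, V x →ₗ[ℝ] ℝ}

lemma cov_morphism (hl : IsSmoothFunctional (𝓡 n) F l) (hlD : IsParallelFunctional D l)
    (hM : IsAlmostFrobenius (𝓡 n) mulM eM gM) (hαl : ∀ x (v : V x), α x v = l x v • eM x)
    (he : ∀ x, nM eM x = 0) (hs : SmoothSec (𝓡 n) F s p) (ξ : TangentSpace (𝓡 n) p) :
    nM (fun y => α y (s y)) p ξ = α p (D s p ξ) := by
  simp only [hαl]
  rw [cov_smul (isSmoothFunctional_iff.1 hl s p hs) (hM.smoothSec_unit p), he,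
    isParallelFunctional_iff.1 hlD s p hs]
  simp

lemma torsion_totalConnection (hD : IsSmoothCov D) (hflat : IsFlat D) (hL : IsLeviCivita nM gM) :
    (totalConnection nM hD).torsion = 0 := by
  funext v
  have hHH (a b : TangentSpace (𝓡 n) v.proj) :
      (totalConnection nM hD).torsion v (horLift D v a) (horLift D v b) = 0 := by
    have ha := smoothSec_extend (𝓡 n) (EuclideanSpace ℝ (Fin n)) a
    have hb := smoothSec_extend (𝓡 n) (EuclideanSpace ℝ (Fin n)) b
    have key := (totalConnection nM hD).torsion_apply (smoothSec_horField hD ha).mdifferentiableAt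
      (smoothSec_horField hD hb).mdifferentiableAt
    rw [totalConnection_horField hD hb, totalConnection_horField hD ha, projDeriv_horField,
      projDeriv_horField, mlieBracket_horField_horField hD hflat ha hb, ← map_sub, ← map_sub,
      hL.torsion_free ha hb, sub_self, map_zero] at key
    simpa only [horField, extend_apply_self] using key
  have hHV (a : TangentSpace (𝓡 n) v.proj) (b : V v.proj) :
      (totalConnection nM hD).torsion v (horLift D v a) (vertLift (𝓡 n) v b) = 0 := by
    have ha := smoothSec_extend (𝓡 n) (EuclideanSpace ℝ (Fin n)) a
    have hb := smoothSec_extend (𝓡 n) F b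
    have key := (totalConnection nM hD).torsion_apply (smoothSec_horField hD ha).mdifferentiableAt
      (smoothSec_vertField hb).mdifferentiableAt
    rw [totalConnection_horField hD ha, totalConnection_vertField hD hb, projDeriv_horField,
      projDeriv_vertField, mlieBracket_horField_vertField hD ha hb, map_zero, map_zero, sub_zero,
      sub_self] at key
    simpa only [horField, vertField, extend_apply_self] using key
  have hVV (a b : V v.proj) :
      (totalConnection nM hD).torsion v (vertLift (𝓡 n) v a) (vertLift (𝓡 n) v b) = 0 := by
    have ha := smoothSec_extend (𝓡 n) F a
    have hb := smoothSec_extend (𝓡 n) F b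
    have key := (totalConnection nM hD).torsion_apply (smoothSec_vertField ha).mdifferentiableAt
      (smoothSec_vertField hb).mdifferentiableAt
    rw [totalConnection_vertField hD ha, totalConnection_vertField hD hb, projDeriv_vertField,
      projDeriv_vertField, mlieBracket_vertField_vertField ha hb] at key
    simp only [map_zero, sub_zero] at key
    simpa only [vertField, extend_apply_self] using key
  ext1 A
  ext1 B
  rw [← horLift_add_vertLift D A, ← horLift_add_vertLift D B]
  simp only [map_add, add_apply, hHH, hHV, hVV]
  rw [(totalConnection nM hD).torsion_antisymm, hHV]
  simp

lemma isParallelMetric_total (hD : IsSmoothCov D) (hM : IsAlmostFrobenius (𝓡 n) mulM eM gM)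
    (hV : IsFrobeniusAlgebraBundle (𝓡 n) F mulV eV gV) (hα : IsSmoothMorphism (𝓡 n) F α)
    (hαD : ∀ (s : ∀ x, V x) (p : M), SmoothSec (𝓡 n) F s p → ∀ ξ : TangentSpace (𝓡 n) p,
      nM (fun y => α y (s y)) p ξ = α p (D s p ξ))
    (hL : IsLeviCivita nM gM) (hP : IsParallelMetric D gV) :
    IsParallelMetric (totalConnection nM hD) (totalMetric D gM gV α) := by
  refine isParallelMetric_iff.2 fun A B v hA hB C => ?_
  have hα' (s) (hs : SmoothSec (𝓡 n) F s v.proj) := isSmoothMorphism_iff.1 hα s v.proj hs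
  have hHV (X : ∀ x : M, TangentSpace (𝓡 n) x) (t : ∀ x, V x)
      (hX : SmoothSec (𝓡 n) (EuclideanSpace ℝ (Fin n)) X v.proj)
      (ht : SmoothSec (𝓡 n) F t v.proj) :
      mvfderiv ((𝓡 n).prod 𝓘(ℝ, F))
        (fun w : TotalSpace F V => gM w.proj (α w.proj (t w.proj)) (X w.proj)) v C =
      gM v.proj (α v.proj (D t v.proj (projDeriv (𝓡 n) v C))) (X v.proj) +
      gM v.proj (α v.proj (t v.proj)) (nM X v.proj (projDeriv (𝓡 n) v C)) := by
    rw [mvfderiv_comp_proj (hM.smoothNear_metric (hα' t ht) hX), hL.metric (hα' t ht) hX,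
      hαD t _ ht]
  have step (A : ∀ w : TotalSpace F V, TangentSpace ((𝓡 n).prod 𝓘(ℝ, F)) w)
      (hA : SmoothSec ((𝓡 n).prod 𝓘(ℝ, F)) (EuclideanSpace ℝ (Fin n) × F) A v)
      (h : ∀ B, IsLift D v B → mvfderiv ((𝓡 n).prod 𝓘(ℝ, F))
        (fun w => totalMetric D gM gV α w (A w) (B w)) v C =
        totalMetric D gM gV α v (totalConnection nM hD A v C) (B v) +
        totalMetric D gM gV α v (A v) (totalConnection nM hD B v C)) :
      mvfderiv ((𝓡 n).prod 𝓘(ℝ, F)) (fun w => totalMetric D gM gV α w (A w) (B w)) v C =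
        totalMetric D gM gV α v (totalConnection nM hD A v C) (B v) +
        totalMetric D gM gV α v (A v) (totalConnection nM hD B v C) := by
    refine lift_induction (P := fun B => mvfderiv ((𝓡 n).prod 𝓘(ℝ, F))
        (fun w => totalMetric D gM gV α w (A w) (B w)) v C =
        totalMetric D gM gV α v (totalConnection nM hD A v C) (B v) +
        totalMetric D gM gV α v (A v) (totalConnection nM hD B v C)) hD
      (fun X hX => h _ (.inl ⟨X, hX, rfl⟩)) (fun s hs => h _ (.inr ⟨s, hs, rfl⟩))
      (fun B B' hB hB' h h' => ?_) (fun f B hf hB h => ?_) (fun B B' hB hBB h => ?_) B hB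
    · simp only [map_add]
      rw [mvfderiv_fun_add' (smoothNear_totalMetric hD hM hV hα hA hB)
        (smoothNear_totalMetric hD hM hV hα hA hB'), h, h', cov_add hB hB', add_apply, map_add]
      ring
    · simp only [map_smul, smul_eq_mul]
      rw [mvfderiv_fun_mul' hf (smoothNear_totalMetric hD hM hV hα hA hB), h, cov_smul hf hB,
        map_add, map_smul, map_smul, smul_eq_mul, smul_eq_mul]
      ring
    · rw [mvfderiv_congr (hBB.mono fun w hw => by rw [hw]), cov_congr hB hBB, hBB.self_of_nhds, h]
  refine lift_induction (P := fun A => mvfderiv ((𝓡 n).prod 𝓘(ℝ, F))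
      (fun w => totalMetric D gM gV α w (A w) (B w)) v C =
      totalMetric D gM gV α v (totalConnection nM hD A v C) (B v) +
      totalMetric D gM gV α v (A v) (totalConnection nM hD B v C)) hD
    (fun X hX => step _ (smoothSec_horField hD hX) fun B hB => ?_)
    (fun s hs => step _ (smoothSec_vertField hs) fun B hB => ?_)
    (fun A A' hA hA' h h' => ?_) (fun f A hf hA h => ?_) (fun A A' hA hAA h => ?_) A hA
  · rcases hB with ⟨Y, hY, rfl⟩ | ⟨t, ht, rfl⟩
    · simp only [totalMetric_horField_horField]
      rw [mvfderiv_comp_proj (hM.smoothNear_metric hX hY), hL.metric hX hY,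
        totalConnection_horField hD hX, totalConnection_horField hD hY]
      simp only [horField, totalMetric_horLift_horLift]
    · simp only [totalMetric_horField_vertField]
      rw [hHV X t hX ht, totalConnection_horField hD hX, totalConnection_vertField hD ht]
      simp only [horField, vertField, totalMetric_horLift_vertLift]
      ring
  · rcases hB with ⟨Y, hY, rfl⟩ | ⟨t, ht, rfl⟩
    · simp only [totalMetric_vertField_horField]
      rw [hHV Y s hY hs, totalConnection_horField hD hY, totalConnection_vertField hD hs]
      simp only [horField, vertField, totalMetric_vertLift_horLift]
    · simp only [totalMetric_vertField_vertField]
      rw [mvfderiv_comp_proj (hV.smoothNear_metric hs ht), isParallelMetric_iff.1 hP s t _ hs ht,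
        totalConnection_vertField hD hs, totalConnection_vertField hD ht]
      simp only [vertField, totalMetric_vertLift_vertLift]
  · simp only [map_add, LinearMap.add_apply]
    rw [mvfderiv_fun_add' (smoothNear_totalMetric hD hM hV hα hA hB)
      (smoothNear_totalMetric hD hM hV hα hA' hB), h, h', cov_add hA hA', add_apply, map_add,
      LinearMap.add_apply]
    ring
  · simp only [map_smul, smul_eq_mul, LinearMap.smul_apply]
    rw [mvfderiv_fun_mul' hf (smoothNear_totalMetric hD hM hV hα hA hB), h, cov_smul hf hA,
      map_add, map_smul, map_smul, LinearMap.add_apply, LinearMap.smul_apply,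
      LinearMap.smul_apply, smul_eq_mul, smul_eq_mul]
    ring
  · rw [mvfderiv_congr (hAA.mono fun w hw => by rw [hw]), cov_congr hA hAA, hAA.self_of_nhds, h]

lemma IsLift.exists_projDeriv {A : ∀ w : TotalSpace F V, TangentSpace ((𝓡 n).prod 𝓘(ℝ, F)) w}
    (hA : IsLift D v A) : ∃ X : ∀ x : M, TangentSpace (𝓡 n) x,
      SmoothSec (𝓡 n) (EuclideanSpace ℝ (Fin n)) X v.proj ∧
        ∀ w, projDeriv (𝓡 n) w (A w) = X w.proj := by
  rcases hA with ⟨X, hX, rfl⟩ | ⟨s, hs, rfl⟩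
  exacts [⟨X, hX, projDeriv_horField⟩, ⟨fun _ => 0, smoothSec_zero, projDeriv_vertField⟩]

lemma isFlat_total (hD : IsSmoothCov D) (hflat : IsFlat D) (hnM : IsSmoothCov nM)
    (hflatM : IsFlat nM)
    (hT : IsSmoothCov (totalConnection nM hD)) : IsFlat (totalConnection nM hD) := by
  refine isFlat_iff.2 fun A A' S v hA hA' hS => ?_
  have base (A A' S) (hA : IsLift D v A) (hA' : IsLift D v A') (hS : IsLift D v S) :
      curvature (totalConnection nM hD) A A' S v = 0 := by
    obtain ⟨X, hX, hAX⟩ := hA.exists_projDeriv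
    obtain ⟨Y, hY, hAY⟩ := hA'.exists_projDeriv
    have hb := projDeriv_mlieBracket (hA.smoothSec hD) (hA'.smoothSec hD) hX hY hAX hAY
    rcases hS with ⟨Z, hZ, rfl⟩ | ⟨s, hs, rfl⟩
    · have h1 (A : ∀ w : TotalSpace F V, TangentSpace ((𝓡 n).prod 𝓘(ℝ, F)) w)
          (X : ∀ x : M, TangentSpace (𝓡 n) x) (hAX : ∀ w, projDeriv (𝓡 n) w (A w) = X w.proj) :
          ∀ᶠ w in 𝓝 v, totalConnection nM hD (horField D Z) w (A w) =
            horField D (fun y => nM Z y (X y)) w := by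
        filter_upwards [eventually_proj hZ.eventually] with w hw
        rw [totalConnection_horField hD hw, hAX]
        rfl
      have h2 (X : ∀ x : M, TangentSpace (𝓡 n) x)
          (hX : SmoothSec (𝓡 n) (EuclideanSpace ℝ (Fin n)) X v.proj) := hnM X Z _ hX hZ
      rw [curvature, cov_congr (smoothSec_horField hD (h2 X hX)) (h1 A X hAX),
        cov_congr (smoothSec_horField hD (h2 Y hY)) (h1 A' Y hAY),
        totalConnection_horField hD (h2 X hX), totalConnection_horField hD (h2 Y hY),
        totalConnection_horField hD hZ, hAX, hAY, hb, ← map_sub, ← map_sub]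
      have h3 := isFlat_iff.1 hflatM X Y Z _ hX hY hZ
      rw [curvature] at h3
      rw [h3, map_zero]
    · have h1 (A : ∀ w : TotalSpace F V, TangentSpace ((𝓡 n).prod 𝓘(ℝ, F)) w)
          (X : ∀ x : M, TangentSpace (𝓡 n) x) (hAX : ∀ w, projDeriv (𝓡 n) w (A w) = X w.proj) :
          ∀ᶠ w in 𝓝 v, totalConnection nM hD (vertField (𝓡 n) s) w (A w) =
            vertField (𝓡 n) (fun y => D s y (X y)) w := by
        filter_upwards [eventually_proj hs.eventually] with w hw
        rw [totalConnection_vertField hD hw, hAX]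
        rfl
      have h2 (X : ∀ x : M, TangentSpace (𝓡 n) x)
          (hX : SmoothSec (𝓡 n) (EuclideanSpace ℝ (Fin n)) X v.proj) := hD X s _ hX hs
      rw [curvature, cov_congr (smoothSec_vertField (h2 X hX)) (h1 A X hAX),
        cov_congr (smoothSec_vertField (h2 Y hY)) (h1 A' Y hAY),
        totalConnection_vertField hD (h2 X hX), totalConnection_vertField hD (h2 Y hY),
        totalConnection_vertField hD hs, hAX, hAY, hb, ← map_sub, ← map_sub]
      have h3 := isFlat_iff.1 hflat X Y s _ hX hY hs
      rw [curvature] at h3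
      rw [h3, map_zero]
  have step (A' S) (hA' : SmoothSec ((𝓡 n).prod 𝓘(ℝ, F)) (EuclideanSpace ℝ (Fin n) × F) A' v)
      (hS : SmoothSec ((𝓡 n).prod 𝓘(ℝ, F)) (EuclideanSpace ℝ (Fin n) × F) S v)
      (h : ∀ A, IsLift D v A → curvature (totalConnection nM hD) A A' S v = 0) (A)
      (hA : SmoothSec ((𝓡 n).prod 𝓘(ℝ, F)) (EuclideanSpace ℝ (Fin n) × F) A v) :
      curvature (totalConnection nM hD) A A' S v = 0 := by
    refine lift_induction (P := fun A => curvature (totalConnection nM hD) A A' S v = 0) hD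
      (fun X hX => h _ (.inl ⟨X, hX, rfl⟩)) (fun s hs => h _ (.inr ⟨s, hs, rfl⟩))
      (fun X X' hX hX' h1 h2 => ?_) (fun f X hf hX h1 => ?_) (fun X X' hX hXX h1 => ?_) A hA
    · rw [curvature_add_left hS hX hX' hT, h1, h2, add_zero]
    · rw [curvature_smul_left hf hS hX hT, h1, smul_zero]
    · rw [curvature_congr_left hXX hX hS hT, h1]
  refine step A' S hA' hS (fun A hA => ?_) A hA
  rw [curvature_swap, neg_eq_zero]
  refine step A S (hA.smoothSec hD) hS (fun A' hA' => ?_) A' hA'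
  refine lift_induction (P := fun S => curvature (totalConnection nM hD) A' A S v = 0) hD
    (fun X hX => base _ _ _ hA' hA (.inl ⟨X, hX, rfl⟩))
    (fun s hs => base _ _ _ hA' hA (.inr ⟨s, hs, rfl⟩))
    (fun S S' hS hS' h1 h2 => ?_) (fun f S hf hS h1 => ?_) (fun S S' hS hSS h1 => ?_) S hS
  · rw [curvature_add hS hS' (hA'.smoothSec hD) (hA.smoothSec hD) hT, h1, h2, add_zero]
  · rw [curvature_smul hf hS (hA'.smoothSec hD) (hA.smoothSec hD) hT, h1, smul_zero]
  · rw [curvature_congr hS hSS (hA'.smoothSec hD) (hA.smoothSec hD) hT, h1]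

lemma IsMetricPotential.metric_self (hη : IsMetricPotential gM u η)
    (hu : u ∈ IsManifold.maximalAtlas (𝓡 n) ∞ M) (hp : p ∈ u.source)
    (ξ : TangentSpace (𝓡 n) p) : gM p ξ ξ =
      ∑ k, mvfderiv (𝓡 n) (fun q => u q k) p ξ ^ 2 * coordDeriv u k η p := by
  conv_lhs => rw [← sum_coordField hu hp ξ]
  rw [map_sum, sum_coordField hu hp ξ]
  refine Finset.sum_congr rfl fun k _ => ?_
  rw [map_smul, hη.metric_coordField hu hp, smul_eq_mul]
  ring

lemma isPosDef_totalMetric (hM : IsAlmostFrobenius (𝓡 n) mulM eM gM)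
    (hV : IsFrobeniusAlgebraBundle (𝓡 n) F mulV eV gV)
    (hαl : ∀ x (v : V x), α x v = l x v • eM x)
    (hc : IsCanonical mulM u) (hη : IsMetricPotential gM u η) (hp : v.proj ∈ u.source)
    (hpos : ∀ k : Fin n, 0 < coordDeriv u k η v.proj)
    (hposV : IsPosDef (gV v.proj - (∑ k : Fin n, coordDeriv u k η v.proj) •
      LinearMap.BilinForm.linMulLin (l v.proj) (l v.proj))) :
    IsPosDef (totalMetric D gM gV α v) := by
  have hgM (ξ : TangentSpace (𝓡 n) v.proj) : 0 ≤ gM v.proj ξ ξ := by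
    rw [hη.metric_self hc.1 hp]
    exact Finset.sum_nonneg fun k _ => mul_nonneg (sq_nonneg _) (hpos k).le
  have hgM' (ξ : TangentSpace (𝓡 n) v.proj) (h : gM v.proj ξ ξ = 0) : ξ = 0 := by
    rw [hη.metric_self hc.1 hp, Finset.sum_eq_zero_iff_of_nonneg
      fun k _ => mul_nonneg (sq_nonneg _) (hpos k).le] at h
    refine tangent_ext_chart hc.1 hp fun k => ?_
    have := (mul_eq_zero.1 (h k (Finset.mem_univ k))).resolve_right (hpos k).ne'
    rw [pow_eq_zero_iff two_ne_zero] at this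
    rw [this, map_zero]
  refine ⟨⟨fun A B => ?_⟩, fun A hA => ?_⟩
  · simp only [totalMetric_apply]
    rw [hM.symm (projDeriv _ v A), hV.symm]
    ring
  · set ξ := projDeriv (𝓡 n) v A
    set w := vertPart D v A
    have h1 : totalMetric D gM gV α v A A = gM v.proj (ξ + α v.proj w) (ξ + α v.proj w) +
        (gV v.proj - (∑ k : Fin n, coordDeriv u k η v.proj) •
          LinearMap.BilinForm.linMulLin (l v.proj) (l v.proj)) w w := by
      rw [totalMetric_apply, ← hη.metric_unit_unit hc hM hp]
      simp only [LinearMap.sub_apply, LinearMap.smul_apply, LinearMap.BilinForm.linMulLin_apply,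
        smul_eq_mul, map_add, LinearMap.add_apply]
      rw [hM.symm ξ (α v.proj w), hαl]
      simp only [map_smul, LinearMap.smul_apply, smul_eq_mul]
      ring
    rw [h1]
    by_cases hw : w = 0
    · have hξ : ξ ≠ 0 := fun hξ => hA (tangent_total_ext' D (by rw [map_zero]; exact hξ)
        (by rw [map_zero]; exact hw))
      rw [hw]
      simp only [map_zero, add_zero]
      exact lt_of_le_of_ne (hgM ξ) fun h => hξ (hgM' ξ h.symm)
    · exact add_pos_of_nonneg_of_pos (hgM _) (hposV.2 w hw)

/-- Parallel data give a Frobenius structure on the total space. -/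
theorem isFrobenius_of_conditions
    (hM : IsSemisimpleFrobeniusWithRotation mulM eM gM)
    (hV : IsFrobeniusAlgebraBundle (𝓡 n) F mulV eV gV) (hD : IsSmoothCov D)
    (hα : IsSmoothMorphism (𝓡 n) F α) (hα_unit : ∀ x, α x (eV x) = eM x)
    (hα_mul : ∀ x (v w : V x), α x (mulV x v w) = mulM x (α x v) (α x w))
    (hflat : IsFlat D) (hpar : IsParallelFrobeniusAlgebra D mulV eV gV)
    (hl : IsSmoothFunctional (𝓡 n) F l) (hlD : IsParallelFunctional D l)
    (hlmul : ∀ x (v w : V x), l x (mulV x v w) = l x v * l x w)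
    (hαl : ∀ x (v : V x), α x v = l x v • eM x)
    (hpos : ∀ (u : OpenPartialHomeomorph M (EuclideanSpace ℝ (Fin n))) (η : M → ℝ),
        IsCanonical mulM u → IsMetricPotential gM u η → ∀ p ∈ u.source,
          (∀ k : Fin n, 0 < coordDeriv u k η p) ∧
          IsPosDef (gV p - (∑ k : Fin n, coordDeriv u k η p) •
            LinearMap.BilinForm.linMulLin (l p) (l p))) :
    IsFrobenius ((𝓡 n).prod 𝓘(ℝ, F)) (totalMul D mulM mulV α) (totalUnit (𝓡 n) eV)
      (totalMetric D gM gV α) ∧ ∀ v, IsPosDef (totalMetric D gM gV α v) := by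
  have hMA := hM.1.almostFrobenius
  obtain ⟨nM, hL, he, hflatM⟩ := hM.1.admissible_flat
  have hposT (v : TotalSpace F V) : IsPosDef (totalMetric D gM gV α v) := by
    obtain ⟨u, η, hu, hc, hη, -⟩ := hM.2 v.proj
    have h := hpos u η hc hη v.proj hu
    exact isPosDef_totalMetric hMA hV hαl hc hη hu h.1 h.2
  have hA := isAlmostFrobenius_total hD hMA hV hα hα_unit hα_mul hposT
  have hLT : IsLeviCivita (totalConnection nM hD) (totalMetric D gM gV α) :=
    ⟨torsion_totalConnection hD hflat hL, isParallelMetric_total hD hMA hV hα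
      (fun _ _ hs ξ => cov_morphism hl hlD hMA hαl he hs ξ) hL hpar.2.2⟩
  refine ⟨⟨hA, isFMultiplication_total hD hMA hM.1.fMultiplication hV hα hA hflat hpar.1 hl hlD
    hlmul hαl, totalConnection nM hD, hLT, fun v => ?_,
    isFlat_total hD hflat (hL.isSmoothCov hMA) hflatM (hLT.isSmoothCov hA)⟩, hposT⟩
  ext1 C
  have h := totalConnection_vertField (nM := nM) (v := v) hD (hV.smoothSec_unit v.proj) C
  rw [hpar.2.1, zero_apply, map_zero] at h
  exact h

end Sufficiency

end FrobBundle

end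

theorem theorem4p5 {n : ℕ} (hn : 0 < n)
    {M : Type*} [TopologicalSpace M] [T2Space M] [ChartedSpace (EuclideanSpace ℝ (Fin n)) M]
    [IsManifold (𝓡 n) ∞ M]
    {F : Type*} [NormedAddCommGroup F] [NormedSpace ℝ F] [FiniteDimensional ℝ F]
    {V : M → Type*} [TopologicalSpace (TotalSpace F V)]
    [∀ x, AddCommGroup (V x)] [∀ x, Module ℝ (V x)] [∀ x, TopologicalSpace (V x)]
    [∀ x, IsTopologicalAddGroup (V x)] [∀ x, ContinuousSMul ℝ (V x)]
    [FiberBundle F V] [VectorBundle ℝ F V] [ContMDiffVectorBundle ∞ F V (𝓡 n)]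
    (mulM : ∀ x : M, TangentSpace (𝓡 n) x →ₗ[ℝ] TangentSpace (𝓡 n) x →ₗ[ℝ] TangentSpace (𝓡 n) x)
    (eM : ∀ x : M, TangentSpace (𝓡 n) x)
    (gM : ∀ x : M, LinearMap.BilinForm ℝ (TangentSpace (𝓡 n) x))
    (hM : FrobBundle.IsSemisimpleFrobeniusWithRotation mulM eM gM)
    (mulV : ∀ x, V x →ₗ[ℝ] V x →ₗ[ℝ] V x) (eV : ∀ x, V x)
    (gV : ∀ x, LinearMap.BilinForm ℝ (V x))
    (hV : FrobBundle.IsFrobeniusAlgebraBundle (𝓡 n) F mulV eV gV)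
    (D : CovariantDerivative (𝓡 n) F V) (hD : CovariantDerivative.ContMDiffCovariantDerivative D ∞)
    (α : ∀ x, V x →ₗ[ℝ] TangentSpace (𝓡 n) x)
    (hα : FrobBundle.IsSmoothMorphism (𝓡 n) F α)
    (hα_unit : ∀ x, α x (eV x) = eM x)
    (hα_mul : ∀ x (v w : V x), α x (mulV x v w) = mulM x (α x v) (α x w)) :
    (FrobBundle.IsFrobenius ((𝓡 n).prod 𝓘(ℝ, F)) (M := TotalSpace F V)
        (FrobBundle.totalMul D mulM mulV α) (FrobBundle.totalUnit (𝓡 n) eV)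
        (FrobBundle.totalMetric D gM gV α) ∧
      ∀ v : TotalSpace F V, FrobBundle.IsPosDef (FrobBundle.totalMetric D gM gV α v)) ↔
    (FrobBundle.IsFlat D ∧ FrobBundle.IsParallelFrobeniusAlgebra D mulV eV gV) ∧
    ∃ l : ∀ x, V x →ₗ[ℝ] ℝ,
      (FrobBundle.IsSmoothFunctional (𝓡 n) F l ∧ FrobBundle.IsParallelFunctional D l ∧
        (∀ x, l x (eV x) = 1) ∧ (∀ x (v w : V x), l x (mulV x v w) = l x v * l x w) ∧
        ∀ x (v : V x), α x v = l x v • eM x) ∧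
      ∀ (u : OpenPartialHomeomorph M (EuclideanSpace ℝ (Fin n))) (η : M → ℝ),
        FrobBundle.IsCanonical mulM u → FrobBundle.IsMetricPotential gM u η → ∀ p ∈ u.source,
          (∀ k : Fin n, 0 < FrobBundle.coordDeriv u k η p) ∧
          FrobBundle.IsPosDef (gV p - (∑ k : Fin n, FrobBundle.coordDeriv u k η p) •
            LinearMap.BilinForm.linMulLin (l p) (l p)) := by
  have : CompleteSpace F := FiniteDimensional.complete ℝ F
  have hD' := FrobBundle.isSmoothCov_of_contMDiff D hD
  constructor
  · rintro ⟨hT, hpos⟩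
    exact FrobBundle.conditions_of_isFrobenius hn hM hV hD' hα hα_unit hα_mul hT hpos
  · rintro ⟨⟨hflat, hpar⟩, l, ⟨hl, hlD, -, hlmul, hαl⟩, hpos⟩
    exact FrobBundle.isFrobenius_of_conditions hM hV hD' hα hα_unit hα_mul hflat hpar hl hlD
      hlmul hαl hpos
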